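/- Let $T>0$, $a\le b$, $\eta_0\in L^2(\mathbb R)$ and $\varepsilon,M>0$, and put $s=2+\varepsilon$. For a bounded open interval $I$, let $H^s(I)$ carry the Sobolev–Slobodeckij norm: with $m=\lfloor s\rfloor$, $\|f\|_{H^s(I)}^2=\sum_{k=0}^m\|f^{(k)}\|_{L^2(I)}^2$ plus, if $s\notin\mathbb N$, $\iint_{I\times I}\frac{|f^{(m)}(x)-f^{(m)}(y)|^2}{|x-y|^{1+2(s-m)}}\,dx\,dy$ (weak derivatives), and let $H^s_0(I)$ be the closure of $C_c^\infty(I)$ in $H^s(I)$. Let $$B_M=\bigl\{(x_0,\zeta_0)\in H^{s}(0,T)\times H^{s}_0(0,1):\ \|x_0\|_{H^s(0,T)}^2+\|\zeta_0\|_{H^s(0,1)}^2\le M^2\bigr\}.$$ For $(x_0,\zeta_0)\in B_M$ put $\zeta(x,t)=\zeta_0(x-x_0(t))$, where $\zeta_0$ is extended by zero outside $[0,1]$. Then the generalized forced BBM problem $$\eta_t+\Bigl(\eta+\tfrac34\eta^2-\tfrac12\zeta\eta\Bigr)_x-\tfrac16\eta_{xxt}=-\tfrac14\zeta_{xtt}+\tfrac12\zeta_t\quad\text{in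 }\mathcal D'(\mathbb R\times(0,T)),\qquad \eta(\cdot,0)=\eta_0,$$ has exactly one solution $\eta\in C([0,T];L^2(\mathbb R))$, and the cost $$J(x_0,\zeta_0)=-\int_{[a,b]}\eta(x,T)^2\,dx$$ attains its infimum on $B_M$: there is $(x_0^*,\zeta_0^*)\in B_M$ with $J(x_0^*,\zeta_0^*)=\inf_{B_M}J$. -/

import Mathlib

open MeasureTheory Set
open scoped ENNReal ContDiff

noncomputable section

/-- A test function on the open interval `(a, b)`: smooth, with compact support in `(a, b)`. -/
def IsTestFun (a b : ℝ) (φ : ℝ → ℝ) : Prop :=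
  ContDiff ℝ ∞ φ ∧ HasCompactSupport φ ∧ tsupport φ ⊆ Ioo a b

/-- `g` is the `k`-th weak derivative of `f` on the open interval `(a, b)`. -/
def IsWeakDeriv (a b : ℝ) (k : ℕ) (f g : ℝ → ℝ) : Prop :=
  LocallyIntegrableOn f (Ioo a b) ∧ LocallyIntegrableOn g (Ioo a b) ∧
    ∀ φ : ℝ → ℝ, IsTestFun a b φ →
      ∫ x in Ioo a b, f x * iteratedDeriv k φ x = (-1) ^ k * ∫ x in Ioo a b, g x * φ x

/-- The Gagliardo (Sobolev–Slobodeckij) double integral of order `σ` on `(a, b)`. -/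
def gagliardoSq (σ a b : ℝ) (g : ℝ → ℝ) : ℝ≥0∞ :=
  ∫⁻ x in Ioo a b, ∫⁻ y in Ioo a b, ENNReal.ofReal ((g x - g y) ^ 2 / |x - y| ^ (1 + 2 * σ))

/-- The square of the Sobolev–Slobodeckij norm of `f` in `H^s(a, b)`, `s ≥ 0`: with `m = ⌊s⌋`,
the sum of the squared `L²` norms of the weak derivatives of order `0, …, m`, plus, if `s` is not
an integer, the Gagliardo double integral of order `s - m` of the `m`-th weak derivative.
Weak derivatives are unique up to null sets, so the infimum is over a single value; it is `⊤` if
some weak derivative of order at most `m` does not exist. -/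
def sobolevSq (s a b : ℝ) (f : ℝ → ℝ) : ℝ≥0∞ :=
  ⨅ (g : ℕ → ℝ → ℝ) (_ : ∀ k ≤ ⌊s⌋₊, IsWeakDeriv a b k f (g k)),
    ((∑ k ∈ Finset.range (⌊s⌋₊ + 1), ∫⁻ x in Ioo a b, ENNReal.ofReal (g k x ^ 2)) +
      if s = ⌊s⌋₊ then 0 else gagliardoSq (s - ⌊s⌋₊) a b (g ⌊s⌋₊))

/-- `H^s(a, b)`. Its elements are represented by functions on `ℝ`, of which only the
almost everywhere class on `(a, b)` matters. -/
def sobolevH (s a b : ℝ) : Set (ℝ → ℝ) :=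
  {f | sobolevSq s a b f < ⊤}

/-- `H^s_0(a, b)`: the closure of the test functions on `(a, b)` in `H^s(a, b)`. -/
def sobolevH0 (s a b : ℝ) : Set (ℝ → ℝ) :=
  {f | f ∈ sobolevH s a b ∧
    ∀ δ : ℝ≥0∞, 0 < δ → ∃ φ : ℝ → ℝ, IsTestFun a b φ ∧ sobolevSq s a b (f - φ) < δ}

/-- The closed ball of radius `M` about the origin of the Hilbert space
`H^s(0, T) × H^s_0(0, 1)`. -/
def controlBall (s T M : ℝ) : Set ((ℝ → ℝ) × (ℝ → ℝ)) :=
  {p | p.1 ∈ sobolevH s 0 T ∧ p.2 ∈ sobolevH0 s 0 1 ∧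
    sobolevSq s 0 T p.1 + sobolevSq s 0 1 p.2 ≤ ENNReal.ofReal (M ^ 2)}

/-- The moving bottom `ζ(x, t) = ζ₀(x - x₀(t))`, with the shape `ζ₀` extended by zero outside
`[0, 1]`. The argument `p` is the pair `(x₀, ζ₀)`; the time is the first variable. -/
def bottom (p : (ℝ → ℝ) × (ℝ → ℝ)) (t x : ℝ) : ℝ :=
  (Icc (0 : ℝ) 1).indicator p.2 (x - p.1 t)

/-- `η ∈ C([0, T]; L²(ℝ))` solves
`η_t + (η + (3/4) η² - (1/2) ζ η)_x - (1/6) η_xxt = -(1/4) ζ_xtt + (1/2) ζ_t`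
in the sense of distributions on `(0, T) × ℝ`, with `η(0) = η₀`.
The functions `ζ` and `φ` have the time as their first variable. -/
def IsSolution (T : ℝ) (η₀ : Lp ℝ 2 (volume : Measure ℝ)) (ζ : ℝ → ℝ → ℝ)
    (η : ℝ → Lp ℝ 2 (volume : Measure ℝ)) : Prop :=
  ContinuousOn η (Icc 0 T) ∧ η 0 = η₀ ∧
    ∀ φ : ℝ → ℝ → ℝ, ContDiff ℝ ∞ (fun q : ℝ × ℝ => φ q.1 q.2) →
      HasCompactSupport (fun q : ℝ × ℝ => φ q.1 q.2) →
      tsupport (fun q : ℝ × ℝ => φ q.1 q.2) ⊆ Ioo 0 T ×ˢ univ →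
      ∫ t in Ioo 0 T, ∫ x,
          (-(η t x * deriv (fun r => φ r x) t)
            - (η t x + 3 / 4 * η t x ^ 2 - 1 / 2 * ζ t x * η t x) * deriv (φ t) x
            + 1 / 6 * η t x * deriv (fun r => iteratedDeriv 2 (φ r) x) t)
        = ∫ t in Ioo 0 T, ∫ x,
          (1 / 4 * ζ t x * iteratedDeriv 2 (fun r => deriv (φ r) x) t
            - 1 / 2 * ζ t x * deriv (fun r => φ r x) t)

open Classical in
/-- The solution for the bottom `ζ` on `[0, T]`; the value `0` is used only if there is none. -/
def solution (T : ℝ) (η₀ : Lp ℝ 2 (volume : Measure ℝ)) (ζ : ℝ → ℝ → ℝ) :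
    ℝ → Lp ℝ 2 (volume : Measure ℝ) :=
  if h : ∃ η, IsSolution T η₀ ζ η then h.choose else 0

/-- The cost `J(x₀, ζ₀) = -∫_[a,b] η(x, T)² dx`. -/
def cost (T a b : ℝ) (η₀ : Lp ℝ 2 (volume : Measure ℝ)) (p : (ℝ → ℝ) × (ℝ → ℝ)) : ℝ :=
  -∫ x in Icc a b, solution T η₀ (bottom p) T x ^ 2

end

/-! Write A = (1 - ∂ₓ²/6)⁻¹ and B = ∂ₓA, convolutions with bounded integrable kernels. B maps L² and
also L¹ into L², so a flux that is only a sum of an L² and an L¹ function is harmless. Applying A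
and integrating in time gives η(t) = a(t) - ∫₀ᵗ B(flux), with a = η₀ + F - F(0). The forcing costs
no derivative of ζ: since ζ_t = -x₀' ζ_x and ∂ₓ²A = 6(A - 1) is bounded on L², its primitive is F =
(3/2) x₀' (A - 1)ζ + (1/2) Aζ, which needs only a C¹ path and an L² shape. The weak and the
integrated problem are equivalent (`ControlRep.isSolution_iff_isMild`), because the functions ψ -
ψ''/6 are dense in L² (`dense_helm`) and du Bois-Reymond applies in time.

The natural BBM energy is an H¹ norm, while the data are only L². Hence the splitting η = a + r -
Bn: r carries the part of the flux built from a alone, which is only L¹, and n solves an ordinary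
differential equation in L² with a locally Lipschitz field (`fluxOp_eq`). With z = Bn one has ‖z‖² +
‖z'‖²/6 = -⟨z', n⟩ (`energy_identity`); the term of highest degree in its time derivative is a
multiple of ∫ z² z' = 0 (`inner_cubic`), and Gronwall bounds the energy, then n (`apriori_bound`,
`exists_mild`). A second Gronwall argument gives Lipschitz dependence on a and ζ, hence uniqueness
(`mild_lipschitz`, `IsMild.eqOn`).

For the minimum, H^s is embedded isometrically as a closed subspace of a product of L² spaces
(derivatives and weighted difference quotient). Bounded sets are weakly relatively compact, the ball
is weakly closed, and the values of x₀, x₀', ζ₀ at a point are inner products with vectors depending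
continuously on the point. Weak convergence therefore makes x₀, x₀' converge uniformly and ζ₀ in L²
(`TendstoWeakly.tendstoUniformlyOn`); then a and ζ converge uniformly in time, η(T) converges in L²
(`tendsto_isMild`) and so does the cost. Thus the set of costs is compact (`isCompact_image_cost`)
and has a least element. -/

noncomputable section

/-! ### Young's inequalities and convolution operators between Lebesgue spaces -/

/-- The Hilbert space `L²(ℝ)`. -/
abbrev L2 : Type := Lp ℝ 2 (volume : Measure ℝ)

/-- The Cauchy–Schwarz inequality with a weight. -/
lemma lintegral_mul_sq_le {α : Type*} [MeasurableSpace α] (μ : Measure α) {w u v : α → ℝ≥0∞}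
    (hw : Measurable w) (hu : Measurable u) (hv : Measurable v) :
    (∫⁻ x, w x * (u x * v x) ∂μ) ^ 2 ≤ (∫⁻ x, w x * u x ^ 2 ∂μ) * ∫⁻ x, w x * v x ^ 2 ∂μ := by
  have h := ENNReal.lintegral_mul_le_Lp_mul_Lq (μ.withDensity w)
    (Real.HolderConjugate.two_two) hu.aemeasurable hv.aemeasurable
  have e1 : ∀ f : α → ℝ≥0∞, Measurable f → ∫⁻ x, f x ∂(μ.withDensity w) = ∫⁻ x, w x * f x ∂μ :=
    fun f hf => lintegral_withDensity_eq_lintegral_mul μ hw hf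
  simp only [Pi.mul_apply] at h
  rw [show ∫⁻ x, u x * v x ∂(μ.withDensity w) = _ from e1 _ (hu.mul hv), e1 _ (hu.pow_const _), e1 _ (hv.pow_const _)] at h
  simp only [ENNReal.rpow_two] at h
  calc _ ≤ _ := pow_le_pow_left' h 2
    _ = _ := by
      rw [mul_pow, ← ENNReal.rpow_two, ← ENNReal.rpow_two, ← ENNReal.rpow_mul, ← ENNReal.rpow_mul]
      norm_num

/-- Convolution of nonnegative functions. -/
def lconv (κ f : ℝ → ℝ≥0∞) (x : ℝ) : ℝ≥0∞ := ∫⁻ y, κ (x - y) * f y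

lemma measurable_lconv {κ f : ℝ → ℝ≥0∞} (hκ : Measurable κ) (hf : Measurable f) :
    Measurable (lconv κ f) := by
  unfold lconv
  exact Measurable.lintegral_prod_right'
    (f := fun p : ℝ × ℝ => κ (p.1 - p.2) * f p.2) (by fun_prop)

lemma lconv_sq_le_mul {κ f : ℝ → ℝ≥0∞} (hκ : Measurable κ) (hf : Measurable f) (x : ℝ) :
    lconv κ f x ^ 2 ≤ (∫⁻ y, κ y ^ 2) * ∫⁻ y, f y ^ 2 := by
  have h := lintegral_mul_sq_le volume (w := fun _ => 1) (u := fun y => κ (x - y)) (v := f)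
    measurable_const (by fun_prop) hf
  simp only [one_mul] at h
  rwa [lintegral_sub_left_eq_self (fun y => κ y ^ 2) x] at h

lemma lintegral_lconv {κ f : ℝ → ℝ≥0∞} (hκ : Measurable κ) (hf : Measurable f) :
    ∫⁻ x, lconv κ f x = (∫⁻ y, κ y) * ∫⁻ y, f y := by
  unfold lconv
  rw [lintegral_lintegral_swap (by fun_prop)]
  rw [← lintegral_const_mul _ hf]
  congr 1; ext y
  rw [lintegral_mul_const _ (show Measurable fun x => κ (x - y) by fun_prop),
    lintegral_sub_right_eq_self κ y]

/-- Cauchy–Schwarz with weight κ(x - y), applied to 1 · f, bounds the square by ‖κ‖₁ (κ * f²);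
Tonelli does the rest. This is Young's inequality L¹ * L² → L². -/
lemma lintegral_lconv_sq_le {κ f : ℝ → ℝ≥0∞} (hκ : Measurable κ) (hf : Measurable f) :
    ∫⁻ x, lconv κ f x ^ 2 ≤ (∫⁻ y, κ y) ^ 2 * ∫⁻ y, f y ^ 2 := by
  have h : ∀ x, lconv κ f x ^ 2 ≤ (∫⁻ y, κ y) * lconv κ (fun y => f y ^ 2) x := fun x => by
    have h := lintegral_mul_sq_le volume (w := fun y => κ (x - y)) (u := fun _ => 1) (v := f)
      (by fun_prop) measurable_const hf
    simp only [one_mul, one_pow, mul_one] at h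
    rwa [lintegral_sub_left_eq_self κ x] at h
  calc _ ≤ ∫⁻ x, (∫⁻ y, κ y) * lconv κ (fun y => f y ^ 2) x := lintegral_mono h
    _ = _ := by
      rw [lintegral_const_mul _ (measurable_lconv hκ (hf.pow_const 2)),
        lintegral_lconv hκ (hf.pow_const 2), sq, mul_assoc]

/-- The same argument with f as the weight, for f in L¹ and a square integrable kernel. It is what
allows L¹ products as inputs. -/
lemma lintegral_lconv_sq_le' {κ f : ℝ → ℝ≥0∞} (hκ : Measurable κ) (hf : Measurable f) :
    ∫⁻ x, lconv κ f x ^ 2 ≤ (∫⁻ y, κ y ^ 2) * (∫⁻ y, f y) ^ 2 := by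
  have h : ∀ x, lconv κ f x ^ 2 ≤ lconv (fun y => κ y ^ 2) f x * (∫⁻ y, f y) := fun x => by
    have h := lintegral_mul_sq_le volume (w := f) (u := fun y => κ (x - y)) (v := fun _ => 1)
      hf (by fun_prop) measurable_const
    simp only [one_pow, mul_one] at h
    simpa only [lconv, mul_comm (f _)] using h
  calc _ ≤ ∫⁻ x, lconv (fun y => κ y ^ 2) f x * (∫⁻ y, f y) := lintegral_mono h
    _ = _ := by
      rw [lintegral_mul_const _ (measurable_lconv (hκ.pow_const 2) hf),
        lintegral_lconv (hκ.pow_const 2) hf, mul_assoc, ← sq]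

lemma lconv_le {κ f : ℝ → ℝ≥0∞} (hf : Measurable f) {C : ℝ≥0∞}
    (hC : ∀ x, κ x ≤ C) (x : ℝ) : lconv κ f x ≤ C * ∫⁻ y, f y := by
  rw [← lintegral_const_mul _ hf]
  exact lintegral_mono fun y => mul_le_mul_left (hC _) _

/-- A bounded integrable convolution kernel. -/
structure IsKernel (k : ℝ → ℝ) : Prop where
  measurable : Measurable k
  integrable : Integrable k
  bdd : ∃ C : ℝ, ∀ x, |k x| ≤ C

namespace IsKernel

variable {k : ℝ → ℝ}

lemma memLp_two (hk : IsKernel k) : MemLp k 2 := by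
  obtain ⟨C, hC⟩ := hk.bdd
  rw [memLp_two_iff_integrable_sq hk.measurable.aestronglyMeasurable]
  refine (hk.integrable.bdd_mul (c := C) hk.measurable.aestronglyMeasurable
    (Filter.Eventually.of_forall hC)).congr (Filter.Eventually.of_forall fun x => ?_)
  simp [sq]

lemma lintegral_lt_top (hk : IsKernel k) : ∫⁻ x, ‖k x‖ₑ < ⊤ := hk.integrable.2

end IsKernel

lemma lintegral_enorm_sq_lt_top {α : Type*} [MeasurableSpace α] {μ : Measure α} {f : α → ℝ}
    (hf : MemLp f 2 μ) : ∫⁻ x, ‖f x‖ₑ ^ 2 ∂μ < ⊤ := by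
  have := (eLpNorm_lt_top_iff_lintegral_rpow_enorm_lt_top two_ne_zero ENNReal.ofNat_ne_top).1 hf.2
  simpa using this

lemma eLpNorm_two_sq {α : Type*} [MeasurableSpace α] (μ : Measure α) (f : α → ℝ) :
    eLpNorm f 2 μ ^ 2 = ∫⁻ x, ‖f x‖ₑ ^ 2 ∂μ := by
  rw [eLpNorm_eq_lintegral_rpow_enorm_toReal two_ne_zero ENNReal.ofNat_ne_top]
  rw [← ENNReal.rpow_two, ← ENNReal.rpow_mul]
  norm_num

/-- Convolution with the kernel `k`. -/
def conv (k f : ℝ → ℝ) (x : ℝ) : ℝ := ∫ y, k (x - y) * f y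

lemma enorm_conv_le (k f : ℝ → ℝ) (x : ℝ) :
    ‖conv k f x‖ₑ ≤ lconv (fun y => ‖k y‖ₑ) (fun y => ‖f y‖ₑ) x :=
  (enorm_integral_le_lintegral_enorm _).trans_eq (by simp only [enorm_mul]; rfl)

lemma stronglyMeasurable_conv {k f : ℝ → ℝ} (hk : Measurable k) (hf : Measurable f) :
    StronglyMeasurable (conv k f) :=
  StronglyMeasurable.integral_prod_right'
    (f := fun p : ℝ × ℝ => k (p.1 - p.2) * f p.2)
    (Measurable.stronglyMeasurable (by fun_prop))

lemma conv_congr_ae {k f g : ℝ → ℝ} (h : f =ᵐ[volume] g) : conv k f = conv k g := by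
  ext x
  exact integral_congr_ae (h.mono fun y hy => by simp [hy])

/-- The convolution with `k` is well defined and bounded from `Lᵖ` to `L^q`. -/
structure ConvBound (k : ℝ → ℝ) (p q : ℝ≥0∞) : Prop where
  measurable : Measurable k
  lt_top : ∀ f : ℝ → ℝ, Measurable f → MemLp f p → ∀ x,
    lconv (fun y => ‖k y‖ₑ) (fun y => ‖f y‖ₑ) x < ⊤
  bound : ∃ C : ℝ≥0∞, C ≠ ⊤ ∧ ∀ f : ℝ → ℝ, Measurable f → MemLp f p →
    eLpNorm (conv k f) q ≤ C * eLpNorm f p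

namespace ConvBound

variable {k : ℝ → ℝ} {p q : ℝ≥0∞}

lemma integrable (h : ConvBound k p q) {f : ℝ → ℝ} (hf : Measurable f) (hfp : MemLp f p)
    (x : ℝ) : Integrable fun y => k (x - y) * f y := by
  have := h.measurable
  refine ⟨Measurable.aestronglyMeasurable (by fun_prop), ?_⟩
  simpa only [HasFiniteIntegral, enorm_mul, lconv] using h.lt_top f hf hfp x

lemma memLp (h : ConvBound k p q) (f : Lp ℝ p (volume : Measure ℝ)) : MemLp (conv k f) q := by
  refine ⟨(stronglyMeasurable_conv h.measurable
    (Lp.stronglyMeasurable f).measurable).aestronglyMeasurable, ?_⟩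
  obtain ⟨C, hC, hb⟩ := h.bound
  exact (hb f (Lp.stronglyMeasurable f).measurable (Lp.memLp f)).trans_lt
    (ENNReal.mul_lt_top hC.lt_top (Lp.memLp f).2)

variable [Fact (1 ≤ p)] [Fact (1 ≤ q)]

/-- The convolution with `k` as a bounded operator from `Lᵖ` to `L^q`. -/
def toCLM (h : ConvBound k p q) :
    Lp ℝ p (volume : Measure ℝ) →L[ℝ] Lp ℝ q (volume : Measure ℝ) :=
  LinearMap.mkContinuous
    { toFun := fun f => (h.memLp f).toLp _
      map_add' := fun f g => by
        rw [← MemLp.toLp_add]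
        refine (MemLp.toLp_eq_toLp_iff _ _).2 (Filter.Eventually.of_forall fun x => ?_)
        rw [conv_congr_ae (Lp.coeFn_add f g)]
        simp only [conv, Pi.add_apply, mul_add]
        exact integral_add
          (h.integrable (Lp.stronglyMeasurable f).measurable (Lp.memLp f) x)
          (h.integrable (Lp.stronglyMeasurable g).measurable (Lp.memLp g) x)
      map_smul' := fun c f => by
        rw [RingHom.id_apply, ← MemLp.toLp_const_smul]
        refine (MemLp.toLp_eq_toLp_iff _ _).2 (Filter.Eventually.of_forall fun x => ?_)
        rw [conv_congr_ae (Lp.coeFn_smul c f)]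
        simp only [conv, Pi.smul_apply, smul_eq_mul, mul_left_comm _ c]
        exact integral_const_mul _ _ }
    h.bound.choose.toReal
    (fun f => by
      obtain ⟨hC, hb⟩ := h.bound.choose_spec
      simp only [LinearMap.coe_mk, AddHom.coe_mk]
      rw [Lp.norm_toLp, Lp.norm_def, ← ENNReal.toReal_mul]
      exact ENNReal.toReal_mono (ENNReal.mul_ne_top hC (Lp.eLpNorm_ne_top f))
        (hb f (Lp.stronglyMeasurable f).measurable (Lp.memLp f)))

lemma coeFn_toCLM (h : ConvBound k p q) (f : Lp ℝ p (volume : Measure ℝ)) :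
    h.toCLM f =ᵐ[volume] conv k f :=
  (h.memLp f).coeFn_toLp

end ConvBound

namespace IsKernel

variable {k : ℝ → ℝ}

lemma lconv_two_lt_top (hk : IsKernel k) {f : ℝ → ℝ} (hf : Measurable f) (hf2 : MemLp f 2)
    (x : ℝ) : lconv (fun y => ‖k y‖ₑ) (fun y => ‖f y‖ₑ) x < ⊤ := by
  have h := lconv_sq_le_mul (κ := fun y => ‖k y‖ₑ) (f := fun y => ‖f y‖ₑ)
    hk.measurable.enorm hf.enorm x
  have h2 := h.trans_lt (ENNReal.mul_lt_top (lintegral_enorm_sq_lt_top hk.memLp_two)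
    (lintegral_enorm_sq_lt_top hf2))
  by_contra hn
  rw [not_lt, top_le_iff] at hn
  rw [hn] at h2
  simp at h2

lemma lconv_one_le (hk : IsKernel k) :
    ∃ C : ℝ≥0∞, C ≠ ⊤ ∧ ∀ f : ℝ → ℝ, Measurable f → ∀ x,
      lconv (fun y => ‖k y‖ₑ) (fun y => ‖f y‖ₑ) x ≤ C * eLpNorm f 1 := by
  obtain ⟨C, hC⟩ := hk.bdd
  refine ⟨ENNReal.ofReal C, ENNReal.ofReal_ne_top, fun f hf x => ?_⟩
  rw [eLpNorm_one_eq_lintegral_enorm]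
  exact lconv_le hf.enorm (fun x => by
    rw [Real.enorm_eq_ofReal_abs]; exact ENNReal.ofReal_le_ofReal (hC x)) x

lemma lconv_one_lt_top (hk : IsKernel k) {f : ℝ → ℝ} (hf : Measurable f) (hf1 : MemLp f 1)
    (x : ℝ) : lconv (fun y => ‖k y‖ₑ) (fun y => ‖f y‖ₑ) x < ⊤ := by
  obtain ⟨C, hC, h⟩ := hk.lconv_one_le
  exact (h f hf x).trans_lt (ENNReal.mul_lt_top hC.lt_top hf1.2)

lemma bound_two_two (hk : IsKernel k) : ConvBound k 2 2 := by
  refine ⟨hk.measurable, fun f hf hf2 => hk.lconv_two_lt_top hf hf2,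
    ∫⁻ y, ‖k y‖ₑ, hk.lintegral_lt_top.ne, fun f hf hf2 => ?_⟩
  rw [← ENNReal.pow_le_pow_left_iff two_ne_zero, mul_pow, eLpNorm_two_sq, eLpNorm_two_sq]
  exact (lintegral_mono fun x => pow_le_pow_left' (enorm_conv_le k f x) 2).trans
    (lintegral_lconv_sq_le hk.measurable.enorm hf.enorm)

lemma bound_one_two (hk : IsKernel k) : ConvBound k 1 2 := by
  refine ⟨hk.measurable, fun f hf hf2 => hk.lconv_one_lt_top hf hf2,
    eLpNorm k 2 volume, hk.memLp_two.2.ne, fun f hf hf2 => ?_⟩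
  rw [← ENNReal.pow_le_pow_left_iff two_ne_zero, mul_pow, eLpNorm_two_sq, eLpNorm_two_sq,
    eLpNorm_one_eq_lintegral_enorm]
  exact (lintegral_mono fun x => pow_le_pow_left' (enorm_conv_le k f x) 2).trans
    (lintegral_lconv_sq_le' hk.measurable.enorm hf.enorm)

lemma bound_two_top (hk : IsKernel k) : ConvBound k 2 ⊤ := by
  refine ⟨hk.measurable, fun f hf hf2 => hk.lconv_two_lt_top hf hf2,
    eLpNorm k 2 volume, hk.memLp_two.2.ne, fun f hf hf2 => ?_⟩
  rw [eLpNorm_exponent_top]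
  refine eLpNormEssSup_le_of_ae_enorm_bound (Filter.Eventually.of_forall fun x => ?_)
  rw [← ENNReal.pow_le_pow_left_iff two_ne_zero, mul_pow, eLpNorm_two_sq, eLpNorm_two_sq]
  exact (pow_le_pow_left' (enorm_conv_le k f x) 2).trans
    (lconv_sq_le_mul hk.measurable.enorm hf.enorm x)

lemma bound_one_top (hk : IsKernel k) : ConvBound k 1 ⊤ := by
  obtain ⟨C, hC, h⟩ := hk.lconv_one_le
  refine ⟨hk.measurable, fun f hf hf2 => hk.lconv_one_lt_top hf hf2, C, hC, fun f hf hf2 => ?_⟩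
  rw [eLpNorm_exponent_top]
  exact eLpNormEssSup_le_of_ae_enorm_bound (Filter.Eventually.of_forall fun x =>
    (enorm_conv_le k f x).trans (h f hf x))

/-- The adjoint of a convolution, when the double integral converges absolutely. -/
lemma integral_conv_mul (hk : IsKernel k) {f g : ℝ → ℝ} (hf : Measurable f) (hg : Measurable g)
    (hfin : ∫⁻ x, lconv (fun y => ‖k y‖ₑ) (fun y => ‖f y‖ₑ) x * ‖g x‖ₑ < ⊤) :
    ∫ x, conv k f x * g x = ∫ y, f y * conv (fun z => k (-z)) g y := by
  have hk' := hk.measurable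
  have hint : Integrable (Function.uncurry fun x y => k (x - y) * f y * g x)
      (volume.prod volume) := by
    refine ⟨Measurable.aestronglyMeasurable (by unfold Function.uncurry; fun_prop), ?_⟩
    rw [HasFiniteIntegral, lintegral_prod _ (by unfold Function.uncurry; fun_prop)]
    refine lt_of_eq_of_lt (lintegral_congr fun x => ?_) hfin
    simp only [Function.uncurry, enorm_mul, lconv]
    rw [lintegral_mul_const _ (by fun_prop)]
  have h1 : ∀ x, conv k f x * g x = ∫ y, k (x - y) * f y * g x := fun x => by
    rw [conv, integral_mul_const]
  have h2 : ∀ y, f y * conv (fun z => k (-z)) g y = ∫ x, k (x - y) * f y * g x := fun y => by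
    rw [conv, ← integral_const_mul]
    congr 1; ext x
    rw [neg_sub]; ring
  simp_rw [h1, h2]
  exact integral_integral_swap hint

lemma integral_conv_mul_two (hk : IsKernel k) {f g : ℝ → ℝ} (hf : Measurable f)
    (hg : Measurable g) (hf2 : MemLp f 2) (hg2 : MemLp g 2) :
    ∫ x, conv k f x * g x = ∫ y, f y * conv (fun z => k (-z)) g y := by
  refine hk.integral_conv_mul hf hg ?_
  have h := lintegral_mul_sq_le volume (w := fun _ => 1)
    (u := lconv (fun y => ‖k y‖ₑ) (fun y => ‖f y‖ₑ)) (v := fun x => ‖g x‖ₑ) measurable_const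
    (measurable_lconv hk.measurable.enorm hf.enorm) hg.enorm
  simp only [one_mul] at h
  have h2 := h.trans_lt (ENNReal.mul_lt_top
    ((lintegral_lconv_sq_le hk.measurable.enorm hf.enorm).trans_lt
      (ENNReal.mul_lt_top (ENNReal.pow_lt_top hk.lintegral_lt_top)
        (lintegral_enorm_sq_lt_top hf2))) (lintegral_enorm_sq_lt_top hg2))
  by_contra hn
  rw [not_lt, top_le_iff] at hn
  rw [hn] at h2
  simp at h2

lemma integral_conv_mul_one_two (hk : IsKernel k) {f g : ℝ → ℝ} (hf : Measurable f)
    (hg : Measurable g) (hf1 : MemLp f 1) (hg2 : MemLp g 2) :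
    ∫ x, conv k f x * g x = ∫ y, f y * conv (fun z => k (-z)) g y := by
  refine hk.integral_conv_mul hf hg ?_
  have h := lintegral_mul_sq_le volume (w := fun _ => 1)
    (u := lconv (fun y => ‖k y‖ₑ) (fun y => ‖f y‖ₑ)) (v := fun x => ‖g x‖ₑ) measurable_const
    (measurable_lconv hk.measurable.enorm hf.enorm) hg.enorm
  simp only [one_mul] at h
  have hf1' : ∫⁻ y, ‖f y‖ₑ < ⊤ := (memLp_one_iff_integrable.1 hf1).2
  have h2 := h.trans_lt (ENNReal.mul_lt_top
    ((lintegral_lconv_sq_le' hk.measurable.enorm hf.enorm).trans_lt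
      (ENNReal.mul_lt_top (lintegral_enorm_sq_lt_top hk.memLp_two)
        (ENNReal.pow_lt_top hf1'))) (lintegral_enorm_sq_lt_top hg2))
  by_contra hn
  rw [not_lt, top_le_iff] at hn
  rw [hn] at h2
  simp at h2

end IsKernel

end

/-! ### The Green's function of 1 - ∂ₓ²/6 and the operators A, B, D -/

noncomputable section

/-- The space `L¹(ℝ)`. -/
abbrev L1 : Type := Lp ℝ 1 (volume : Measure ℝ)

/-- The space `L^∞(ℝ)`. -/
abbrev Linf : Type := Lp ℝ ⊤ (volume : Measure ℝ)

open Classical in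
/-- The class in `L²(ℝ)` of a square integrable function. -/
def toL2 (f : ℝ → ℝ) : L2 := if h : MemLp f 2 then h.toLp f else 0

lemma coeFn_toL2 {f : ℝ → ℝ} (h : MemLp f 2) : toL2 f =ᵐ[volume] f := by
  rw [toL2, dif_pos h]; exact h.coeFn_toLp

lemma eq_toL2 {f : ℝ → ℝ} {u : L2} (h : u =ᵐ[volume] f) : u = toL2 f :=
  Lp.ext (h.trans (coeFn_toL2 ((memLp_congr_ae h).1 (Lp.memLp u))).symm)

lemma inner_L2 (f g : L2) : inner ℝ f g = ∫ x, f x * g x := by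
  rw [L2.inner_def]
  simp [mul_comm]

lemma inner_L2_eq {f g : L2} {u v : ℝ → ℝ} (hf : f =ᵐ[volume] u) (hg : g =ᵐ[volume] v) :
    inner ℝ f g = ∫ x, u x * v x := by
  rw [inner_L2]
  exact integral_congr_ae (by filter_upwards [hf, hg] with x h1 h2; rw [h1, h2])

/-- The product of two elements of `L²`, an element of `L¹`. -/
def mulTwo : L2 →L[ℝ] L2 →L[ℝ] L1 := (ContinuousLinearMap.mul ℝ ℝ).holderL volume 2 2 1

/-- The multiplication of an element of `L²` by a bounded function. -/
def mulTop : Linf →L[ℝ] L2 →L[ℝ] L2 := (ContinuousLinearMap.mul ℝ ℝ).holderL volume ⊤ 2 2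

lemma coeFn_mulTwo (f g : L2) : mulTwo f g =ᵐ[volume] fun x => f x * g x :=
  ContinuousLinearMap.coeFn_holder _ _ _

lemma coeFn_mulTop (f : Linf) (g : L2) : mulTop f g =ᵐ[volume] fun x => f x * g x :=
  ContinuousLinearMap.coeFn_holder _ _ _

lemma norm_mulTwo_le (f g : L2) : ‖mulTwo f g‖ ≤ ‖f‖ * ‖g‖ := by
  have h := ContinuousLinearMap.norm_holder_apply_apply_le (r := 1)
    (ContinuousLinearMap.mul ℝ ℝ) f g
  rw [ContinuousLinearMap.opNorm_mul, one_mul] at h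
  exact h

lemma norm_mulTop_le (f : Linf) (g : L2) : ‖mulTop f g‖ ≤ ‖f‖ * ‖g‖ := by
  have h := ContinuousLinearMap.norm_holder_apply_apply_le (r := 2)
    (ContinuousLinearMap.mul ℝ ℝ) f g
  rw [ContinuousLinearMap.opNorm_mul, one_mul] at h
  exact h

/-- The pairing of `L¹` and `L^∞`. -/
def pairing (h : L1) (m : Linf) : ℝ := ∫ x, h x * m x

/-- The decay rate `√6` of the Green's function of `1 - ∂ₓ²/6`. -/
def rate : ℝ := √6

lemma rate_pos : 0 < rate := Real.sqrt_pos.2 (by norm_num)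

lemma rate_sq : rate * rate = 6 := Real.mul_self_sqrt (by norm_num)

/-- The Green's function of `1 - ∂ₓ²/6`. -/
def kerA (x : ℝ) : ℝ := rate / 2 * Real.exp (-(rate * |x|))

/-- The derivative of the Green's function of `1 - ∂ₓ²/6`. -/
def kerB (x : ℝ) : ℝ := -3 * (Real.sign x * Real.exp (-(rate * |x|)))

lemma measurable_sign : Measurable Real.sign := by
  unfold Real.sign
  exact Measurable.ite measurableSet_Iio measurable_const
    (Measurable.ite measurableSet_Ioi measurable_const measurable_const)

lemma abs_sign_le (x : ℝ) : |Real.sign x| ≤ 1 := by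
  rcases Real.sign_apply_eq x with h | h | h <;> simp [h]

lemma integrable_exp_neg_rate : Integrable fun x : ℝ => Real.exp (-(rate * |x|)) := by
  rw [← integrableOn_univ, ← Iic_union_Ioi (a := (0 : ℝ))]
  refine IntegrableOn.union ?_ ?_
  · refine (integrableOn_exp_mul_Iic rate_pos 0).congr_fun (fun x hx => ?_) measurableSet_Iic
    simp only [abs_of_nonpos (mem_Iic.1 hx), mul_neg, neg_neg]
  · refine (integrableOn_exp_mul_Ioi (neg_neg_of_pos rate_pos) 0).congr_fun (fun x hx => ?_)
      measurableSet_Ioi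
    simp only [abs_of_pos (mem_Ioi.1 hx), neg_mul]

lemma exp_neg_rate_le (x : ℝ) : Real.exp (-(rate * |x|)) ≤ 1 :=
  Real.exp_le_one_iff.2 (neg_nonpos.2 (mul_nonneg rate_pos.le (abs_nonneg x)))

lemma isKernel_kerA : IsKernel kerA := by
  refine ⟨by unfold kerA; fun_prop, integrable_exp_neg_rate.const_mul _, rate / 2, fun x => ?_⟩
  rw [kerA, abs_mul, abs_of_pos (Real.exp_pos _), abs_of_pos (half_pos rate_pos)]
  exact mul_le_of_le_one_right (half_pos rate_pos).le (exp_neg_rate_le x)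

lemma isKernel_kerB : IsKernel kerB := by
  refine ⟨?_, ?_, 3, fun x => ?_⟩
  · unfold kerB
    exact (measurable_sign.mul (by fun_prop)).const_mul _
  · exact (integrable_exp_neg_rate.bdd_mul (c := 1) measurable_sign.aestronglyMeasurable
      (Filter.Eventually.of_forall abs_sign_le)).const_mul _
  · rw [kerB, abs_mul, abs_mul, abs_of_pos (Real.exp_pos _)]
    have := abs_sign_le x
    have := exp_neg_rate_le x
    have := Real.exp_pos (-(rate * |x|))
    have h3 : |(-3 : ℝ)| = 3 := by norm_num
    rw [h3]
    nlinarith [abs_nonneg (Real.sign x)]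

lemma kerA_neg (x : ℝ) : kerA (-x) = kerA x := by simp [kerA]

lemma kerB_neg (x : ℝ) : kerB (-x) = -kerB x := by simp [kerB, Real.sign_neg]

/-- `(1 - ∂ₓ²/6)⁻¹` on `L²`. -/
def opA : L2 →L[ℝ] L2 := isKernel_kerA.bound_two_two.toCLM

/-- `(1 - ∂ₓ²/6)⁻¹` from `L²` to `L^∞`. -/
def opAtop : L2 →L[ℝ] Linf := isKernel_kerA.bound_two_top.toCLM

/-- `∂ₓ (1 - ∂ₓ²/6)⁻¹` on `L²`. -/
def opB : L2 →L[ℝ] L2 := isKernel_kerB.bound_two_two.toCLM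

/-- `∂ₓ (1 - ∂ₓ²/6)⁻¹` from `L²` to `L^∞`. -/
def opBtop : L2 →L[ℝ] Linf := isKernel_kerB.bound_two_top.toCLM

/-- `∂ₓ (1 - ∂ₓ²/6)⁻¹` from `L¹` to `L²`. -/
def opB₁ : L1 →L[ℝ] L2 := isKernel_kerB.bound_one_two.toCLM

/-- `∂ₓ (1 - ∂ₓ²/6)⁻¹` from `L¹` to `L^∞`. -/
def opB₁top : L1 →L[ℝ] Linf := isKernel_kerB.bound_one_top.toCLM

/-- `∂ₓ² (1 - ∂ₓ²/6)⁻¹` on `L²`. -/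
def opD : L2 →L[ℝ] L2 := (6 : ℝ) • (opA - ContinuousLinearMap.id ℝ L2)

lemma opD_apply (f : L2) : opD f = (6 : ℝ) • (opA f - f) := rfl

lemma coeFn_opA (f : L2) : opA f =ᵐ[volume] conv kerA f := ConvBound.coeFn_toCLM _ f
lemma coeFn_opAtop (f : L2) : opAtop f =ᵐ[volume] conv kerA f := ConvBound.coeFn_toCLM _ f
lemma coeFn_opB (f : L2) : opB f =ᵐ[volume] conv kerB f := ConvBound.coeFn_toCLM _ f
lemma coeFn_opBtop (f : L2) : opBtop f =ᵐ[volume] conv kerB f := ConvBound.coeFn_toCLM _ f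
lemma coeFn_opB₁ (f : L1) : opB₁ f =ᵐ[volume] conv kerB f := ConvBound.coeFn_toCLM _ f
lemma coeFn_opB₁top (f : L1) : opB₁top f =ᵐ[volume] conv kerB f := ConvBound.coeFn_toCLM _ f

lemma opBtop_ae_eq (f : L2) : opBtop f =ᵐ[volume] opB f :=
  (coeFn_opBtop f).trans (coeFn_opB f).symm

lemma opB₁top_ae_eq (f : L1) : opB₁top f =ᵐ[volume] opB₁ f :=
  (coeFn_opB₁top f).trans (coeFn_opB₁ f).symm

/-- Products are formed in L¹; when one of them happens to lie in L², this brings it back under the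
L² operator. -/
lemma opB₁_eq_opB {h : L1} {f : L2} (hf : h =ᵐ[volume] f) : opB₁ h = opB f := by
  refine Lp.ext ((coeFn_opB₁ h).trans ?_)
  rw [conv_congr_ae hf]
  exact (coeFn_opB f).symm

lemma inner_opA (f g : L2) : inner ℝ (opA f) g = inner ℝ f (opA g) := by
  rw [inner_L2_eq (coeFn_opA f) (Filter.EventuallyEq.refl _ g),
    inner_L2_eq (Filter.EventuallyEq.refl _ f) (coeFn_opA g),
    isKernel_kerA.integral_conv_mul_two (Lp.stronglyMeasurable f).measurable
    (Lp.stronglyMeasurable g).measurable (Lp.memLp f) (Lp.memLp g)]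
  simp only [kerA_neg]

lemma conv_kerB_neg (g : ℝ → ℝ) (y : ℝ) :
    conv (fun z => kerB (-z)) g y = -conv kerB g y := by
  simp only [conv, kerB_neg, neg_mul, integral_neg]

lemma inner_opB (f g : L2) : inner ℝ (opB f) g = -inner ℝ f (opB g) := by
  rw [inner_L2_eq (coeFn_opB f) (Filter.EventuallyEq.refl _ g),
    inner_L2_eq (Filter.EventuallyEq.refl _ f) (coeFn_opB g),
    isKernel_kerB.integral_conv_mul_two (Lp.stronglyMeasurable f).measurable
    (Lp.stronglyMeasurable g).measurable (Lp.memLp f) (Lp.memLp g)]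
  simp only [conv_kerB_neg, mul_neg, integral_neg]

/-- B is antisymmetric because its kernel is odd; with one factor in L¹, the other must be moved to
L^∞. -/
lemma inner_opB₁ (h : L1) (g : L2) : inner ℝ (opB₁ h) g = -pairing h (opBtop g) := by
  rw [inner_L2_eq (coeFn_opB₁ h) (Filter.EventuallyEq.refl _ g), pairing,
    isKernel_kerB.integral_conv_mul_one_two (Lp.stronglyMeasurable h).measurable
    (Lp.stronglyMeasurable g).measurable (Lp.memLp h) (Lp.memLp g)]
  simp only [conv_kerB_neg, mul_neg, integral_neg]
  rw [integral_congr_ae]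
  filter_upwards [coeFn_opBtop g] with x hx
  rw [hx]

lemma inner_opD (f g : L2) : inner ℝ (opD f) g = inner ℝ f (opD g) := by
  simp only [opD_apply, inner_smul_left, inner_smul_right, inner_sub_left, inner_sub_right,
    inner_opA]
  simp

/-- The fundamental theorem of calculus for y ↦ exp(-(rate (x - y))) ψ(y) on (-∞, x]. Together with
its mirror image on (x, ∞) it replaces differentiation of kernels that have a kink or a jump at the
origin. -/
lemma integral_Iic_exp_mul {ψ : ℝ → ℝ} (h1 : ContDiff ℝ 1 ψ) (hc : HasCompactSupport ψ) (x : ℝ) :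
    rate * (∫ y in Iic x, Real.exp (-(rate * (x - y))) * ψ y)
      + ∫ y in Iic x, Real.exp (-(rate * (x - y))) * deriv ψ y = ψ x := by
  have hd : ∀ y, deriv (fun y => Real.exp (-(rate * (x - y))) * ψ y) y
      = rate * (Real.exp (-(rate * (x - y))) * ψ y)
        + Real.exp (-(rate * (x - y))) * deriv ψ y := fun y => by
    have he : HasDerivAt (fun y => Real.exp (-(rate * (x - y))))
        (Real.exp (-(rate * (x - y))) * rate) y := by
      have := (((hasDerivAt_id y).const_sub x).const_mul rate).neg.exp
      simpa using this
    rw [deriv_fun_mul he.differentiableAt (h1.differentiable one_ne_zero y), he.deriv]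
    ring
  have hc' := h1.continuous
  have hc'' := h1.continuous_deriv le_rfl
  have h := HasCompactSupport.integral_Iic_deriv_eq
    (f := fun y => Real.exp (-(rate * (x - y))) * ψ y)
    (ContDiff.mul (by fun_prop) h1) hc.mul_left x
  simp only [hd] at h
  rw [integral_add, integral_const_mul] at h
  · simpa using h
  · exact ((Continuous.integrable_of_hasCompactSupport (by fun_prop)
      hc.mul_left).const_mul _).integrableOn
  · exact (Continuous.integrable_of_hasCompactSupport (by fun_prop)
      hc.deriv.mul_left).integrableOn

lemma integral_Ioi_exp_mul {ψ : ℝ → ℝ} (h1 : ContDiff ℝ 1 ψ) (hc : HasCompactSupport ψ) (x : ℝ) :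
    -rate * (∫ y in Ioi x, Real.exp (-(rate * (y - x))) * ψ y)
      + ∫ y in Ioi x, Real.exp (-(rate * (y - x))) * deriv ψ y = -ψ x := by
  have hd : ∀ y, deriv (fun y => Real.exp (-(rate * (y - x))) * ψ y) y
      = -rate * (Real.exp (-(rate * (y - x))) * ψ y)
        + Real.exp (-(rate * (y - x))) * deriv ψ y := fun y => by
    have he : HasDerivAt (fun y => Real.exp (-(rate * (y - x))))
        (Real.exp (-(rate * (y - x))) * -rate) y := by
      have := (((hasDerivAt_id y).sub_const x).const_mul rate).neg.exp
      simpa using this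
    rw [deriv_fun_mul he.differentiableAt (h1.differentiable one_ne_zero y), he.deriv]
    ring
  have hc' := h1.continuous
  have hc'' := h1.continuous_deriv le_rfl
  have h := HasCompactSupport.integral_Ioi_deriv_eq
    (f := fun y => Real.exp (-(rate * (y - x))) * ψ y)
    (ContDiff.mul (by fun_prop) h1) hc.mul_left x
  simp only [hd] at h
  rw [integral_add, integral_const_mul] at h
  · simpa using h
  · exact ((Continuous.integrable_of_hasCompactSupport (by fun_prop)
      hc.mul_left).const_mul _).integrableOn
  · exact (Continuous.integrable_of_hasCompactSupport (by fun_prop)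
      hc.deriv.mul_left).integrableOn

lemma conv_split {k ψ : ℝ → ℝ} {c d : ℝ} {x : ℝ} (hint : Integrable fun y => k (x - y) * ψ y)
    (hpos : ∀ z, 0 < z → k z = c * Real.exp (-(rate * z)))
    (hneg : ∀ z, z < 0 → k z = d * Real.exp (-(rate * -z))) :
    conv k ψ x = c * (∫ y in Iic x, Real.exp (-(rate * (x - y))) * ψ y)
      + d * ∫ y in Ioi x, Real.exp (-(rate * (y - x))) * ψ y := by
  rw [conv, ← intervalIntegral.integral_Iic_add_Ioi (b := x) hint.integrableOn hint.integrableOn,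
    ← integral_const_mul, ← integral_const_mul, integral_Iic_eq_integral_Iio,
    integral_Iic_eq_integral_Iio]
  congr 1
  · refine setIntegral_congr_fun measurableSet_Iio fun y hy => ?_
    rw [hpos _ (sub_pos.2 hy)]; ring
  · refine setIntegral_congr_fun measurableSet_Ioi fun y hy => ?_
    rw [hneg _ (sub_neg.2 hy), neg_sub]; ring

lemma integrable_kernel_mul {k ψ : ℝ → ℝ} (hk : IsKernel k) (hψ : Continuous ψ)
    (hc : HasCompactSupport ψ) (x : ℝ) : Integrable fun y => k (x - y) * ψ y :=
  hk.bound_two_two.integrable hψ.measurable (hψ.memLp_of_hasCompactSupport hc) x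

lemma conv_kerA_eq {ψ : ℝ → ℝ} (hψ : Continuous ψ) (hc : HasCompactSupport ψ) (x : ℝ) :
    conv kerA ψ x = rate / 2 * (∫ y in Iic x, Real.exp (-(rate * (x - y))) * ψ y)
      + rate / 2 * ∫ y in Ioi x, Real.exp (-(rate * (y - x))) * ψ y :=
  conv_split (integrable_kernel_mul isKernel_kerA hψ hc x)
    (fun z hz => by rw [kerA, abs_of_pos hz]) (fun z hz => by rw [kerA, abs_of_neg hz])

lemma conv_kerB_eq {ψ : ℝ → ℝ} (hψ : Continuous ψ) (hc : HasCompactSupport ψ) (x : ℝ) :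
    conv kerB ψ x = -3 * (∫ y in Iic x, Real.exp (-(rate * (x - y))) * ψ y)
      + 3 * ∫ y in Ioi x, Real.exp (-(rate * (y - x))) * ψ y :=
  conv_split (integrable_kernel_mul isKernel_kerB hψ hc x)
    (fun z hz => by rw [kerB, abs_of_pos hz, Real.sign_of_pos hz]; ring)
    (fun z hz => by rw [kerB, abs_of_neg hz, Real.sign_of_neg hz]; ring)

lemma conv_kerA_deriv {ψ : ℝ → ℝ} (h1 : ContDiff ℝ 1 ψ) (hc : HasCompactSupport ψ) (x : ℝ) :
    conv kerA (deriv ψ) x = conv kerB ψ x := by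
  rw [conv_kerA_eq (h1.continuous_deriv le_rfl) hc.deriv, conv_kerB_eq h1.continuous hc]
  -- The boundary values ±ψ(x) from the two half-lines cancel, and rate²/2 = 3 is the constant in
  -- `kerB`.
  linear_combination (rate / 2) * integral_Iic_exp_mul h1 hc x
    + (rate / 2) * integral_Ioi_exp_mul h1 hc x
    + (1 / 2) * ((∫ y in Ioi x, Real.exp (-(rate * (y - x))) * ψ y)
      - ∫ y in Iic x, Real.exp (-(rate * (x - y))) * ψ y) * rate_sq

/-- The Green's function equation Aψ - (1/6)∂ₓ²Aψ = ψ with one derivative moved onto ψ. Here the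
boundary values of the two half-lines add up to ψ(x): the jump of `kerB` is the Dirac mass. -/
lemma conv_kerA_sub {ψ : ℝ → ℝ} (h1 : ContDiff ℝ 1 ψ) (hc : HasCompactSupport ψ) (x : ℝ) :
    conv kerA ψ x - 1 / 6 * conv kerB (deriv ψ) x = ψ x := by
  rw [conv_kerB_eq (h1.continuous_deriv le_rfl) hc.deriv, conv_kerA_eq h1.continuous hc]
  linear_combination (1 / 2) * integral_Iic_exp_mul h1 hc x
    - (1 / 2) * integral_Ioi_exp_mul h1 hc x

end

/-! ### Density of the functions ψ - ψ''/6 and the identities it yields -/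

noncomputable section

/-- A smooth function with compact support. -/
structure IsBump (ψ : ℝ → ℝ) : Prop where
  smooth : ContDiff ℝ ∞ ψ
  compact : HasCompactSupport ψ

namespace IsBump

variable {ψ φ : ℝ → ℝ}

lemma deriv (h : IsBump ψ) : IsBump (deriv ψ) :=
  ⟨(contDiff_infty_iff_deriv.1 h.smooth).2, h.compact.deriv⟩

lemma contDiff_one (h : IsBump ψ) : ContDiff ℝ 1 ψ := h.smooth.of_le (by norm_cast)

lemma continuous (h : IsBump ψ) : Continuous ψ := h.smooth.continuous

lemma differentiable (h : IsBump ψ) : Differentiable ℝ ψ := h.smooth.differentiable (by simp)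

lemma memLp (h : IsBump ψ) (p : ℝ≥0∞) : MemLp ψ p :=
  h.continuous.memLp_of_hasCompactSupport h.compact

lemma integrable (h : IsBump ψ) : Integrable ψ :=
  h.continuous.integrable_of_hasCompactSupport h.compact

lemma coeFn (h : IsBump ψ) : toL2 ψ =ᵐ[volume] ψ := coeFn_toL2 (h.memLp 2)

lemma const_mul (h : IsBump ψ) (c : ℝ) : IsBump fun x => c * ψ x :=
  ⟨contDiff_const.mul h.smooth, h.compact.mul_left⟩

lemma sub (h : IsBump ψ) (h' : IsBump φ) : IsBump fun x => ψ x - φ x :=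
  ⟨h.smooth.sub h'.smooth, h.compact.sub h'.compact⟩

end IsBump

/-- The differential operator `1 - ∂ₓ²/6`. -/
def helm (ψ : ℝ → ℝ) (x : ℝ) : ℝ := ψ x - 1 / 6 * deriv (deriv ψ) x

lemma IsBump.helm {ψ : ℝ → ℝ} (h : IsBump ψ) : IsBump (helm ψ) :=
  h.sub (h.deriv.deriv.const_mul _)

/-- The class in `L²` of the derivative of order `≤ 2` combination is linear. -/
lemma toL2_add {f g : ℝ → ℝ} (hf : MemLp f 2) (hg : MemLp g 2) :
    toL2 (fun x => f x + g x) = toL2 f + toL2 g := by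
  refine (eq_toL2 ?_).symm
  filter_upwards [Lp.coeFn_add (toL2 f) (toL2 g), coeFn_toL2 hf, coeFn_toL2 hg] with x h1 h2 h3
  rw [h1, Pi.add_apply, h2, h3]

lemma toL2_const_mul {f : ℝ → ℝ} (c : ℝ) (hf : MemLp f 2) :
    toL2 (fun x => c * f x) = c • toL2 f := by
  refine (eq_toL2 ?_).symm
  filter_upwards [Lp.coeFn_smul c (toL2 f), coeFn_toL2 hf] with x h1 h2
  rw [h1, Pi.smul_apply, h2, smul_eq_mul]

lemma toL2_sub {f g : ℝ → ℝ} (hf : MemLp f 2) (hg : MemLp g 2) :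
    toL2 (fun x => f x - g x) = toL2 f - toL2 g := by
  refine (eq_toL2 ?_).symm
  filter_upwards [Lp.coeFn_sub (toL2 f) (toL2 g), coeFn_toL2 hf, coeFn_toL2 hg] with x h1 h2 h3
  rw [h1, Pi.sub_apply, h2, h3]

lemma toL2_helm {ψ : ℝ → ℝ} (h : IsBump ψ) :
    toL2 (helm ψ) = toL2 ψ - (1 / 6 : ℝ) • toL2 (deriv (deriv ψ)) := by
  rw [← toL2_const_mul _ (h.deriv.deriv.memLp 2)]
  exact toL2_sub (h.memLp 2) ((h.deriv.deriv.const_mul _).memLp 2)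

lemma opA_toL2 {f : ℝ → ℝ} (hf : MemLp f 2) : opA (toL2 f) =ᵐ[volume] conv kerA f := by
  rw [← conv_congr_ae (coeFn_toL2 hf)]; exact coeFn_opA _

lemma opB_toL2 {f : ℝ → ℝ} (hf : MemLp f 2) : opB (toL2 f) =ᵐ[volume] conv kerB f := by
  rw [← conv_congr_ae (coeFn_toL2 hf)]; exact coeFn_opB _

lemma opA_deriv {ψ : ℝ → ℝ} (h : IsBump ψ) : opA (toL2 (deriv ψ)) = opB (toL2 ψ) := by
  refine Lp.ext ((opA_toL2 (h.deriv.memLp 2)).trans ?_)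
  rw [funext (conv_kerA_deriv h.contDiff_one h.compact)]
  exact (opB_toL2 (h.memLp 2)).symm

lemma opA_sub_opB_deriv {ψ : ℝ → ℝ} (h : IsBump ψ) :
    opA (toL2 ψ) - (1 / 6 : ℝ) • opB (toL2 (deriv ψ)) = toL2 ψ := by
  refine Lp.ext ?_
  filter_upwards [Lp.coeFn_sub (opA (toL2 ψ)) ((1 / 6 : ℝ) • opB (toL2 (deriv ψ))),
    Lp.coeFn_smul (1 / 6 : ℝ) (opB (toL2 (deriv ψ))), opA_toL2 (h.memLp 2),
    opB_toL2 (h.deriv.memLp 2), h.coeFn] with x h1 h2 h3 h4 h5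
  rw [h1, Pi.sub_apply, h2, Pi.smul_apply, h3, h4, h5, smul_eq_mul,
    conv_kerA_sub h.contDiff_one h.compact]

lemma opA_helm {ψ : ℝ → ℝ} (h : IsBump ψ) : opA (toL2 (helm ψ)) = toL2 ψ := by
  rw [toL2_helm h, map_sub, map_smul, opA_deriv h.deriv, opA_sub_opB_deriv h]

lemma opB_helm {ψ : ℝ → ℝ} (h : IsBump ψ) : opB (toL2 (helm ψ)) = toL2 (deriv ψ) := by
  rw [toL2_helm h, map_sub, map_smul, ← opA_deriv h, opA_sub_opB_deriv h.deriv]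

lemma opD_helm {ψ : ℝ → ℝ} (h : IsBump ψ) : opD (toL2 (helm ψ)) = toL2 (deriv (deriv ψ)) := by
  rw [opD_apply, opA_helm h, toL2_helm h]
  simp

lemma conv_eq_convolution (k f : ℝ → ℝ) :
    conv k f = convolution k f (ContinuousLinearMap.mul ℝ ℝ) volume := by
  ext x
  rw [convolution_def, conv, ← integral_sub_left_eq_self _ volume x]
  simp

lemma contDiff_conv_kerA {χ : ℝ → ℝ} (h : IsBump χ) : ContDiff ℝ ∞ (conv kerA χ) := by
  rw [conv_eq_convolution]
  exact h.compact.contDiff_convolution_right _ isKernel_kerA.integrable.locallyIntegrable h.smooth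

lemma deriv_conv_kerA {χ : ℝ → ℝ} (h : IsBump χ) :
    deriv (conv kerA χ) = conv kerA (deriv χ) := by
  ext x
  rw [conv_eq_convolution, conv_eq_convolution]
  exact (h.compact.hasDerivAt_convolution_right _
    isKernel_kerA.integrable.locallyIntegrable h.contDiff_one x).deriv

lemma memLp_conv_kerA {χ : ℝ → ℝ} (h : IsBump χ) : MemLp (conv kerA χ) 2 :=
  (memLp_congr_ae (opA_toL2 (h.memLp 2))).1 (Lp.memLp _)

lemma helm_conv_kerA {χ : ℝ → ℝ} (h : IsBump χ) : helm (conv kerA χ) = χ := by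
  ext x
  rw [helm, deriv_conv_kerA h, deriv_conv_kerA h.deriv,
    conv_kerA_deriv h.deriv.contDiff_one h.deriv.compact, conv_kerA_sub h.contDiff_one h.compact]

lemma deriv_comp_const_mul {f : ℝ → ℝ} (hf : Differentiable ℝ f) (c : ℝ) :
    (deriv fun x => f (c * x)) = fun x => c * deriv f (c * x) := by
  ext x
  have h := (hf (c * x)).hasDerivAt.comp x ((hasDerivAt_id x).const_mul c)
  refine (show HasDerivAt (fun x => f (c * x)) _ x from h).deriv.trans ?_
  ring

lemma deriv_mul_fun {f g : ℝ → ℝ} (hf : Differentiable ℝ f) (hg : Differentiable ℝ g) :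
    (deriv fun x => f x * g x) = fun x => deriv f x * g x + f x * deriv g x := by
  ext x
  exact deriv_fun_mul (hf x) (hg x)

/-- Leibniz rule for a slowly varying cutoff: each derivative that falls on θ(c·) brings a factor c.
-/
lemma helm_mul_comp {θ ψ : ℝ → ℝ} (hθ : ContDiff ℝ ∞ θ) (hψ : ContDiff ℝ ∞ ψ) (c x : ℝ) :
    helm (fun x => θ (c * x) * ψ x) x = θ (c * x) * helm ψ x
      - (1 / 3 * c) * (deriv θ (c * x) * deriv ψ x)
      - (1 / 6 * c ^ 2) * (deriv (deriv θ) (c * x) * ψ x) := by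
  have d1 : Differentiable ℝ θ := hθ.differentiable (by simp)
  have d2 : Differentiable ℝ (deriv θ) :=
    (contDiff_infty_iff_deriv.1 hθ).2.differentiable (by simp)
  have e1 : Differentiable ℝ ψ := hψ.differentiable (by simp)
  have e2 : Differentiable ℝ (deriv ψ) :=
    (contDiff_infty_iff_deriv.1 hψ).2.differentiable (by simp)
  have t1 : Differentiable ℝ fun x => θ (c * x) := by fun_prop
  have t2 : Differentiable ℝ fun x => deriv θ (c * x) := by fun_prop
  rw [helm, helm, deriv_mul_fun t1 e1, deriv_comp_const_mul d1]
  rw [deriv_fun_add (by fun_prop) (by fun_prop), deriv_fun_mul (by fun_prop) (by fun_prop),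
    deriv_fun_mul (by fun_prop) (by fun_prop), deriv_fun_mul (by fun_prop) (by fun_prop),
    deriv_comp_const_mul d1, deriv_comp_const_mul d2]
  simp only [deriv_const]
  ring

lemma norm_toL2_mul_le {g f : ℝ → ℝ} {C : ℝ} (hg : Continuous g) (hC : ∀ x, |g x| ≤ C)
    (hf : MemLp f 2) :
    MemLp (fun x => g x * f x) 2 ∧ ‖toL2 (fun x => g x * f x)‖ ≤ C * ‖toL2 f‖ := by
  have hm : MemLp (fun x => g x * f x) 2 :=
    MemLp.of_le_mul (c := C) hf (hg.aestronglyMeasurable.mul hf.1)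
      (Filter.Eventually.of_forall fun x => by
        rw [norm_mul]; exact mul_le_mul_of_nonneg_right (hC x) (norm_nonneg _))
  refine ⟨hm, Lp.norm_le_mul_norm_of_ae_le_mul ?_⟩
  filter_upwards [coeFn_toL2 hm, coeFn_toL2 hf] with x h1 h2
  rw [h1, h2, norm_mul]
  exact mul_le_mul_of_nonneg_right (hC x) (norm_nonneg _)

/-- The exact preimage Aχ is smooth but not compactly supported. Cutting it off at scale 1/c changes
its image by terms of order c and c² in L². -/
lemma exists_helm_near {χ : ℝ → ℝ} (h : IsBump χ) {ε : ℝ} (hε : 0 < ε) :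
    ∃ ψ, IsBump ψ ∧ ‖toL2 (helm ψ) - toL2 χ‖ < ε := by
  obtain ⟨θ⟩ : Nonempty (ContDiffBump (0 : ℝ)) := inferInstance
  have hθ : IsBump θ := ⟨θ.contDiff, θ.hasCompactSupport⟩
  obtain ⟨C₁, hC₁⟩ := hθ.deriv.compact.exists_bound_of_continuous hθ.deriv.continuous
  obtain ⟨C₂, hC₂⟩ := hθ.deriv.deriv.compact.exists_bound_of_continuous hθ.deriv.deriv.continuous
  obtain ⟨R, hR⟩ := h.compact.isCompact.isBounded.subset_closedBall 0
  set ψ := conv kerA χ with hψdef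
  have hψ := contDiff_conv_kerA h
  have m0 : MemLp ψ 2 := memLp_conv_kerA h
  have m1 : MemLp (deriv ψ) 2 := by rw [deriv_conv_kerA h]; exact memLp_conv_kerA h.deriv
  have key : ∀ c : ℝ, 0 < c → c * R ≤ θ.rIn →
      IsBump (fun x => θ (c * x) * ψ x) ∧
      ‖toL2 (helm fun x => θ (c * x) * ψ x) - toL2 χ‖ ≤
        1 / 3 * c * (C₁ * ‖toL2 (deriv ψ)‖) + 1 / 6 * c ^ 2 * (C₂ * ‖toL2 ψ‖) := by
    intro c hc hcR
    have hc1 := hθ.deriv.continuous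
    have hc2 := hθ.deriv.deriv.continuous
    obtain ⟨n1, b1⟩ := norm_toL2_mul_le (g := fun x => deriv θ (c * x)) (C := C₁) (by fun_prop)
      (fun x => hC₁ _) m1
    obtain ⟨n2, b2⟩ := norm_toL2_mul_le (g := fun x => deriv (deriv θ) (c * x)) (C := C₂)
      (by fun_prop) (fun x => hC₂ _) m0
    have hB : IsBump (fun x => θ (c * x) * ψ x) := by
      refine ⟨(θ.contDiff.comp (contDiff_const.mul contDiff_id)).mul hψ, ?_⟩
      exact (hθ.compact.comp_homeomorph (Homeomorph.mulLeft₀ c hc.ne')).mul_right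
    refine ⟨hB, ?_⟩
    have he : (helm fun x => θ (c * x) * ψ x) = fun x => (χ x
        - (1 / 3 * c) * (deriv θ (c * x) * deriv ψ x))
        - (1 / 6 * c ^ 2) * (deriv (deriv θ) (c * x) * ψ x) := by
      ext x
      rw [helm_mul_comp θ.contDiff hψ, helm_conv_kerA h]
      congr 2
      -- It remains to see θ(cx) χ(x) = χ(x): on the support of χ one has |cx| ≤ cR ≤ rIn, where the
      -- cutoff equals 1.
      by_cases hx : χ x = 0
      · simp [hx]
      · have hx' := hR (subset_tsupport _ hx)
        rw [mem_closedBall_zero_iff, Real.norm_eq_abs] at hx'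
        rw [θ.one_of_mem_closedBall, one_mul]
        rw [mem_closedBall_zero_iff, Real.norm_eq_abs, abs_mul, abs_of_pos hc]
        exact (mul_le_mul_of_nonneg_left hx' hc.le).trans hcR
    rw [he, toL2_sub (f := fun x => χ x - (1 / 3 * c) * (deriv θ (c * x) * deriv ψ x))
      ((h.memLp 2).sub (n1.const_mul _)) (n2.const_mul _),
      toL2_sub (h.memLp 2) (n1.const_mul _), toL2_const_mul _ n1, toL2_const_mul _ n2]
    rw [sub_right_comm _ _ (toL2 χ), sub_right_comm _ _ (toL2 χ), sub_self, zero_sub,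
      ← neg_add', norm_neg]
    refine (norm_add_le _ _).trans ?_
    rw [norm_smul, norm_smul, Real.norm_of_nonneg (by positivity),
      Real.norm_of_nonneg (by positivity)]
    gcongr
  have hlim : Filter.Tendsto (fun c : ℝ => 1 / 3 * c * (C₁ * ‖toL2 (deriv ψ)‖)
      + 1 / 6 * c ^ 2 * (C₂ * ‖toL2 ψ‖)) (nhdsWithin 0 (Ioi 0)) (nhds 0) := by
    refine (Continuous.tendsto' (by fun_prop) 0 0 (by simp)).mono_left nhdsWithin_le_nhds
  have hlim2 : Filter.Tendsto (fun c : ℝ => c * R) (nhdsWithin 0 (Ioi 0)) (nhds 0) :=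
    (Continuous.tendsto' (by fun_prop) 0 0 (by simp)).mono_left nhdsWithin_le_nhds
  obtain ⟨c, h1, h2, h3⟩ := ((hlim.eventually_lt_const hε).and
    ((hlim2.eventually_le_const θ.rIn_pos).and self_mem_nhdsWithin)).exists
  exact ⟨_, (key c h3 h2).1, (key c h3 h2).2.trans_lt h1⟩

lemma dense_helm : Dense {f : L2 | ∃ ψ, IsBump ψ ∧ f = toL2 (helm ψ)} := by
  rw [← dense_closure]
  refine (Lp.dense_hasCompactSupport_contDiff (F := ℝ) (μ := (volume : Measure ℝ))
    (p := 2) (by simp)).mono ?_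
  rintro f ⟨χ, hf, hc, hs⟩
  have hχ : IsBump χ := ⟨hs, hc⟩
  rw [eq_toL2 hf, Metric.mem_closure_iff]
  intro ε hε
  obtain ⟨ψ, h1, h2⟩ := exists_helm_near hχ hε
  exact ⟨_, ⟨ψ, h1, rfl⟩, by rwa [dist_comm, dist_eq_norm]⟩

/-- Two continuous maps on `L²` that agree on the functions `ψ - ψ''/6` are equal. -/
lemma ext_helm {Y : Type*} [TopologicalSpace Y] [T2Space Y] {F G : L2 → Y} (hF : Continuous F)
    (hG : Continuous G) (h : ∀ ψ, IsBump ψ → F (toL2 (helm ψ)) = G (toL2 (helm ψ))) (f : L2) :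
    F f = G f :=
  congr_fun (hF.ext_on dense_helm hG (by rintro _ ⟨ψ, hψ, rfl⟩; exact h ψ hψ)) f

/-- Both sides are ∂ₓ²A²; on functions ψ - ψ''/6 they both become Aψ'', and density extends this. -/
lemma opB_opB (f : L2) : opB (opB f) = opA (opD f) := by
  refine ext_helm (F := fun f => opB (opB f)) (G := fun f => opA (opD f)) (by fun_prop)
    (by fun_prop) (fun ψ h => ?_) f
  simp only [opB_helm h, opD_helm h, opA_deriv h.deriv]

/-- With z = Bf and z' = Df this is ‖z‖² + ‖z'‖²/6 = -⟨z', f⟩. The first term equals -⟨Df, Af⟩ by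
antisymmetry and `opB_opB`, and expanding one factor Df = 6(Af - f) in the second cancels it. -/
lemma energy_identity (f : L2) :
    ‖opB f‖ ^ 2 + 1 / 6 * ‖opD f‖ ^ 2 = -inner ℝ (opD f) f := by
  have h1 : inner ℝ (opB f) (opB f) = -inner ℝ (opD f) (opA f) := by
    rw [inner_opB, opB_opB, ← inner_opA, real_inner_comm]
  have h2 : inner ℝ (opD f) (opD f) = 6 * (inner ℝ (opD f) (opA f) - inner ℝ (opD f) f) := by
    calc inner ℝ (opD f) (opD f) = inner ℝ (opD f) ((6 : ℝ) • (opA f - f)) := rfl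
      _ = _ := by rw [inner_smul_right, inner_sub_right]
  rw [← real_inner_self_eq_norm_sq, ← real_inner_self_eq_norm_sq, h1, h2]
  ring

/-- The resolvent identity z = Az - (1/6)Bz' for z = Bf, z' = Df. Both right-hand terms are
smoothing operators applied to L² functions, so the sup norm of z is controlled by its H¹ norm. -/
lemma opBtop_eq (f : L2) : opBtop f = opAtop (opB f) - (1 / 6 : ℝ) • opBtop (opD f) := by
  refine ext_helm (F := fun f => opBtop f)
    (G := fun f => opAtop (opB f) - (1 / 6 : ℝ) • opBtop (opD f)) (by fun_prop)
    (by fun_prop) (fun ψ h => ?_) f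
  simp only [opB_helm h, opD_helm h]
  have h2 := opA_sub_opB_deriv h.deriv
  refine Lp.ext ((opBtop_ae_eq _).trans ?_)
  rw [opB_helm h, ← h2]
  filter_upwards [Lp.coeFn_sub (opA (toL2 (deriv ψ))) ((1 / 6 : ℝ) • opB (toL2 (deriv (deriv ψ)))),
    Lp.coeFn_smul (1 / 6 : ℝ) (opB (toL2 (deriv (deriv ψ)))),
    Lp.coeFn_sub (opAtop (toL2 (deriv ψ))) ((1 / 6 : ℝ) • opBtop (toL2 (deriv (deriv ψ)))),
    Lp.coeFn_smul (1 / 6 : ℝ) (opBtop (toL2 (deriv (deriv ψ)))),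
    coeFn_opA (toL2 (deriv ψ)), coeFn_opAtop (toL2 (deriv ψ)),
    opBtop_ae_eq (toL2 (deriv (deriv ψ)))] with x a1 a2 a3 a4 a5 a6 a7
  rw [a1, h2, a3, Pi.sub_apply, Pi.sub_apply, a2, a4, Pi.smul_apply, Pi.smul_apply, a5, a6, a7]

/-- The sup norm of `∂ₓ(1 - ∂ₓ²/6)⁻¹ f` is controlled by its `H¹` norm. -/
lemma exists_norm_opBtop_le : ∃ C : ℝ, 0 ≤ C ∧ ∀ f, ‖opBtop f‖ ≤ C * (‖opB f‖ + ‖opD f‖) := by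
  refine ⟨max ‖opAtop‖ (1 / 6 * ‖opBtop‖), by positivity, fun f => ?_⟩
  rw [opBtop_eq]
  refine (norm_sub_le _ _).trans ?_
  rw [norm_smul, mul_add, Real.norm_of_nonneg (by norm_num)]
  have h1 := (opAtop.le_opNorm (opB f)).trans (mul_le_mul_of_nonneg_right
    (le_max_left ‖opAtop‖ (1 / 6 * ‖opBtop‖)) (norm_nonneg _))
  have h2 := mul_le_mul_of_nonneg_right
    (le_max_right ‖opAtop‖ (1 / 6 * ‖opBtop‖)) (norm_nonneg (opD f))
  have h3 := opBtop.le_opNorm (opD f)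
  linarith

lemma coeFn_opBtop_helm {ψ : ℝ → ℝ} (h : IsBump ψ) : opBtop (toL2 (helm ψ)) =ᵐ[volume] deriv ψ :=
  (opBtop_ae_eq _).trans (by rw [opB_helm h]; exact h.deriv.coeFn)

/-- The cancellation `∫ z² z' = 0` for `z = ∂ₓ(1 - ∂ₓ²/6)⁻¹ f`. -/
lemma inner_cubic (f : L2) : inner ℝ (opD f) (mulTop (opBtop f) (opB f)) = 0 := by
  refine ext_helm (F := fun f => inner ℝ (opD f) (mulTop (opBtop f) (opB f))) (G := fun _ => 0)
    (by fun_prop) (by fun_prop) (fun ψ h => ?_) f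
  simp only [opB_helm h, opD_helm h]
  have h3 : mulTop (opBtop (toL2 (helm ψ))) (toL2 (deriv ψ)) =ᵐ[volume]
      fun x => deriv ψ x * deriv ψ x := by
    filter_upwards [coeFn_mulTop (opBtop (toL2 (helm ψ))) (toL2 (deriv ψ)),
      coeFn_opBtop_helm h, h.deriv.coeFn] with x a1 a2 a3
    rw [a1, a2, a3]
  rw [inner_L2_eq h.deriv.deriv.coeFn h3]
  -- With z = ψ', the integrand z' z² is the exact derivative of z³/3, which has compact support.
  have hd : ∀ x, deriv (deriv ψ) x * (deriv ψ x * deriv ψ x)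
      = deriv (fun x => 1 / 3 * deriv ψ x ^ 3) x := fun x => by
    rw [deriv_const_mul_field, deriv_fun_pow (h.deriv.differentiable x)]
    simp only [Nat.add_one_sub_one, Nat.cast_ofNat]
    ring
  simp_rw [hd]
  have hs : ContDiff ℝ ∞ fun x => 1 / 3 * deriv ψ x ^ 3 := contDiff_const.mul (h.deriv.smooth.pow 3)
  have hc : HasCompactSupport fun x => 1 / 3 * deriv ψ x ^ 3 :=
    (h.deriv.compact.comp_left (g := fun y : ℝ => 1 / 3 * y ^ 3) (by simp))
  exact integral_eq_zero_of_hasDerivAt_of_integrable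
    (fun x => (hs.differentiable (by simp) x).hasDerivAt)
    (IsBump.deriv ⟨hs, hc⟩).integrable (IsBump.integrable ⟨hs, hc⟩)

end

/-! ### Global existence for differential equations by radial truncation -/

noncomputable section

section RadialProjection

variable {H : Type*} [NormedAddCommGroup H]

/-- The factor of the radial projection to the ball of radius `R`. -/
def radialFactor (R : ℝ) (x : H) : ℝ := R / max R ‖x‖

lemma radialFactor_mem {R : ℝ} (hR : 0 < R) (x : H) : radialFactor R x ∈ Icc (0 : ℝ) 1 :=
  ⟨by unfold radialFactor; positivity,
    div_le_one_of_le₀ (le_max_left _ _) (hR.le.trans (le_max_left _ _))⟩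

lemma radialFactor_eq_one {R : ℝ} (hR : 0 < R) {x : H} (hx : ‖x‖ ≤ R) :
    radialFactor R x = 1 := by
  rw [radialFactor, max_eq_left hx, div_self hR.ne']

variable [NormedSpace ℝ H]

lemma norm_radialFactor_smul_le {R : ℝ} (hR : 0 < R) (x : H) :
    ‖radialFactor R x • x‖ ≤ R := by
  rw [norm_smul, Real.norm_of_nonneg (radialFactor_mem hR x).1, radialFactor, div_mul_eq_mul_div,
    div_le_iff₀ (hR.trans_le (le_max_left _ _))]
  exact mul_le_mul_of_nonneg_left (le_max_right _ _) hR.le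

/-- The constant 2 is valid in any normed space. The difference splits into one scaled by R/m ≤ 1
and one due to the change of the factor, controlled by | ‖x‖ - ‖y‖ | ≤ ‖x - y‖ and R‖y‖ ≤ mk. -/
lemma lipschitzWith_radialFactor_smul {R : ℝ} (hR : 0 < R) :
    LipschitzWith 2 fun x : H => radialFactor R x • x := by
  refine LipschitzWith.of_dist_le_mul fun x y => ?_
  rw [dist_eq_norm, dist_eq_norm]
  set m := max R ‖x‖ with hm
  set k := max R ‖y‖ with hk
  have hm0 : 0 < m := hR.trans_le (le_max_left _ _)
  have hk0 : 0 < k := hR.trans_le (le_max_left _ _)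
  have hmk : |k - m| ≤ ‖x - y‖ := by
    rw [hm, hk, max_comm R, max_comm R]
    refine (abs_max_sub_max_le_abs _ _ _).trans ?_
    rw [abs_sub_comm]
    exact abs_norm_sub_norm_le x y
  have e : radialFactor R x • x - radialFactor R y • y
      = (R / m) • (x - y) + (R * (k - m) / (m * k)) • y := by
    rw [smul_sub, sub_add_eq_add_sub, add_comm, ← sub_add_eq_add_sub, ← sub_smul]
    simp only [radialFactor, ← hm, ← hk]
    have : R * (k - m) / (m * k) - R / m = -(R / k) := by field_simp; ring
    rw [this, neg_smul]; abel
  have h1 : ‖(R / m) • (x - y)‖ ≤ ‖x - y‖ := by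
    rw [norm_smul, Real.norm_of_nonneg (by positivity)]
    exact mul_le_of_le_one_left (norm_nonneg _) (div_le_one_of_le₀ (le_max_left _ _) hm0.le)
  have h2 : ‖(R * (k - m) / (m * k)) • y‖ ≤ ‖x - y‖ := by
    refine le_trans ?_ hmk
    rw [norm_smul, Real.norm_eq_abs, abs_div, abs_mul, abs_of_pos hR, abs_of_pos (mul_pos hm0 hk0),
      div_mul_eq_mul_div, div_le_iff₀ (mul_pos hm0 hk0)]
    have : R * ‖y‖ ≤ m * k := mul_le_mul (le_max_left _ _) (le_max_right _ _) (norm_nonneg _) hm0.le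
    nlinarith [abs_nonneg (k - m)]
  rw [e]
  refine (norm_add_le _ _).trans ?_
  simp only [NNReal.coe_ofNat]
  linarith

end RadialProjection

/-- Global existence for a locally Lipschitz differential equation with an a priori bound. -/
theorem exists_solution_of_apriori_bound {H : Type*} [NormedAddCommGroup H] [NormedSpace ℝ H]
    [CompleteSpace H] {f : ℝ → H → H} {T C : ℝ} (hT : 0 ≤ T)
    (hcont : ∀ x, ContinuousOn (fun t => f t x) (Icc 0 T))
    (hlip : ∀ R : ℝ, ∃ K : NNReal, ∀ t ∈ Icc 0 T,
      LipschitzOnWith K (f t) (Metric.closedBall 0 R))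
    (hap : ∀ (n : ℝ → H) (lam : ℝ → ℝ), n 0 = 0 → (∀ t, lam t ∈ Icc (0 : ℝ) 1) →
      (∀ t ∈ Icc 0 T, HasDerivWithinAt n (f t (lam t • n t)) (Icc 0 T) t) →
      ∀ t ∈ Icc 0 T, ‖n t‖ ≤ C) :
    ∃ n : ℝ → H, n 0 = 0 ∧ ∀ t ∈ Icc 0 T, HasDerivWithinAt n (f t (n t)) (Icc 0 T) t := by
  -- The truncation radius dominates the a priori bound; the 1 only makes it positive.
  set R := max C 1 with hRdef
  have hR : 0 < R := zero_lt_one.trans_le (le_max_right _ _)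
  obtain ⟨K, hK⟩ := hlip R
  obtain ⟨B, hB⟩ := isCompact_Icc.exists_bound_of_continuousOn (hcont 0)
  have hB0 : 0 ≤ B := (norm_nonneg _).trans (hB 0 ⟨le_rfl, hT⟩)
  have hball : ∀ x : H, radialFactor R x • x ∈ Metric.closedBall (0 : H) R := fun x =>
    mem_closedBall_zero_iff.2 (norm_radialFactor_smul_le hR x)
  set L : ℝ := B + K * R with hL
  have hL0 : 0 ≤ L := by positivity
  have hbound : ∀ t ∈ Icc 0 T, ∀ x ∈ Metric.closedBall (0 : H) R, ‖f t x‖ ≤ L := by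
    intro t ht x hx
    have h1 := (hK t ht).dist_le_mul x hx 0 (Metric.mem_closedBall_self hR.le)
    rw [dist_eq_norm, dist_zero_right] at h1
    have h2 := mul_le_mul_of_nonneg_left (mem_closedBall_zero_iff.1 hx) K.coe_nonneg
    calc ‖f t x‖ = ‖(f t x - f t 0) + f t 0‖ := by rw [sub_add_cancel]
      _ ≤ _ := (norm_add_le _ _).trans (by linarith [hB t ht])
  -- The truncated field is globally Lipschitz and bounded by L, so its solution stays in the ball
  -- of radius L T and Picard–Lindelöf reaches time T in one step.
  have hPL : IsPicardLindelof (fun t x => f t (radialFactor R x • x)) (tmin := 0) (tmax := T)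
      ⟨0, le_rfl, hT⟩ 0 (L * T).toNNReal 0 L.toNNReal (K * 2) := by
    refine ⟨fun t ht => ?_, fun x _ => hcont _, fun t ht x _ => ?_, ?_⟩
    · exact (((hK t ht).comp (lipschitzWith_radialFactor_smul hR).lipschitzOnWith
        (s := univ) fun x _ => hball x)).mono (subset_univ _)
    · rw [Real.coe_toNNReal _ hL0]
      exact hbound t ht _ (hball x)
    · rw [Real.coe_toNNReal _ hL0, Real.coe_toNNReal _ (mul_nonneg hL0 hT)]
      simp [hT]
  obtain ⟨n, hn0, hn⟩ := hPL.exists_eq_forall_mem_Icc_hasDerivWithinAt₀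
  -- The truncated equation is the original one evaluated at λ n with λ in [0, 1], which the a
  -- priori bound tolerates. Hence ‖n‖ ≤ C ≤ R and the truncation was never active.
  have hb := hap n (fun t => radialFactor R (n t)) hn0 (fun t => radialFactor_mem hR _) hn
  refine ⟨n, hn0, fun t ht => ?_⟩
  have := hn t ht
  rwa [radialFactor_eq_one hR ((hb t ht).trans (le_max_left _ _)), one_smul] at this

end

/-! ### The integrated equation: splitting, energy estimate, global existence -/

noncomputable section

/-- The operator `∂ₓ(1 - ∂ₓ²/6)⁻¹` applied to the flux `u + (3/4) u² - (1/2) z u`. -/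
def fluxOp (u z : L2) : L2 := opB u + opB₁ (mulTwo ((3 / 4 : ℝ) • u - (1 / 2 : ℝ) • z) u)

lemma continuous_fluxOp : Continuous fun p : L2 × L2 => fluxOp p.1 p.2 := by
  unfold fluxOp; fun_prop

/-- The integrated equation `η(t) = a(t) - ∫₀ᵗ ∂ₓ(1 - ∂ₓ²/6)⁻¹(η + (3/4) η² - (1/2) ζ η)`. -/
def IsMild (T : ℝ) (a ζ η : ℝ → L2) : Prop :=
  ContinuousOn η (Icc 0 T) ∧ ∀ t ∈ Icc 0 T, η t = a t - ∫ τ in 0..t, fluxOp (η τ) (ζ τ)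

/-- The vector field for the regularised unknown `n`, where `η = a + r - ∂ₓ(1 - ∂ₓ²/6)⁻¹ n`. -/
def regField (a ζ r : L2) (ρ : Linf) (n : L2) : L2 :=
  a + (r - opB n) + mulTop (ρ - opBtop n)
    ((3 / 4 : ℝ) • ((2 : ℝ) • a + (r - opB n)) - (1 / 2 : ℝ) • ζ)

/-- Put y = r - Bn and expand the flux at a + y. The part (3/4 a - 1/2 ζ)a is only in L¹; every
other term is linear or has a factor y, which is bounded and represented by ρ - Bn in L^∞, so the
rest is B of an L² function. This is why the same r enters once in L² and once in L^∞. -/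
lemma fluxOp_eq {a ζ r : L2} {ρ : Linf} (hρ : ρ =ᵐ[volume] r) (n : L2) :
    fluxOp (a + (r - opB n)) ζ
      = opB₁ (mulTwo ((3 / 4 : ℝ) • a - (1 / 2 : ℝ) • ζ) a) + opB (regField a ζ r ρ n) := by
  set y := r - opB n with hy
  set m := ρ - opBtop n with hm
  set v := (3 / 4 : ℝ) • ((2 : ℝ) • a + y) - (1 / 2 : ℝ) • ζ with hv
  have hmy : m =ᵐ[volume] y := by
    filter_upwards [Lp.coeFn_sub ρ (opBtop n), Lp.coeFn_sub r (opB n), hρ, opBtop_ae_eq n]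
      with x h1 h2 h3 h4
    rw [hm, hy, h1, h2, Pi.sub_apply, Pi.sub_apply, h3, h4]
  have key : opB₁ (mulTwo ((3 / 4 : ℝ) • (a + y) - (1 / 2 : ℝ) • ζ) (a + y)
      - mulTwo ((3 / 4 : ℝ) • a - (1 / 2 : ℝ) • ζ) a) = opB (mulTop m v) := by
    refine opB₁_eq_opB ?_
    -- Bilinearity alone leaves a commutator of y and a; it vanishes only once the products are
    -- evaluated pointwise.
    have e : mulTwo ((3 / 4 : ℝ) • (a + y) - (1 / 2 : ℝ) • ζ) (a + y)
        - mulTwo ((3 / 4 : ℝ) • a - (1 / 2 : ℝ) • ζ) a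
        = mulTwo v y + (mulTwo ((3 / 4 : ℝ) • y) a - mulTwo a ((3 / 4 : ℝ) • y)) := by
      rw [hv]
      simp only [map_add, map_sub, map_smul, add_apply, sub_apply, smul_apply, smul_add, smul_smul]
      module
    rw [e]
    filter_upwards [Lp.coeFn_add (mulTwo v y)
      (mulTwo ((3 / 4 : ℝ) • y) a - mulTwo a ((3 / 4 : ℝ) • y)),
      Lp.coeFn_sub (mulTwo ((3 / 4 : ℝ) • y) a) (mulTwo a ((3 / 4 : ℝ) • y)),
      coeFn_mulTwo v y, coeFn_mulTwo ((3 / 4 : ℝ) • y) a, coeFn_mulTwo a ((3 / 4 : ℝ) • y),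
      coeFn_mulTop m v, hmy] with x h1 h2 h3 h4 h5 h6 h7
    rw [h1, Pi.add_apply, h2, Pi.sub_apply, h3, h4, h5, h6, h7]
    ring
  rw [map_sub, sub_eq_iff_eq_add'] at key
  rw [fluxOp, key, regField, ← hy, ← hm, ← hv]
  simp only [map_add]
  abel

lemma lipschitz_regField {R : ℝ} (hR : 0 ≤ R) (S : ℝ) : ∃ K : NNReal, ∀ (a ζ r : L2) (ρ : Linf),
    ‖a‖ ≤ R → ‖ζ‖ ≤ R → ‖r‖ ≤ R → ‖ρ‖ ≤ R →
      LipschitzOnWith K (regField a ζ r ρ) (Metric.closedBall 0 S) := by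
  set b := ‖opB‖ with hb
  set c := ‖opBtop‖ with hc
  have hb0 : 0 ≤ b := norm_nonneg _
  have hc0 : 0 ≤ c := norm_nonneg _
  refine ⟨(b + c * (3 / 4 * (2 * R + (R + b * |S|)) + 1 / 2 * R)
    + (R + c * |S|) * (3 / 4 * b)).toNNReal, fun a ζ r ρ ha hζ hr hρ => ?_⟩
  refine LipschitzOnWith.of_dist_le_mul fun n hn k hk => ?_
  rw [Real.coe_toNNReal _ (by positivity), dist_eq_norm, dist_eq_norm]
  rw [mem_closedBall_zero_iff] at hn hk
  have hn' := hn.trans (le_abs_self S)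
  have hk' := hk.trans (le_abs_self S)
  have hB : ∀ x : L2, ‖opB x‖ ≤ b * ‖x‖ := opB.le_opNorm
  have hBt : ∀ x : L2, ‖opBtop x‖ ≤ c * ‖x‖ := opBtop.le_opNorm
  set v := (3 / 4 : ℝ) • ((2 : ℝ) • a + (r - opB n)) - (1 / 2 : ℝ) • ζ with hv
  -- Telescoping of the product: change the bounded factor first, with v taken at n, then the L²
  -- factor, with the bounded one taken at k.
  have e : regField a ζ r ρ n - regField a ζ r ρ k = -opB (n - k) - mulTop (opBtop (n - k)) v
      - mulTop (ρ - opBtop k) ((3 / 4 : ℝ) • opB (n - k)) := by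
    rw [regField, regField, ← hv]
    have h1 : (3 / 4 : ℝ) • ((2 : ℝ) • a + (r - opB k)) - (1 / 2 : ℝ) • ζ
        = v + (3 / 4 : ℝ) • opB (n - k) := by rw [hv, map_sub]; module
    have h2 : ρ - opBtop n = (ρ - opBtop k) - opBtop (n - k) := by rw [map_sub]; abel
    rw [h1, h2, map_sub mulTop, sub_apply, map_add (mulTop _), map_sub opB]
    abel
  have hvn : ‖v‖ ≤ 3 / 4 * (2 * R + (R + b * |S|)) + 1 / 2 * R := by
    rw [hv]
    refine (norm_sub_le _ _).trans ?_
    rw [norm_smul, norm_smul, Real.norm_of_nonneg (by norm_num), Real.norm_of_nonneg (by norm_num)]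
    gcongr
    refine (norm_add_le _ _).trans ?_
    rw [norm_smul, Real.norm_of_nonneg (by norm_num)]
    gcongr
    refine (norm_sub_le _ _).trans ?_
    gcongr
    exact (hB n).trans (by gcongr)
  have hm : ‖ρ - opBtop k‖ ≤ R + c * |S| :=
    (norm_sub_le _ _).trans (add_le_add hρ ((hBt k).trans (by gcongr)))
  rw [e]
  calc _ ≤ ‖opB (n - k)‖ + ‖mulTop (opBtop (n - k)) v‖
        + ‖mulTop (ρ - opBtop k) ((3 / 4 : ℝ) • opB (n - k))‖ := by
        refine (norm_sub_le _ _).trans (add_le_add ((norm_sub_le _ _).trans ?_) le_rfl)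
        rw [norm_neg]
    _ ≤ b * ‖n - k‖ + (c * ‖n - k‖) * (3 / 4 * (2 * R + (R + b * |S|)) + 1 / 2 * R)
        + (R + c * |S|) * (3 / 4 * (b * ‖n - k‖)) := by
        refine add_le_add (add_le_add (hB _) ?_) ?_
        · refine (norm_mulTop_le _ _).trans (mul_le_mul (hBt _) hvn (norm_nonneg _) (by positivity))
        · refine (norm_mulTop_le _ _).trans (mul_le_mul hm ?_ (norm_nonneg _) (by positivity))
          rw [norm_smul, Real.norm_of_nonneg (by norm_num)]
          exact mul_le_mul_of_nonneg_left (hB _) (by norm_num)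
    _ = _ := by ring

/-- The energy estimate and the growth of the vector field in terms of the `H¹` norm. -/
lemma regField_bounds {R : ℝ} (hR : 0 ≤ R) : ∃ c : ℝ, 0 ≤ c ∧ ∀ (a ζ r : L2) (ρ : Linf),
    ‖a‖ ≤ R → ‖ζ‖ ≤ R → ‖r‖ ≤ R → ‖ρ‖ ≤ R → ∀ (n : L2) (l : ℝ), l ∈ Icc (0 : ℝ) 1 →
      |inner ℝ (opD n) (regField a ζ r ρ (l • n))|
        ≤ c * (1 + (‖opB n‖ + ‖opD n‖) ^ 2) ∧
      ‖regField a ζ r ρ (l • n)‖ ≤ c * (1 + (‖opB n‖ + ‖opD n‖) ^ 2) := by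
  obtain ⟨c, hc0, hc⟩ := exists_norm_opBtop_le
  set W := 3 / 4 * (2 * R + R) + 1 / 2 * R with hW
  have hW0 : 0 ≤ W := by positivity
  set p := R + R + R * W with hp
  set q := 1 + R * (3 / 4) + c * W with hq
  have hp0 : 0 ≤ p := by positivity
  have hq0 : 0 ≤ q := by positivity
  refine ⟨p + q + 3 / 4 * c, by positivity, fun a ζ r ρ ha hζ hr hρ n l hl => ?_⟩
  set S := ‖opB n‖ + ‖opD n‖ with hS
  have hS0 : 0 ≤ S := by positivity
  set w := (3 / 4 : ℝ) • ((2 : ℝ) • a + r) - (1 / 2 : ℝ) • ζ with hw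
  set g := a + r - l • opB n + mulTop ρ (w - (3 / 4 * l : ℝ) • opB n)
    - l • mulTop (opBtop n) w with hg
  -- Only (3/4) l² (Bn)² is quadratic in n. The remainder g grows at most linearly in S, because S
  -- controls the L² and the sup norm of Bn.
  have e : regField a ζ r ρ (l • n) = g + (3 / 4 * l ^ 2 : ℝ) • mulTop (opBtop n) (opB n) := by
    rw [regField, hg]
    have h1 : (3 / 4 : ℝ) • ((2 : ℝ) • a + (r - opB (l • n))) - (1 / 2 : ℝ) • ζ
        = w - (3 / 4 * l : ℝ) • opB n := by rw [hw, map_smul]; module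
    rw [h1, map_smul opB, map_smul opBtop, map_sub mulTop, sub_apply,
      map_smul mulTop, smul_apply, map_sub (mulTop (opBtop n)),
      map_smul (mulTop (opBtop n))]
    module
  have hwn : ‖w‖ ≤ W := by
    rw [hw, hW]
    refine (norm_sub_le _ _).trans ?_
    rw [norm_smul, norm_smul, Real.norm_of_nonneg (by norm_num), Real.norm_of_nonneg (by norm_num)]
    gcongr
    refine (norm_add_le _ _).trans ?_
    rw [norm_smul, Real.norm_of_nonneg (by norm_num)]
    gcongr
  have hBS : ‖opB n‖ ≤ S := le_add_of_nonneg_right (norm_nonneg _)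
  have hDS : ‖opD n‖ ≤ S := le_add_of_nonneg_left (norm_nonneg _)
  have hlB : ‖l • opB n‖ ≤ S := by
    rw [norm_smul, Real.norm_of_nonneg hl.1]
    exact (mul_le_of_le_one_left (norm_nonneg _) hl.2).trans hBS
  have hgn : ‖g‖ ≤ p + q * S := by
    have h1 : ‖a + r - l • opB n‖ ≤ R + R + S :=
      (norm_sub_le _ _).trans (add_le_add ((norm_add_le _ _).trans (add_le_add ha hr)) hlB)
    have h2 : ‖mulTop ρ (w - (3 / 4 * l : ℝ) • opB n)‖ ≤ R * (W + 3 / 4 * S) := by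
      refine (norm_mulTop_le _ _).trans (mul_le_mul hρ ((norm_sub_le _ _).trans
        (add_le_add hwn ?_)) (norm_nonneg _) hR)
      rw [mul_smul, norm_smul, Real.norm_of_nonneg (by norm_num)]
      exact mul_le_mul_of_nonneg_left hlB (by norm_num)
    have h3 : ‖l • mulTop (opBtop n) w‖ ≤ c * S * W := by
      rw [norm_smul, Real.norm_of_nonneg hl.1]
      refine (mul_le_of_le_one_left (norm_nonneg _) hl.2).trans ?_
      exact (norm_mulTop_le _ _).trans (mul_le_mul (hc n) hwn (norm_nonneg _) (by positivity))
    calc ‖g‖ ≤ (R + R + S) + R * (W + 3 / 4 * S) + c * S * W :=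
          (norm_sub_le _ _).trans (add_le_add ((norm_add_le _ _).trans (add_le_add h1 h2)) h3)
      _ = _ := by rw [hp, hq]; ring
  constructor
  -- The quadratic term drops out by the cubic cancellation, for every value of l, so truncation
  -- does not spoil it.
  · rw [e, inner_add_right, inner_smul_right, inner_cubic, mul_zero, add_zero]
    refine (abs_real_inner_le_norm _ _).trans ((mul_le_mul hDS hgn (norm_nonneg _) hS0).trans ?_)
    nlinarith [mul_nonneg hp0 (sq_nonneg (S - 1)), mul_nonneg hc0 (sq_nonneg S),
      mul_nonneg hp0 (sq_nonneg S)]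
  · have h4 : ‖(3 / 4 * l ^ 2 : ℝ) • mulTop (opBtop n) (opB n)‖ ≤ 3 / 4 * (c * S * S) := by
      have hl2 : l ^ 2 ≤ 1 := pow_le_one₀ hl.1 hl.2
      rw [norm_smul, Real.norm_of_nonneg (by positivity)]
      refine mul_le_mul (by linarith) ?_ (norm_nonneg _) (by norm_num)
      exact (norm_mulTop_le _ _).trans (mul_le_mul (hc n) hBS (norm_nonneg _) (by positivity))
    rw [e]
    refine (norm_add_le _ _).trans ((add_le_add hgn h4).trans ?_)
    nlinarith [mul_nonneg hq0 (sq_nonneg (S - 1)), mul_nonneg hq0 (sq_nonneg S),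
      mul_nonneg hp0 (sq_nonneg S)]

/-- The factor 2 comes from the symmetry of D. -/
lemma hasDerivWithinAt_energy {n : ℝ → L2} {n' : L2} {s : Set ℝ} {t : ℝ}
    (h : HasDerivWithinAt n n' s t) :
    HasDerivWithinAt (fun t => -inner ℝ (opD (n t)) (n t)) (-2 * inner ℝ (opD (n t)) n') s t := by
  have h1 := (((opD.hasFDerivAt (x := n t)).comp_hasDerivWithinAt t h).inner ℝ h).neg
  convert! h1 using 1
  rw [inner_opD n' (n t), Function.comp_apply, real_inner_comm n']
  ring

/-- A priori bound for the regularised unknown. -/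
lemma apriori_bound {R T : ℝ} (hR : 0 ≤ R) (hT : 0 ≤ T) : ∃ C : ℝ, 0 ≤ C ∧
    ∀ (a ζ r : ℝ → L2) (ρ : ℝ → Linf),
    (∀ t ∈ Icc 0 T, ‖a t‖ ≤ R ∧ ‖ζ t‖ ≤ R ∧ ‖r t‖ ≤ R ∧ ‖ρ t‖ ≤ R) →
    ∀ (n : ℝ → L2) (l : ℝ → ℝ), n 0 = 0 → (∀ t, l t ∈ Icc (0 : ℝ) 1) →
      (∀ t ∈ Icc 0 T, HasDerivWithinAt n (regField (a t) (ζ t) (r t) (ρ t) (l t • n t))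
        (Icc 0 T) t) → ∀ t ∈ Icc 0 T, ‖n t‖ ≤ C := by
  obtain ⟨c, hc0, hc⟩ := regField_bounds hR
  -- Write E for the energy. By `regField_bounds` and S² ≤ 12 E, |E'| ≤ 2c(1 + S²) ≤ 24c E + 2c,
  -- with E = 0 at time 0; these are the Gronwall constants.
  obtain ⟨G, hG⟩ := (isCompact_Icc (a := (0 : ℝ)) (b := T)).exists_bound_of_continuousOn
    (f := gronwallBound 0 (24 * c) (2 * c))
    (fun x _ => (hasDerivAt_gronwallBound _ _ _ x).continuousAt.continuousWithinAt)
  have hG0 : 0 ≤ G := (norm_nonneg _).trans (hG 0 ⟨le_rfl, hT⟩)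
  refine ⟨c * (1 + 12 * G) * T, by positivity, fun a ζ r ρ hb n l hn0 hl hn => ?_⟩
  have hcn : ContinuousOn n (Icc 0 T) := fun t ht => (hn t ht).continuousWithinAt
  have hS : ∀ t, (‖opB (n t)‖ + ‖opD (n t)‖) ^ 2 ≤ 12 * (-inner ℝ (opD (n t)) (n t)) := fun t => by
    rw [← energy_identity]
    nlinarith [sq_nonneg (‖opB (n t)‖ - ‖opD (n t)‖), sq_nonneg (‖opB (n t)‖)]
  have hE0 : ∀ t, 0 ≤ -inner ℝ (opD (n t)) (n t) := fun t => by
    rw [← energy_identity]; positivity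
  have hE : ∀ t ∈ Icc 0 T, -inner ℝ (opD (n t)) (n t) ≤ G := by
    intro t ht
    have h1 := norm_le_gronwallBound_of_norm_deriv_right_le (a := 0) (b := T) (δ := 0)
      (K := 24 * c) (ε := 2 * c)
      (f := fun t => -inner ℝ (opD (n t)) (n t))
      (f' := fun t => -2 * inner ℝ (opD (n t)) (regField (a t) (ζ t) (r t) (ρ t) (l t • n t)))
      (fun t ht => (hasDerivWithinAt_energy (hn t ht)).continuousWithinAt)
      (fun t ht => (hasDerivWithinAt_energy (hn t ⟨ht.1, ht.2.le⟩)).mono_of_mem_nhdsWithin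
        (Icc_mem_nhdsGE_of_mem ht)) (by simp [hn0])
      (fun t ht => by
        obtain ⟨b1, b2, b3, b4⟩ := hb t ⟨ht.1, ht.2.le⟩
        have := (hc _ _ _ _ b1 b2 b3 b4 (n t) (l t) (hl t)).1
        rw [Real.norm_of_nonneg (hE0 t), norm_mul, Real.norm_eq_abs, Real.norm_eq_abs]
        have h2 : |(-2 : ℝ)| = 2 := by norm_num
        rw [h2]
        nlinarith [mul_le_mul_of_nonneg_left (hS t) hc0]) t ht
    rw [sub_zero, Real.norm_of_nonneg (hE0 t)] at h1
    exact h1.trans ((le_abs_self _).trans (hG t ht))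
  intro t ht
  -- The energy does not bound ‖n‖ itself. It bounds ‖n'‖ through the growth estimate, and n starts
  -- from 0.
  have h2 := norm_image_sub_le_of_norm_deriv_le_segment' (f := n) (C := c * (1 + 12 * G)) hn
    (fun t ht => by
      obtain ⟨b1, b2, b3, b4⟩ := hb t ⟨ht.1, ht.2.le⟩
      refine (hc _ _ _ _ b1 b2 b3 b4 (n t) (l t) (hl t)).2.trans ?_
      refine mul_le_mul_of_nonneg_left ?_ hc0
      have := hE t ⟨ht.1, ht.2.le⟩
      linarith [hS t]) t ht
  rw [hn0, sub_zero, sub_zero] at h2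
  exact h2.trans (mul_le_mul_of_nonneg_left ht.2 (by positivity))

/-- Global existence for the integrated equation, with a uniform bound. -/
theorem exists_mild {R T : ℝ} (hR : 0 ≤ R) (hT : 0 ≤ T) : ∃ C : ℝ, ∀ a ζ : ℝ → L2,
    Continuous a → Continuous ζ → (∀ t ∈ Icc 0 T, ‖a t‖ ≤ R ∧ ‖ζ t‖ ≤ R) →
      ∃ η, IsMild T a ζ η ∧ ∀ t ∈ Icc 0 T, ‖η t‖ ≤ C := by
  set b := ‖opB₁‖
  set c := ‖opB₁top‖
  have hb0 : 0 ≤ b := norm_nonneg _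
  have hc0 : 0 ≤ c := norm_nonneg _
  set N := (3 / 4 * R + 1 / 2 * R) * R * T with hN
  have hN0 : 0 ≤ N := by positivity
  set R' := R + b * N + c * N with hR'
  have hR'0 : 0 ≤ R' := by positivity
  obtain ⟨C, hC0, hC⟩ := apriori_bound hR'0 hT
  refine ⟨R + (R' + ‖opB‖ * C), fun a ζ ha hζ hb => ?_⟩
  -- The part of the flux that involves only a and ζ is known but merely in L¹; its primitive n₁ is
  -- computed beforehand and enters through r and ρ.
  set h : ℝ → L1 := fun t => mulTwo ((3 / 4 : ℝ) • a t - (1 / 2 : ℝ) • ζ t) (a t) with hh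
  have hhc : Continuous h := by rw [hh]; fun_prop
  set n₁ : ℝ → L1 := fun t => ∫ τ in 0..t, h τ with hn₁
  have hn₁d : ∀ t, HasDerivAt n₁ (h t) t := fun t => hhc.integral_hasStrictDerivAt 0 t |>.hasDerivAt
  have hn₁c : Continuous n₁ := continuous_iff_continuousAt.2 fun t => (hn₁d t).continuousAt
  have hn₁N : ∀ t ∈ Icc 0 T, ‖n₁ t‖ ≤ N := by
    intro t ht
    have h1 := intervalIntegral.norm_integral_le_of_norm_le_const (f := h) (a := 0) (b := t)
      (C := (3 / 4 * R + 1 / 2 * R) * R) (fun τ hτ => by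
        rw [uIoc_of_le ht.1] at hτ
        obtain ⟨b1, b2⟩ := hb τ ⟨hτ.1.le, hτ.2.trans ht.2⟩
        refine (norm_mulTwo_le _ _).trans (mul_le_mul ((norm_sub_le _ _).trans ?_) b1
          (norm_nonneg _) (by positivity))
        rw [norm_smul, norm_smul, Real.norm_of_nonneg (by norm_num),
          Real.norm_of_nonneg (by norm_num)]
        gcongr)
    rw [sub_zero, abs_of_nonneg ht.1] at h1
    exact h1.trans (mul_le_mul_of_nonneg_left ht.2 (by positivity))
  set r : ℝ → L2 := fun t => -opB₁ (n₁ t) with hr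
  set ρ : ℝ → Linf := fun t => -opB₁top (n₁ t) with hρ
  have hrc : Continuous r := by rw [hr]; fun_prop
  have hρc : Continuous ρ := by rw [hρ]; fun_prop
  have hρr : ∀ t, ρ t =ᵐ[volume] r t := fun t => by
    filter_upwards [Lp.coeFn_neg (opB₁ (n₁ t)), Lp.coeFn_neg (opB₁top (n₁ t)),
      opB₁top_ae_eq (n₁ t)] with x h1 h2 h3
    rw [hr, hρ, h1, h2, Pi.neg_apply, Pi.neg_apply, h3]
  have hall : ∀ t ∈ Icc 0 T, ‖a t‖ ≤ R' ∧ ‖ζ t‖ ≤ R' ∧ ‖r t‖ ≤ R' ∧ ‖ρ t‖ ≤ R' := by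
    intro t ht
    have i1 : 0 ≤ b * N := by positivity
    have i2 : 0 ≤ c * N := by positivity
    refine ⟨(hb t ht).1.trans (by linarith), (hb t ht).2.trans (by linarith), ?_, ?_⟩
    · rw [hr, norm_neg]
      have := (opB₁.le_opNorm (n₁ t)).trans (mul_le_mul_of_nonneg_left (hn₁N t ht) hb0)
      linarith
    · rw [hρ, norm_neg]
      have := (opB₁top.le_opNorm (n₁ t)).trans (mul_le_mul_of_nonneg_left (hn₁N t ht) hc0)
      linarith
  obtain ⟨n, hn0, hn⟩ := exists_solution_of_apriori_bound hT
    (f := fun t x => regField (a t) (ζ t) (r t) (ρ t) x) (C := C)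
    (fun x => Continuous.continuousOn (by unfold regField; fun_prop))
    (fun S => (lipschitz_regField hR'0 S).imp fun K hK t ht => by
      obtain ⟨b1, b2, b3, b4⟩ := hall t ht
      exact hK _ _ _ _ b1 b2 b3 b4)
    (hC a ζ r ρ hall)
  -- For the untruncated solution the a priori bound is used with factor 1; the constant depends on
  -- R and T only, so it is uniform in the data.
  have hnC := hC a ζ r ρ hall n (fun _ => 1) hn0 (fun _ => ⟨zero_le_one, le_rfl⟩)
    (fun t ht => by rw [one_smul]; exact hn t ht)
  have hnc : ContinuousOn n (Icc 0 T) := fun t ht => (hn t ht).continuousWithinAt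
  have hyc : ContinuousOn (fun t => r t - opB (n t)) (Icc 0 T) :=
    hrc.continuousOn.sub (opB.continuous.comp_continuousOn hnc)
  have hηc : ContinuousOn (fun t => a t + (r t - opB (n t))) (Icc 0 T) := ha.continuousOn.add hyc
  refine ⟨fun t => a t + (r t - opB (n t)), ⟨hηc, fun t ht => ?_⟩, fun t ht => ?_⟩
  · have hd : ∀ t ∈ Icc 0 T, HasDerivWithinAt (fun t => r t - opB (n t))
        (-fluxOp (a t + (r t - opB (n t))) (ζ t)) (Icc 0 T) t := by
      intro t ht
      rw [fluxOp_eq (hρr t), neg_add']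
      exact ((opB₁.hasFDerivAt.comp_hasDerivAt t (hn₁d t)).neg.hasDerivWithinAt).sub
        (opB.hasFDerivAt.comp_hasDerivWithinAt t (hn t ht))
    have hfc : ContinuousOn (fun t => -fluxOp (a t + (r t - opB (n t))) (ζ t)) (Icc 0 T) :=
      (continuous_fluxOp.comp_continuousOn (hηc.prodMk hζ.continuousOn)).neg
    have hsub : Icc 0 t ⊆ Icc 0 T := Icc_subset_Icc_right ht.2
    have h1 := intervalIntegral.integral_eq_sub_of_hasDeriv_right_of_le ht.1 (hyc.mono hsub)
      (fun s hs => (hd s (hsub (Ioo_subset_Icc_self hs))).mono_of_mem_nhdsWithin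
        (mem_nhdsWithin_of_mem_nhds (Icc_mem_nhds hs.1 (hs.2.trans_le ht.2))))
      ((hfc.mono hsub).intervalIntegrable_of_Icc ht.1)
    rw [intervalIntegral.integral_neg] at h1
    have h0 : r 0 - opB (n 0) = 0 := by simp [hr, hn₁, hn0]
    rw [h0, sub_zero] at h1
    simp only
    rw [← h1, sub_eq_add_neg]
  · obtain ⟨b1, b2, b3, b4⟩ := hall t ht
    refine (norm_add_le _ _).trans (add_le_add (hb t ht).1 ((norm_sub_le _ _).trans
      (add_le_add b3 ((opB.le_opNorm _).trans ?_))))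
    exact mul_le_mul_of_nonneg_left (hnC t ht) (norm_nonneg _)

end

/-! ### Lipschitz dependence on the data and uniqueness -/

noncomputable section

lemma norm_fluxOp_sub_le {R : ℝ} : ∃ c : ℝ, 0 < c ∧ ∀ u z u' z' : L2, ‖u‖ ≤ R → ‖u'‖ ≤ R →
    ‖z‖ ≤ R → ‖fluxOp u z - fluxOp u' z'‖ ≤ c * (‖u - u'‖ + ‖z - z'‖) := by
  refine ⟨‖opB‖ + 2 * (‖opB₁‖ * |R|) + 1, by positivity, fun u z u' z' hu hu' hz => ?_⟩
  have hu := hu.trans (le_abs_self R)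
  have hu' := hu'.trans (le_abs_self R)
  have hz := hz.trans (le_abs_self R)
  have e : fluxOp u z - fluxOp u' z' = opB (u - u')
      + opB₁ (mulTwo ((3 / 4 : ℝ) • u - (1 / 2 : ℝ) • z) (u - u')
        + mulTwo ((3 / 4 : ℝ) • (u - u') - (1 / 2 : ℝ) • (z - z')) u') := by
    have e1 : mulTwo ((3 / 4 : ℝ) • u - (1 / 2 : ℝ) • z) (u - u')
        + mulTwo ((3 / 4 : ℝ) • (u - u') - (1 / 2 : ℝ) • (z - z')) u'
        = mulTwo ((3 / 4 : ℝ) • u - (1 / 2 : ℝ) • z) u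
          - mulTwo ((3 / 4 : ℝ) • u' - (1 / 2 : ℝ) • z') u' := by
      simp only [map_sub, map_smul, sub_apply, smul_apply, smul_sub]
      abel
    rw [e1, fluxOp, fluxOp, map_sub opB, map_sub opB₁, add_sub_add_comm]
  have h1 : ‖mulTwo ((3 / 4 : ℝ) • u - (1 / 2 : ℝ) • z) (u - u')‖
      ≤ (3 / 4 * |R| + 1 / 2 * |R|) * ‖u - u'‖ := by
    refine (norm_mulTwo_le _ _).trans (mul_le_mul_of_nonneg_right ((norm_sub_le _ _).trans ?_)
      (norm_nonneg _))
    rw [norm_smul, norm_smul, Real.norm_of_nonneg (by norm_num), Real.norm_of_nonneg (by norm_num)]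
    gcongr
  have h2 : ‖mulTwo ((3 / 4 : ℝ) • (u - u') - (1 / 2 : ℝ) • (z - z')) u'‖
      ≤ (3 / 4 * ‖u - u'‖ + 1 / 2 * ‖z - z'‖) * |R| := by
    refine (norm_mulTwo_le _ _).trans (mul_le_mul ((norm_sub_le _ _).trans ?_) hu'
      (norm_nonneg _) (by positivity))
    rw [norm_smul, norm_smul, Real.norm_of_nonneg (by norm_num), Real.norm_of_nonneg (by norm_num)]
  have h3 := opB.le_opNorm (u - u')
  have h4 := (opB₁.le_opNorm (mulTwo ((3 / 4 : ℝ) • u - (1 / 2 : ℝ) • z) (u - u')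
        + mulTwo ((3 / 4 : ℝ) • (u - u') - (1 / 2 : ℝ) • (z - z')) u')).trans
    (mul_le_mul_of_nonneg_left ((norm_add_le _ _).trans (add_le_add h1 h2)) (norm_nonneg _))
  rw [e]
  refine (norm_add_le _ _).trans ((add_le_add h3 h4).trans ?_)
  have p1 : 0 ≤ ‖opB‖ * ‖z - z'‖ := by positivity
  have p2 : 0 ≤ ‖opB₁‖ * |R| * ‖z - z'‖ := by positivity
  nlinarith [norm_nonneg (u - u'), norm_nonneg (z - z')]

/-- A curve that is continuous on `[0, T]` agrees there with a continuous curve. -/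
lemma exists_continuous_eqOn {Y : Type*} [TopologicalSpace Y] {T : ℝ} (hT : 0 ≤ T) {η : ℝ → Y}
    (h : ContinuousOn η (Icc 0 T)) : ∃ η', Continuous η' ∧ EqOn η η' (Icc 0 T) :=
  ⟨IccExtend hT ((Icc 0 T).domRestrict η), (continuousOn_iff_continuous_domRestrict.1 h).Icc_extend',
    fun _ ht => (IccExtend_of_mem hT ((Icc 0 T).domRestrict η) ht).symm⟩

lemma IsMild.congr {T : ℝ} {a ζ η η' : ℝ → L2} (h : IsMild T a ζ η) (he : EqOn η η' (Icc 0 T)) :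
    IsMild T a ζ η' := by
  refine ⟨h.1.congr he.symm, fun t ht => ?_⟩
  rw [← he ht, h.2 t ht]
  congr 1
  refine intervalIntegral.integral_congr fun τ hτ => ?_
  rw [uIcc_of_le ht.1] at hτ
  rw [he ⟨hτ.1, hτ.2.trans ht.2⟩]

lemma hasDerivAt_integral_fluxOp {ζ η : ℝ → L2} (hζ : Continuous ζ) (hη : Continuous η) (t : ℝ) :
    HasDerivAt (fun t => ∫ τ in 0..t, fluxOp (η τ) (ζ τ)) (fluxOp (η t) (ζ t)) t :=
  ((continuous_fluxOp.comp (hη.prodMk hζ)).integral_hasStrictDerivAt 0 t).hasDerivAt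

/-- Lipschitz dependence of the solution of the integrated equation on the data. -/
theorem mild_lipschitz {R T : ℝ} (hT : 0 ≤ T) : ∃ K : ℝ, 0 ≤ K ∧ ∀ a ζ η a' ζ' η' : ℝ → L2,
    Continuous ζ → Continuous ζ' → IsMild T a ζ η → IsMild T a' ζ' η' →
    (∀ t ∈ Icc 0 T, ‖η t‖ ≤ R ∧ ‖η' t‖ ≤ R ∧ ‖ζ t‖ ≤ R) →
    ∀ δ : ℝ, (∀ t ∈ Icc 0 T, ‖a t - a' t‖ ≤ δ ∧ ‖ζ t - ζ' t‖ ≤ δ) →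
      ∀ t ∈ Icc 0 T, ‖η t - η' t‖ ≤ K * δ := by
  obtain ⟨c, hc0, hc⟩ := norm_fluxOp_sub_le (R := R)
  -- Gronwall gives ‖d(t)‖ ≤ 2δ(exp(ct) - 1) for the difference d of the time integrals; adding the
  -- δ from the data stays below 2δ exp(cT).
  refine ⟨2 * Real.exp (c * T), by positivity,
    fun a ζ η a' ζ' η' hζ hζ' hη hη' hR δ hδ t ht => ?_⟩
  obtain ⟨u, huc, hu⟩ := exists_continuous_eqOn hT hη.1
  obtain ⟨u', huc', hu'⟩ := exists_continuous_eqOn hT hη'.1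
  have hm := hη.congr hu
  have hm' := hη'.congr hu'
  have hδ0 : 0 ≤ δ := (norm_nonneg _).trans (hδ t ht).1
  -- The difference of the solutions need not be differentiable because a - a' is only continuous.
  -- The difference of the integrals is differentiable, and u - u' = d + (a - a').
  set d : ℝ → L2 := fun t => (∫ τ in 0..t, fluxOp (u' τ) (ζ' τ))
    - ∫ τ in 0..t, fluxOp (u τ) (ζ τ) with hd
  have hdd : ∀ t, HasDerivAt d (fluxOp (u' t) (ζ' t) - fluxOp (u t) (ζ t)) t := fun t =>
    (hasDerivAt_integral_fluxOp hζ' huc' t).sub (hasDerivAt_integral_fluxOp hζ huc t)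
  have hud : ∀ t ∈ Icc 0 T, ‖u t - u' t‖ ≤ ‖d t‖ + δ := fun t ht => by
    have : u t - u' t = d t + (a t - a' t) := by
      rw [hm.2 t ht, hm'.2 t ht, hd, sub_sub_sub_comm, sub_eq_add_neg, neg_sub, add_comm]
    rw [this]
    exact (norm_add_le _ _).trans (add_le_add le_rfl (hδ t ht).1)
  have h1 := norm_le_gronwallBound_of_norm_deriv_right_le (a := 0) (b := T) (δ := 0) (K := c)
    (ε := c * (2 * δ)) (f := d) (f' := fun t => fluxOp (u' t) (ζ' t) - fluxOp (u t) (ζ t))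
    (fun t _ => (hdd t).continuousAt.continuousWithinAt)
    (fun t _ => (hdd t).hasDerivWithinAt) (by simp [hd])
    (fun t ht' => by
      have ht : t ∈ Icc 0 T := ⟨ht'.1, ht'.2.le⟩
      obtain ⟨r1, r2, r3⟩ := hR t ht
      rw [hu ht] at r1
      rw [hu' ht] at r2
      rw [norm_sub_rev]
      refine (hc _ _ _ _ r1 r2 r3).trans ?_
      rw [← mul_add]
      refine mul_le_mul_of_nonneg_left ?_ hc0.le
      linarith [hud t ht, (hδ t ht).2]) t ht
  rw [gronwallBound_of_K_ne_0 hc0.ne'] at h1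
  have h2 : c * (2 * δ) / c = 2 * δ := by field_simp
  simp only [zero_mul, zero_add, sub_zero, h2] at h1
  rw [hu ht, hu' ht]
  refine (hud t ht).trans ((add_le_add h1 le_rfl).trans ?_)
  have h3 : Real.exp (c * t) ≤ Real.exp (c * T) :=
    Real.exp_le_exp.2 (mul_le_mul_of_nonneg_left ht.2 hc0.le)
  nlinarith

theorem IsMild.eqOn {T : ℝ} (hT : 0 ≤ T) {a ζ η η' : ℝ → L2} (hζ : Continuous ζ)
    (h : IsMild T a ζ η) (h' : IsMild T a ζ η') : EqOn η η' (Icc 0 T) := by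
  obtain ⟨R₁, h1⟩ := isCompact_Icc.exists_bound_of_continuousOn h.1
  obtain ⟨R₂, h2⟩ := isCompact_Icc.exists_bound_of_continuousOn h'.1
  obtain ⟨R₃, h3⟩ := isCompact_Icc.exists_bound_of_continuousOn (hζ.continuousOn (s := Icc 0 T))
  obtain ⟨K, -, hK⟩ := mild_lipschitz (R := max R₁ (max R₂ R₃)) hT
  intro t ht
  have := hK a ζ η a ζ η' hζ hζ h h' (fun t ht => ⟨(h1 t ht).trans (by simp),
    (h2 t ht).trans (by simp), (h3 t ht).trans (by simp)⟩) 0 (fun t _ => by simp) t ht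
  rw [mul_zero, norm_le_zero_iff, sub_eq_zero] at this
  exact this

end

/-! ### Translations and test functions as curves in L² -/

noncomputable section

/-- The translation `f ↦ f(· - r)` on `L²`. -/
def transl (r : ℝ) : L2 →ₗᵢ[ℝ] L2 :=
  Lp.compMeasurePreservingₗᵢ ℝ (fun x => x - r) (measurePreserving_sub_right volume r)

lemma coeFn_transl (r : ℝ) (f : L2) : transl r f =ᵐ[volume] fun x => f (x - r) :=
  Lp.coeFn_compMeasurePreserving f (measurePreserving_sub_right volume r)

lemma continuous_transl (f : L2) : Continuous fun r => transl r f := by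
  have h := Continuous.compMeasurePreservingLp (p := 2) (μ := (volume : Measure ℝ))
    (ν := (volume : Measure ℝ)) (g := fun r : ℝ => (⟨fun x => x - r, by fun_prop⟩ : C(ℝ, ℝ)))
    (f := fun _ : ℝ => f) continuous_const (ContinuousMap.continuous_of_continuous_uncurry _
      (show Continuous fun p : ℝ × ℝ => p.2 - p.1 by fun_prop)) (fun r => measurePreserving_sub_right volume r) (by simp)
  exact h

lemma inner_transl_toL2 (r : ℝ) (f : L2) {g : ℝ → ℝ} (hg : MemLp g 2)
    (hg' : MemLp (fun y => g (y + r)) 2) :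
    inner ℝ (transl r f) (toL2 g) = inner ℝ f (toL2 fun y => g (y + r)) := by
  rw [inner_L2_eq (coeFn_transl r f) (coeFn_toL2 hg),
    inner_L2_eq (Filter.EventuallyEq.refl _ f) (coeFn_toL2 hg'),
    ← integral_add_right_eq_self _ r]
  simp

/-- A continuous compactly supported function of two variables. -/
structure IsFamily (Φ : ℝ → ℝ → ℝ) : Prop where
  continuous : Continuous fun q : ℝ × ℝ => Φ q.1 q.2
  compact : HasCompactSupport fun q : ℝ × ℝ => Φ q.1 q.2

namespace IsFamily

variable {Φ Φ₁ : ℝ → ℝ → ℝ}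

lemma exists_radius (h : IsFamily Φ) : ∃ R : ℝ, 0 < R ∧ ∀ t x, R < |x| → Φ t x = 0 := by
  obtain ⟨R, hR0, hR⟩ := h.compact.isCompact.isBounded.subset_closedBall_lt 0 0
  refine ⟨R, hR0, fun t x hx => ?_⟩
  by_contra hne
  have h2 : (t, x) ∈ Metric.closedBall (0 : ℝ × ℝ) R := hR (subset_tsupport _ hne)
  rw [mem_closedBall_zero_iff, Prod.norm_def] at h2
  exact absurd ((le_max_right _ _).trans h2) (not_le.2 hx)

lemma continuous_apply (h : IsFamily Φ) (t : ℝ) : Continuous (Φ t) :=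
  h.continuous.comp (Continuous.prodMk_right t)

lemma compact_apply (h : IsFamily Φ) (t : ℝ) : HasCompactSupport (Φ t) := by
  obtain ⟨R, -, hR⟩ := h.exists_radius
  refine HasCompactSupport.intro (isCompact_Icc (a := -R) (b := R)) fun x hx => hR t x ?_
  rw [mem_Icc, ← abs_le, not_le] at hx
  exact hx

lemma memLp (h : IsFamily Φ) (t : ℝ) : MemLp (Φ t) 2 :=
  (h.continuous_apply t).memLp_of_hasCompactSupport (h.compact_apply t)

lemma coeFn (h : IsFamily Φ) (t : ℝ) : toL2 (Φ t) =ᵐ[volume] Φ t := coeFn_toL2 (h.memLp t)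

end IsFamily

lemma norm_toL2_le_of_bound {g : ℝ → ℝ} (hg : MemLp g 2) {R ε : ℝ} (hε : 0 ≤ ε)
    (h0 : ∀ x, R < |x| → g x = 0) (hb : ∀ x, |g x| ≤ ε) :
    ‖toL2 g‖ ≤ ‖toL2 ((Icc (-R) R).indicator fun _ => (1 : ℝ))‖ * ε := by
  have hm : MemLp ((Icc (-R) R).indicator fun _ => (1 : ℝ)) 2 :=
    memLp_indicator_const 2 measurableSet_Icc 1 (Or.inr (by simp))
  rw [mul_comm]
  refine Lp.norm_le_mul_norm_of_ae_le_mul ?_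
  filter_upwards [coeFn_toL2 hg, coeFn_toL2 hm] with x h1 h2
  rw [h1, h2]
  by_cases hx : x ∈ Icc (-R) R
  · simpa [hx] using hb x
  · rw [mem_Icc, ← abs_le, not_le] at hx
    simp only [h0 x hx, norm_zero]
    positivity

namespace IsFamily

variable {Φ Φ₁ : ℝ → ℝ → ℝ}

lemma uniform (h : IsFamily Φ) {ε : ℝ} (hε : 0 < ε) :
    ∃ δ > 0, ∀ s t, |s - t| < δ → ∀ x, |Φ s x - Φ t x| ≤ ε := by
  obtain ⟨δ, hδ, H⟩ := Metric.uniformContinuous_iff.1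
    (h.compact.uniformContinuous_of_continuous h.continuous) ε hε
  refine ⟨δ, hδ, fun s t hst x => ?_⟩
  have := @H (s, x) (t, x) (by simpa [Prod.dist_eq, Real.dist_eq] using hst)
  simp only [Real.dist_eq] at this
  exact this.le

lemma continuous_toL2 (h : IsFamily Φ) : Continuous fun t => toL2 (Φ t) := by
  obtain ⟨R, hR0, hR⟩ := h.exists_radius
  set C := ‖toL2 ((Icc (-R) R).indicator fun _ => (1 : ℝ))‖ with hC
  rw [Metric.continuous_iff]
  intro t ε hε
  obtain ⟨δ, hδ, H⟩ := h.uniform (ε := ε / (C + 1)) (by positivity)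
  refine ⟨δ, hδ, fun s hs => ?_⟩
  rw [dist_eq_norm, ← toL2_sub (h.memLp s) (h.memLp t)]
  refine (norm_toL2_le_of_bound (g := fun x => Φ s x - Φ t x) (R := R)
    ((h.memLp s).sub (h.memLp t)) (by positivity : 0 ≤ ε / (C + 1))
    (fun x hx => by simp [hR _ x hx]) (fun x => H s t hs x)).trans_lt ?_
  rw [← hC, mul_div_assoc', div_lt_iff₀ (by positivity)]
  nlinarith

/-- The supports lie in one fixed bounded interval, so the mean value inequality at each x, with a
modulus of continuity of Φ₁ uniform in x, bounds the remainder uniformly and hence in L². -/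
lemma hasDerivAt_toL2 (h : IsFamily Φ) (h₁ : IsFamily Φ₁)
    (hd : ∀ t x, HasDerivAt (fun r => Φ r x) (Φ₁ t x) t) (t : ℝ) :
    HasDerivAt (fun t => toL2 (Φ t)) (toL2 (Φ₁ t)) t := by
  obtain ⟨R, hR0, hR⟩ := h.exists_radius
  obtain ⟨R₁, hR₁0, hR₁⟩ := h₁.exists_radius
  set C := ‖toL2 ((Icc (-(max R R₁)) (max R R₁)).indicator fun _ => (1 : ℝ))‖ with hC
  rw [hasDerivAt_iff_isLittleO, Asymptotics.isLittleO_iff]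
  intro ε hε
  obtain ⟨δ, hδ, H⟩ := h₁.uniform (ε := ε / (C + 1)) (by positivity)
  filter_upwards [Metric.ball_mem_nhds t hδ] with s hs
  have m1 := (h.memLp s).sub (h.memLp t)
  have m2 := (h₁.memLp t).const_mul (s - t)
  rw [← toL2_sub (h.memLp s) (h.memLp t), ← toL2_const_mul _ (h₁.memLp t),
    ← toL2_sub (f := fun x => Φ s x - Φ t x) m1 m2]
  have hb : ∀ x, |Φ s x - Φ t x - (s - t) * Φ₁ t x| ≤ ε / (C + 1) * |s - t| := by
    intro x
    have h1 := (convex_ball t δ).norm_image_sub_le_of_norm_hasDerivWithin_le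
      (f := fun r => Φ r x - r * Φ₁ t x) (f' := fun r => Φ₁ r x - 1 * Φ₁ t x) (C := ε / (C + 1))
      (x := t) (y := s)
      (fun r _ => ((hd r x).sub ((hasDerivAt_id r).mul_const _)).hasDerivWithinAt)
      (fun r hr => by
        rw [one_mul]; exact H r t (by simpa [Real.dist_eq] using hr) x)
      (Metric.mem_ball_self hδ) hs
    rw [Real.norm_eq_abs, Real.norm_eq_abs] at h1
    convert h1 using 2
    ring
  refine (norm_toL2_le_of_bound (g := fun x => Φ s x - Φ t x - (s - t) * Φ₁ t x)
    (R := max R R₁) (m1.sub m2)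
    (by positivity : 0 ≤ ε / (C + 1) * |s - t|) (fun x hx => ?_) hb).trans ?_
  · have e1 := (le_max_left R R₁).trans_lt hx
    have e2 := (le_max_right R R₁).trans_lt hx
    simp [hR _ x e1, hR₁ _ x e2]
  · rw [← hC, Real.norm_eq_abs, ← mul_assoc]
    refine mul_le_mul_of_nonneg_right ?_ (abs_nonneg _)
    rw [mul_div_assoc', div_le_iff₀ (by positivity)]
    nlinarith

end IsFamily

/-- A smooth compactly supported function of two variables. -/
structure IsBump₂ (φ : ℝ → ℝ → ℝ) : Prop where
  smooth : ContDiff ℝ ∞ fun q : ℝ × ℝ => φ q.1 q.2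
  compact : HasCompactSupport fun q : ℝ × ℝ => φ q.1 q.2

/-- The partial derivative in the first variable. -/
def dt (φ : ℝ → ℝ → ℝ) (t x : ℝ) : ℝ := deriv (fun r => φ r x) t

/-- The partial derivative in the second variable. -/
def dx (φ : ℝ → ℝ → ℝ) (t x : ℝ) : ℝ := deriv (φ t) x

namespace IsBump₂

variable {φ : ℝ → ℝ → ℝ}

lemma isFamily (h : IsBump₂ φ) : IsFamily φ := ⟨h.smooth.continuous, h.compact⟩

lemma hasFDerivAt (h : IsBump₂ φ) (q : ℝ × ℝ) :
    HasFDerivAt (fun q : ℝ × ℝ => φ q.1 q.2) (fderiv ℝ (fun q : ℝ × ℝ => φ q.1 q.2) q) q :=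
  (h.smooth.differentiable (by simp) q).hasFDerivAt

lemma hasDerivAt_fst (h : IsBump₂ φ) (t x : ℝ) : HasDerivAt (fun r => φ r x)
    (fderiv ℝ (fun q : ℝ × ℝ => φ q.1 q.2) (t, x) (1, 0)) t :=
  (h.hasFDerivAt (t, x)).comp_hasDerivAt (f := fun r => (r, x)) t ((hasDerivAt_id t).prodMk (hasDerivAt_const t x))

lemma hasDerivAt_snd (h : IsBump₂ φ) (t x : ℝ) : HasDerivAt (φ t)
    (fderiv ℝ (fun q : ℝ × ℝ => φ q.1 q.2) (t, x) (0, 1)) x :=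
  (h.hasFDerivAt (t, x)).comp_hasDerivAt (f := fun y => (t, y)) x ((hasDerivAt_const x t).prodMk (hasDerivAt_id x))

lemma dt_eq (h : IsBump₂ φ) : (fun q : ℝ × ℝ => dt φ q.1 q.2)
    = fun q => fderiv ℝ (fun q : ℝ × ℝ => φ q.1 q.2) q (1, 0) :=
  funext fun q => (h.hasDerivAt_fst q.1 q.2).deriv

lemma dx_eq (h : IsBump₂ φ) : (fun q : ℝ × ℝ => dx φ q.1 q.2)
    = fun q => fderiv ℝ (fun q : ℝ × ℝ => φ q.1 q.2) q (0, 1) :=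
  funext fun q => (h.hasDerivAt_snd q.1 q.2).deriv

lemma hasDerivAt_dt (h : IsBump₂ φ) (t x : ℝ) : HasDerivAt (fun r => φ r x) (dt φ t x) t :=
  (h.hasDerivAt_fst t x).differentiableAt.hasDerivAt

lemma smooth_fderiv_apply (h : IsBump₂ φ) (v : ℝ × ℝ) :
    ContDiff ℝ ∞ fun q => fderiv ℝ (fun q : ℝ × ℝ => φ q.1 q.2) q v :=
  (h.smooth.fderiv_right (m := ∞) (by simp)).clm_apply contDiff_const

lemma dt (h : IsBump₂ φ) : IsBump₂ (dt φ) := by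
  refine ⟨?_, ?_⟩ <;> rw [h.dt_eq]
  exacts [h.smooth_fderiv_apply _, h.compact.fderiv_apply ℝ _]

lemma dx (h : IsBump₂ φ) : IsBump₂ (dx φ) := by
  refine ⟨?_, ?_⟩ <;> rw [h.dx_eq]
  exacts [h.smooth_fderiv_apply _, h.compact.fderiv_apply ℝ _]

lemma tsupport_dt (h : IsBump₂ φ) : tsupport (fun q : ℝ × ℝ => _root_.dt φ q.1 q.2)
    ⊆ tsupport fun q : ℝ × ℝ => φ q.1 q.2 := by
  rw [h.dt_eq]; exact tsupport_fderiv_apply_subset ℝ _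

lemma tsupport_dx (h : IsBump₂ φ) : tsupport (fun q : ℝ × ℝ => _root_.dx φ q.1 q.2)
    ⊆ tsupport fun q : ℝ × ℝ => φ q.1 q.2 := by
  rw [h.dx_eq]; exact tsupport_fderiv_apply_subset ℝ _

lemma dt_dx (h : IsBump₂ φ) : _root_.dt (_root_.dx φ) = _root_.dx (_root_.dt φ) := by
  ext t x
  have e1 : _root_.dt (_root_.dx φ) t x = _ := congr_fun h.dx.dt_eq (t, x)
  have e2 : _root_.dx (_root_.dt φ) t x = _ := congr_fun h.dt.dx_eq (t, x)
  rw [e1, e2, h.dx_eq, h.dt_eq]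
  have hd : Differentiable ℝ (fderiv ℝ fun q : ℝ × ℝ => φ q.1 q.2) :=
    (h.smooth.fderiv_right (m := ∞) (by simp)).differentiable (by simp)
  have hsymm : IsSymmSndFDerivAt ℝ (fun q : ℝ × ℝ => φ q.1 q.2) (t, x) :=
    h.smooth.contDiffAt.isSymmSndFDerivAt (by simp; norm_cast)
  rw [fderiv_clm_apply (hd _) (differentiableAt_const _),
    fderiv_clm_apply (hd _) (differentiableAt_const _)]
  simpa using hsymm (1, 0) (0, 1)

lemma isBump (h : IsBump₂ φ) (t : ℝ) : IsBump (φ t) :=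
  ⟨h.smooth.comp (contDiff_const.prodMk contDiff_id), h.isFamily.compact_apply t⟩

lemma hasDerivAt_toL2 (h : IsBump₂ φ) (t : ℝ) :
    HasDerivAt (fun t => toL2 (φ t)) (toL2 (_root_.dt φ t)) t :=
  h.isFamily.hasDerivAt_toL2 h.dt.isFamily h.hasDerivAt_dt t

lemma helm_dt (h : IsBump₂ φ) (t : ℝ) :
    helm (_root_.dt φ t) = fun x => _root_.dt φ t x
      - 1 / 6 * _root_.dt (_root_.dx (_root_.dx φ)) t x := by
  have : _root_.dt (_root_.dx (_root_.dx φ)) = _root_.dx (_root_.dx (_root_.dt φ)) := by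
    rw [h.dx.dt_dx, h.dt_dx]
  rw [this]; rfl

lemma hasDerivAt_toL2_helm (h : IsBump₂ φ) (t : ℝ) :
    HasDerivAt (fun t => toL2 (helm (φ t))) (toL2 (helm (_root_.dt φ t))) t := by
  rw [h.helm_dt, toL2_sub (h.dt.isFamily.memLp t)
    ((h.dx.dx.dt.isFamily.memLp t).const_mul _), toL2_const_mul _ (h.dx.dx.dt.isFamily.memLp t)]
  simp_rw [fun t => toL2_helm (h.isBump t)]
  exact (h.hasDerivAt_toL2 t).sub ((h.dx.dx.hasDerivAt_toL2 t).const_smul (1 / 6 : ℝ))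

lemma continuous_toL2_helm (h : IsBump₂ φ) : Continuous fun t => toL2 (helm (φ t)) :=
  continuous_iff_continuousAt.2 fun t => (h.hasDerivAt_toL2_helm t).continuousAt

lemma apply_eq_zero {T : ℝ} (hs : tsupport (fun q : ℝ × ℝ => φ q.1 q.2) ⊆ Ioo 0 T ×ˢ univ)
    {t : ℝ} (ht : t ∉ Ioo 0 T) : φ t = fun _ => 0 := by
  ext x
  by_contra hne
  exact ht (hs (subset_tsupport _ (show (t, x) ∈ Function.support
    fun q : ℝ × ℝ => φ q.1 q.2 from hne))).1

end IsBump₂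

lemma toL2_zero : toL2 (fun _ => 0) = 0 := (eq_toL2 (Lp.coeFn_zero ℝ 2 volume)).symm

end

/-! ### The weak formulation as pairings in L² -/

noncomputable section

lemma iteratedDeriv_two_eq (f : ℝ → ℝ) : iteratedDeriv 2 f = deriv (deriv f) := by
  rw [iteratedDeriv_succ, iteratedDeriv_one]

namespace IsFamily

variable {Φ Ψ : ℝ → ℝ → ℝ}

/-- Moves the translation from the merely square integrable bottom to the test function. The shear
is a homeomorphism of the plane, so compact support survives. -/
lemma shear (h : IsFamily Φ) {X : ℝ → ℝ} (hX : Continuous X) :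
    IsFamily fun t y => Φ t (y + X t) := by
  let e : ℝ × ℝ ≃ₜ ℝ × ℝ :=
    { toFun := fun q => (q.1, q.2 + X q.1)
      invFun := fun q => (q.1, q.2 - X q.1)
      left_inv := fun q => by simp
      right_inv := fun q => by simp
      continuous_toFun := by fun_prop
      continuous_invFun := by fun_prop }
  exact ⟨h.continuous.comp e.continuous, h.compact.comp_homeomorph e⟩

lemma add (h : IsFamily Φ) (h' : IsFamily Ψ) : IsFamily fun t x => Φ t x + Ψ t x :=
  ⟨h.continuous.add h'.continuous, h.compact.add h'.compact⟩

lemma mul_left (h : IsFamily Φ) {g : ℝ → ℝ} (hg : Continuous g) :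
    IsFamily fun t x => g t * Φ t x :=
  ⟨(hg.comp continuous_fst).mul h.continuous, h.compact.mul_left (f := fun q : ℝ × ℝ => g q.1)⟩

end IsFamily

lemma setIntegral_Ioo_eq {a b : ℝ} (hab : a ≤ b) (f : ℝ → ℝ) :
    ∫ x in Ioo a b, f x = ∫ x in a..b, f x := by
  rw [intervalIntegral.integral_of_le hab, integral_Ioc_eq_integral_Ioo]

/-- The bottom as a curve in `L²`: the translates of `Z` along the path `X`. -/
def bottomCurve (X : ℝ → ℝ) (Z : L2) (t : ℝ) : L2 := transl (X t) Z

lemma continuous_bottomCurve {X : ℝ → ℝ} (hX : Continuous X) (Z : L2) :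
    Continuous (bottomCurve X Z) := (continuous_transl Z).comp hX

/-- Integration by parts along the moving bottom. -/
lemma integral_inner_bottomCurve_dt {T : ℝ} {X X' : ℝ → ℝ}
    (hX : ∀ t, HasDerivAt X (X' t) t) (hX' : Continuous X') (Z : L2) {Ψ : ℝ → ℝ → ℝ}
    (h : IsBump₂ Ψ) (hs : tsupport (fun q : ℝ × ℝ => Ψ q.1 q.2) ⊆ Ioo 0 T ×ˢ univ) :
    ∫ t in 0..T, inner ℝ (bottomCurve X Z t) (toL2 (dt Ψ t))
      = -∫ t in 0..T, X' t * inner ℝ (bottomCurve X Z t) (toL2 (dx Ψ t)) := by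
  have hXc : Continuous X := continuous_iff_continuousAt.2 fun t => (hX t).continuousAt
  have f0 := h.isFamily.shear hXc
  have f1 := h.dt.isFamily.shear hXc
  have f2 := h.dx.isFamily.shear hXc
  have f3 := f2.mul_left hX'
  have hd : ∀ t y, HasDerivAt (fun r => Ψ r (y + X r))
      (dt Ψ t (y + X t) + X' t * dx Ψ t (y + X t)) t := by
    intro t y
    have h1 := (h.hasFDerivAt (t, y + X t)).comp_hasDerivAt (f := fun r => (r, y + X r)) t
      ((hasDerivAt_id t).prodMk ((hX t).const_add y))
    have e : ((1 : ℝ), X' t) = (1, 0) + X' t • (0, 1) := by simp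
    rw [e, map_add, map_smul, smul_eq_mul] at h1
    have e1 : dt Ψ t (y + X t) = _ := congr_fun h.dt_eq (t, y + X t)
    have e2 : dx Ψ t (y + X t) = _ := congr_fun h.dx_eq (t, y + X t)
    rw [e1, e2]
    exact h1
  -- After the change of variables Z is fixed in time and the chain rule falls on Ψ(t, y + X(t)); no
  -- derivative of Z appears.
  have hder : ∀ t, HasDerivAt (fun t => inner ℝ Z (toL2 fun y => Ψ t (y + X t)))
      (inner ℝ (bottomCurve X Z t) (toL2 (dt Ψ t))
        + X' t * inner ℝ (bottomCurve X Z t) (toL2 (dx Ψ t))) t := by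
    intro t
    have h1 := f0.hasDerivAt_toL2 (f1.add f3) hd t
    have h2 := (hasDerivAt_const t Z).inner ℝ h1
    rw [toL2_add (f1.memLp t) (f3.memLp t), toL2_const_mul _ (f2.memLp t), inner_add_right,
      inner_smul_right, inner_zero_left, add_zero] at h2
    rw [bottomCurve, inner_transl_toL2 _ _ (h.dt.isFamily.memLp t) (f1.memLp t),
      inner_transl_toL2 _ _ (h.dx.isFamily.memLp t) (f2.memLp t)]
    exact h2
  have hζ := continuous_bottomCurve hXc Z
  have c1 : Continuous fun t => inner ℝ (bottomCurve X Z t) (toL2 (dt Ψ t)) :=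
    hζ.inner h.dt.isFamily.continuous_toL2
  have c2 : Continuous fun t => X' t * inner ℝ (bottomCurve X Z t) (toL2 (dx Ψ t)) :=
    hX'.mul (hζ.inner h.dx.isFamily.continuous_toL2)
  have hint := intervalIntegral.integral_eq_sub_of_hasDerivAt (a := 0) (b := T)
    (fun t _ => hder t) ((c1.add c2).intervalIntegrable _ _)
  rw [intervalIntegral.integral_add (c1.intervalIntegrable _ _) (c2.intervalIntegrable _ _)] at hint
  have z : ∀ t, t ∉ Ioo 0 T → inner ℝ Z (toL2 fun y => Ψ t (y + X t)) = 0 := fun t ht => by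
    rw [IsBump₂.apply_eq_zero hs ht, toL2_zero, inner_zero_right]
  rw [z T (by simp), z 0 (by simp), sub_zero] at hint
  exact eq_neg_of_add_eq_zero_left hint

/-- The time primitive of the forcing term `(1 - ∂ₓ²/6)⁻¹(-ζ_xtt/4 + ζ_t/2)`. -/
def forcing (X X' : ℝ → ℝ) (Z : L2) (t : ℝ) : L2 :=
  (3 / 2 * X' t) • (opA (bottomCurve X Z t) - bottomCurve X Z t)
    + (1 / 2 : ℝ) • opA (bottomCurve X Z t)

lemma continuous_forcing {X X' : ℝ → ℝ} (hX : Continuous X) (hX' : Continuous X') (Z : L2) :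
    Continuous (forcing X X' Z) := by
  have := continuous_bottomCurve hX Z
  unfold forcing
  fun_prop

/-- A is symmetric and inverts ψ ↦ ψ - ψ''/6, so pairing (A - 1)ζ with g - g''/6 leaves ⟨ζ, g''⟩/6.
The factor 3/2 in `forcing` thus becomes the 1/4 of the equation. -/
lemma inner_forcing {X X' : ℝ → ℝ} {Z : L2} {t : ℝ} {g : ℝ → ℝ} (hg : IsBump g) :
    inner ℝ (forcing X X' Z t) (toL2 (helm g))
      = 1 / 4 * (X' t * inner ℝ (bottomCurve X Z t) (toL2 (deriv (deriv g))))
        + 1 / 2 * inner ℝ (bottomCurve X Z t) (toL2 g) := by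
  rw [forcing, inner_add_left, real_inner_smul_left, real_inner_smul_left, inner_sub_left,
    inner_opA, opA_helm hg, toL2_helm hg, inner_sub_right, inner_smul_right]
  ring

/-- The right-hand side of the weak formulation. -/
lemma integral_forcing {T : ℝ} {X X' : ℝ → ℝ}
    (hX : ∀ t, HasDerivAt X (X' t) t) (hX' : Continuous X') (Z : L2) {φ : ℝ → ℝ → ℝ}
    (h : IsBump₂ φ) (hs : tsupport (fun q : ℝ × ℝ => φ q.1 q.2) ⊆ Ioo 0 T ×ˢ univ) :
    ∫ t in 0..T, (1 / 4 * inner ℝ (bottomCurve X Z t) (toL2 (dt (dt (dx φ)) t))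
        - 1 / 2 * inner ℝ (bottomCurve X Z t) (toL2 (dt φ t)))
      = -∫ t in 0..T, inner ℝ (forcing X X' Z t) (toL2 (helm (dt φ t))) := by
  have hXc : Continuous X := continuous_iff_continuousAt.2 fun t => (hX t).continuousAt
  have hζ := continuous_bottomCurve hXc Z
  have h1 := integral_inner_bottomCurve_dt hX hX' Z h.dx.dt
    ((h.dx.tsupport_dt.trans h.tsupport_dx).trans hs)
  have e : dx (dt (dx φ)) = dx (dx (dt φ)) := by rw [h.dt_dx]
  have c1 : Continuous fun t => inner ℝ (bottomCurve X Z t) (toL2 (dt (dt (dx φ)) t)) :=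
    hζ.inner h.dx.dt.dt.isFamily.continuous_toL2
  have c2 : Continuous fun t => inner ℝ (bottomCurve X Z t) (toL2 (dt φ t)) :=
    hζ.inner h.dt.isFamily.continuous_toL2
  have c3 : Continuous fun t => X' t * inner ℝ (bottomCurve X Z t) (toL2 (dx (dx (dt φ)) t)) :=
    hX'.mul (hζ.inner h.dt.dx.dx.isFamily.continuous_toL2)
  rw [e] at h1
  simp_rw [fun t => inner_forcing (X := X) (X' := X') (Z := Z) (t := t) (h.dt.isBump t)]
  rw [intervalIntegral.integral_sub, intervalIntegral.integral_const_mul,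
    intervalIntegral.integral_const_mul, h1, intervalIntegral.integral_add,
    intervalIntegral.integral_const_mul, intervalIntegral.integral_const_mul]
  · have e2 : ∀ t, deriv (deriv (dt φ t)) = dx (dx (dt φ)) t := fun _ => rfl
    simp only [e2]
    ring
  · exact (c3.intervalIntegrable _ _).const_mul _
  · exact (c2.intervalIntegrable _ _).const_mul _
  · exact (c1.intervalIntegrable _ _).const_mul _
  · exact (c2.intervalIntegrable _ _).const_mul _

lemma integrable_mul_of_memLp {u g : ℝ → ℝ} (hu : MemLp u 2) (hg : MemLp g 2) :
    Integrable fun x => u x * g x := hu.integrable_mul hg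

/-- The spatial integral on the left-hand side of the weak formulation. -/
lemma integral_weak_lhs (u z : L2) {b : ℝ → ℝ} (hb : b =ᵐ[volume] z) {φ : ℝ → ℝ → ℝ}
    (h : IsBump₂ φ) (t : ℝ) :
    ∫ x, (-(u x * dt φ t x) - (u x + 3 / 4 * u x ^ 2 - 1 / 2 * b x * u x) * dx φ t x
        + 1 / 6 * u x * dt (dx (dx φ)) t x)
      = -inner ℝ u (toL2 (helm (dt φ t))) + inner ℝ (fluxOp u z) (toL2 (helm (φ t))) := by
  set w : L2 := (3 / 4 : ℝ) • u - (1 / 2 : ℝ) • z with hw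
  have hφ := h.isBump t
  have hdx : IsBump (dx φ t) := h.dx.isBump t
  have e1 : inner ℝ (fluxOp u z) (toL2 (helm (φ t)))
      = -(∫ x, u x * dx φ t x) - ∫ x, w x * u x * dx φ t x := by
    -- Antisymmetry of B and B(φ - φ_xx/6) = φ_x turn the integrated flux back into the flux tested
    -- against φ_x.
    rw [fluxOp, inner_add_left, inner_opB, inner_opB₁, opB_helm hφ,
      inner_L2_eq (Filter.EventuallyEq.refl _ u) hφ.deriv.coeFn, ← sub_eq_add_neg]
    congr 1
    refine integral_congr_ae ?_
    filter_upwards [coeFn_mulTwo w u, coeFn_opBtop_helm hφ] with x h1 h2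
    rw [h1, h2]
    rfl
  have e2 : inner ℝ u (toL2 (helm (dt φ t))) = ∫ x, u x * helm (dt φ t) x :=
    inner_L2_eq (Filter.EventuallyEq.refl _ u) (h.dt.isBump t).helm.coeFn
  have i1 : Integrable fun x => u x * helm (dt φ t) x :=
    integrable_mul_of_memLp (Lp.memLp u) ((h.dt.isBump t).helm.memLp 2)
  have i2 : Integrable fun x => u x * dx φ t x :=
    integrable_mul_of_memLp (Lp.memLp u) (hdx.memLp 2)
  obtain ⟨C, hC⟩ := hdx.compact.exists_bound_of_continuous hdx.continuous
  have i3 : Integrable fun x => w x * u x * dx φ t x :=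
    (integrable_mul_of_memLp (Lp.memLp w) (Lp.memLp u)).mul_bdd (c := C)
      hdx.continuous.aestronglyMeasurable (Filter.Eventually.of_forall hC)
  have e3 : ∫ x, (-(u x * helm (dt φ t) x) + (-(u x * dx φ t x) - w x * u x * dx φ t x))
      = -(∫ x, u x * helm (dt φ t) x) + (-(∫ x, u x * dx φ t x) - ∫ x, w x * u x * dx φ t x) := by
    rw [integral_add (by exact i1.neg) (by exact i2.neg.sub i3), integral_sub (by exact i2.neg) i3,
      integral_neg, integral_neg]
  rw [e1, e2, ← e3]
  refine integral_congr_ae ?_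
  filter_upwards [hb, Lp.coeFn_sub ((3 / 4 : ℝ) • u) ((1 / 2 : ℝ) • z),
    Lp.coeFn_smul (3 / 4 : ℝ) u, Lp.coeFn_smul (1 / 2 : ℝ) z] with x h1 h2 h3 h4
  have h5 : w x = 3 / 4 * u x - 1 / 2 * z x := by
    rw [hw, h2, Pi.sub_apply, h3, h4, Pi.smul_apply, Pi.smul_apply, smul_eq_mul, smul_eq_mul]
  simp only [h5, h1, h.helm_dt t]
  ring

/-- The spatial integral on the right-hand side of the weak formulation. -/
lemma integral_weak_rhs (z : L2) {b : ℝ → ℝ} (hb : b =ᵐ[volume] z) {φ : ℝ → ℝ → ℝ}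
    (h : IsBump₂ φ) (t : ℝ) :
    ∫ x, (1 / 4 * b x * dt (dt (dx φ)) t x - 1 / 2 * b x * dt φ t x)
      = 1 / 4 * inner ℝ z (toL2 (dt (dt (dx φ)) t)) - 1 / 2 * inner ℝ z (toL2 (dt φ t)) := by
  rw [inner_L2_eq hb.symm (h.dx.dt.dt.isFamily.coeFn t), inner_L2_eq hb.symm (h.dt.isFamily.coeFn t),
    ← integral_const_mul, ← integral_const_mul, ← integral_sub]
  · simp only [mul_assoc]
  · exact (integrable_mul_of_memLp ((memLp_congr_ae hb).2 (Lp.memLp z))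
      (h.dx.dt.dt.isFamily.memLp t)).const_mul _
  · exact (integrable_mul_of_memLp ((memLp_congr_ae hb).2 (Lp.memLp z))
      (h.dt.isFamily.memLp t)).const_mul _

/-- A regular representative `(X, Z)` of the control `p = (x₀, ζ₀)`: `X` is a continuously
differentiable version of `x₀` and `Z` is the class of `ζ₀` extended by zero. -/
structure ControlRep (T : ℝ) (p : (ℝ → ℝ) × (ℝ → ℝ)) (X X' : ℝ → ℝ) (Z : L2) : Prop where
  hasDerivAt : ∀ t, HasDerivAt X (X' t) t
  continuous : Continuous X'
  path : ∀ᵐ t ∂(volume.restrict (Ioo 0 T)), p.1 t = X t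
  shape : Z =ᵐ[volume] (Icc (0 : ℝ) 1).indicator p.2

namespace ControlRep

variable {T : ℝ} {p : (ℝ → ℝ) × (ℝ → ℝ)} {X X' : ℝ → ℝ} {Z : L2}

lemma continuous_path (h : ControlRep T p X X' Z) : Continuous X :=
  continuous_iff_continuousAt.2 fun t => (h.hasDerivAt t).continuousAt

lemma bottom_ae_eq (h : ControlRep T p X X' Z) : ∀ᵐ t ∂(volume.restrict (Ioo 0 T)),
    bottom p t =ᵐ[volume] bottomCurve X Z t := by
  filter_upwards [h.path] with t ht
  filter_upwards [coeFn_transl (X t) Z,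
    (measurePreserving_sub_right volume (X t)).quasiMeasurePreserving.ae_eq h.shape] with x h1 h2
  rw [bottom, ht, bottomCurve, h1]
  exact h2.symm

/-- The weak formulation in terms of curves in `L²`. -/
lemma isSolution_iff (h : ControlRep T p X X' Z) (hT : 0 ≤ T) (η₀ : L2) (η : ℝ → L2) :
    IsSolution T η₀ (bottom p) η ↔ ContinuousOn η (Icc 0 T) ∧ η 0 = η₀ ∧
      ∀ φ : ℝ → ℝ → ℝ, IsBump₂ φ →
        tsupport (fun q : ℝ × ℝ => φ q.1 q.2) ⊆ Ioo 0 T ×ˢ univ →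
        ∫ t in 0..T, (-inner ℝ (η t) (toL2 (helm (dt φ t)))
          + inner ℝ (fluxOp (η t) (bottomCurve X Z t)) (toL2 (helm (φ t))))
          = -∫ t in 0..T, inner ℝ (forcing X X' Z t) (toL2 (helm (dt φ t))) := by
  refine and_congr_right fun _ => and_congr_right fun _ => ?_
  have key : ∀ φ : ℝ → ℝ → ℝ, IsBump₂ φ →
      tsupport (fun q : ℝ × ℝ => φ q.1 q.2) ⊆ Ioo 0 T ×ˢ univ →
      ((∫ t in Ioo 0 T, ∫ x,
          (-(η t x * deriv (fun r => φ r x) t)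
            - (η t x + 3 / 4 * η t x ^ 2 - 1 / 2 * bottom p t x * η t x) * deriv (φ t) x
            + 1 / 6 * η t x * deriv (fun r => iteratedDeriv 2 (φ r) x) t)
        = ∫ t in Ioo 0 T, ∫ x,
          (1 / 4 * bottom p t x * iteratedDeriv 2 (fun r => deriv (φ r) x) t
            - 1 / 2 * bottom p t x * deriv (fun r => φ r x) t)) ↔
      ∫ t in 0..T, (-inner ℝ (η t) (toL2 (helm (dt φ t)))
          + inner ℝ (fluxOp (η t) (bottomCurve X Z t)) (toL2 (helm (φ t))))
          = -∫ t in 0..T, inner ℝ (forcing X X' Z t) (toL2 (helm (dt φ t)))) := by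
    intro φ hφ hs
    simp only [iteratedDeriv_two_eq]
    rw [← integral_forcing h.hasDerivAt h.continuous Z hφ hs, ← setIntegral_Ioo_eq hT,
      ← setIntegral_Ioo_eq hT]
    have e1 := integral_congr_ae (h.bottom_ae_eq.mono fun t ht =>
      integral_weak_lhs (η t) (bottomCurve X Z t) ht hφ t)
    have e2 := integral_congr_ae (h.bottom_ae_eq.mono fun t ht =>
      integral_weak_rhs (bottomCurve X Z t) ht hφ t)
    rw [← e1, ← e2]
    rfl
  exact ⟨fun H φ hφ hs => (key φ hφ hs).1 (H φ hφ.smooth hφ.compact hs),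
    fun H φ h1 h2 hs => (key φ ⟨h1, h2⟩ hs).2 (H φ ⟨h1, h2⟩ hs)⟩

end ControlRep

end

/-! ### Du Bois-Reymond's lemma; equivalence of the weak and integrated equations -/

noncomputable section

namespace IsTestFun

variable {a b : ℝ} {φ ψ : ℝ → ℝ}

lemma isBump (h : IsTestFun a b φ) : IsBump φ := ⟨h.1, h.2.1⟩

lemma eq_zero (h : IsTestFun a b φ) {x : ℝ} (hx : x ∉ Ioo a b) : φ x = 0 := by
  by_contra hne
  exact hx (h.2.2 (subset_tsupport _ hne))

lemma deriv (h : IsTestFun a b φ) : IsTestFun a b (deriv φ) :=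
  ⟨h.isBump.deriv.smooth, h.isBump.deriv.compact, (tsupport_deriv_subset).trans h.2.2⟩

lemma const_mul (h : IsTestFun a b φ) (c : ℝ) : IsTestFun a b fun x => c * φ x :=
  ⟨(h.isBump.const_mul c).smooth, (h.isBump.const_mul c).compact,
    (tsupport_mul_subset_right (f := fun _ => c)).trans h.2.2⟩

lemma sub (h : IsTestFun a b φ) (h' : IsTestFun a b ψ) : IsTestFun a b fun x => φ x - ψ x :=
  ⟨(h.isBump.sub h'.isBump).smooth, (h.isBump.sub h'.isBump).compact,
    (tsupport_sub φ ψ).trans (union_subset h.2.2 h'.2.2)⟩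

lemma setIntegral_mul (h : IsTestFun a b φ) (f : ℝ → ℝ) :
    ∫ x in Ioo a b, f x * φ x = ∫ x, f x * φ x :=
  setIntegral_eq_integral_of_forall_compl_eq_zero fun x hx => by rw [h.eq_zero hx, mul_zero]

end IsTestFun

lemma exists_Ioo_of_isCompact {a b : ℝ} (hab : a < b) {K : Set ℝ} (hK : IsCompact K)
    (hs : K ⊆ Ioo a b) : ∃ α β, a < α ∧ α < β ∧ β < b ∧ K ⊆ Ioo α β := by
  rcases K.eq_empty_or_nonempty with rfl | hne
  · refine ⟨(2 * a + b) / 3, (a + 2 * b) / 3, by linarith, by linarith, by linarith, empty_subset _⟩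
  · obtain ⟨m, hm, hm'⟩ := hK.exists_isLeast hne
    obtain ⟨M, hM, hM'⟩ := hK.exists_isGreatest hne
    have h1 := hs hm
    have h2 := hs hM
    have h3 := hm' hM
    refine ⟨(a + m) / 2, (M + b) / 2, by linarith [h1.1], by linarith [h1.1, h2.2],
      by linarith [h2.2], fun x hx => ⟨?_, ?_⟩⟩
    · linarith [hm' hx, h1.1]
    · linarith [hM' hx, h2.2]

/-- A test function with vanishing integral is the derivative of a test function. -/
lemma IsTestFun.exists_primitive {a b : ℝ} (hab : a < b) {ψ : ℝ → ℝ} (h : IsTestFun a b ψ)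
    (h0 : ∫ x, ψ x = 0) : ∃ Φ, IsTestFun a b Φ ∧ _root_.deriv Φ = ψ := by
  obtain ⟨α, β, h1, h2, h3, hK⟩ := exists_Ioo_of_isCompact hab h.2.1.isCompact h.2.2
  have hd : ∀ x, HasDerivAt (fun x => ∫ y in α..x, ψ y) (ψ x) x := fun x =>
    (h.isBump.continuous.integral_hasStrictDerivAt α x).hasDerivAt
  have hz : ∀ x ∉ Icc α β, ∫ y in α..x, ψ y = 0 := by
    intro x hx
    rw [mem_Icc, not_and_or, not_le, not_le] at hx
    rcases hx with hx | hx
    · refine intervalIntegral.integral_zero_ae (Filter.Eventually.of_forall fun y hy => ?_)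
      rw [uIoc_comm, uIoc_of_le hx.le] at hy
      by_contra hne
      exact absurd (hK (subset_tsupport _ hne)).1 (not_lt.2 hy.2)
    · rw [intervalIntegral.integral_eq_integral_of_support_subset, h0]
      exact (subset_tsupport ψ).trans (hK.trans fun y hy => ⟨hy.1, (hy.2.trans hx).le⟩)
  have hts : tsupport (fun x => ∫ y in α..x, ψ y) ⊆ Icc α β :=
    closure_minimal (fun x hx => by by_contra hn; exact hx (hz x hn)) isClosed_Icc
  refine ⟨fun x => ∫ y in α..x, ψ y, ⟨?_, ?_, hts.trans (Icc_subset_Ioo h1 h3)⟩,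
    funext fun x => (hd x).deriv⟩
  · rw [contDiff_infty_iff_deriv, funext fun x => (hd x).deriv]
    exact ⟨fun x => (hd x).differentiableAt, h.1⟩
  · exact HasCompactSupport.intro isCompact_Icc hz

lemma exists_testFun_integral_eq_one {a b : ℝ} (hab : a < b) :
    ∃ ρ, IsTestFun a b ρ ∧ ∫ x, ρ x = 1 := by
  let θ : ContDiffBump ((a + b) / 2) :=
    { rIn := (b - a) / 4, rOut := (b - a) / 3, rIn_pos := by linarith, rIn_lt_rOut := by linarith }
  have hθ : IsTestFun a b θ := by
    refine ⟨θ.contDiff, θ.hasCompactSupport, ?_⟩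
    rw [θ.tsupport_eq, Real.closedBall_eq_Icc]
    exact Icc_subset_Ioo (by simp only [θ]; linarith) (by simp only [θ]; linarith)
  have hpos := θ.integral_pos (μ := volume)
  refine ⟨fun x => (∫ x, θ x)⁻¹ * θ x, hθ.const_mul _, ?_⟩
  rw [integral_const_mul, inv_mul_cancel₀ hpos.ne']

/-- The fundamental lemma of du Bois-Reymond. -/
lemma exists_ae_eq_const_of_integral_deriv_eq_zero {a b : ℝ} (hab : a < b) {h : ℝ → ℝ}
    (hint : LocallyIntegrableOn h (Ioo a b))
    (H : ∀ φ, IsTestFun a b φ → ∫ x in Ioo a b, h x * deriv φ x = 0) :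
    ∃ c : ℝ, ∀ᵐ x ∂(volume.restrict (Ioo a b)), h x = c := by
  obtain ⟨ρ, hρ, hρ1⟩ := exists_testFun_integral_eq_one hab
  have hi : ∀ φ, IsTestFun a b φ → Integrable fun x => h x * φ x := fun φ hφ => by
    have h1 : IntegrableOn h (tsupport φ) := hint.integrableOn_compact_subset hφ.2.2 hφ.2.1
    obtain ⟨C, hC⟩ := hφ.2.1.exists_bound_of_continuous hφ.isBump.continuous
    have h2 : IntegrableOn (fun x => h x * φ x) (tsupport φ) :=
      Integrable.mul_bdd (c := C) h1 hφ.isBump.continuous.aestronglyMeasurable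
        (Filter.Eventually.of_forall hC)
    refine (integrableOn_iff_integrable_of_support_subset fun x hx => ?_).1 h2
    exact subset_tsupport _ (right_ne_zero_of_mul hx)
  set c := ∫ x, h x * ρ x with hc
  refine ⟨c, ?_⟩
  rw [ae_restrict_iff' measurableSet_Ioo]
  have key := IsOpen.ae_eq_zero_of_integral_contDiff_smul_eq_zero (μ := (volume : Measure ℝ))
    (f := fun x => h x - c) (U := Ioo a b) isOpen_Ioo
    (hint.sub ((locallyIntegrable_const c).locallyIntegrableOn _)) (fun φ h1 h2 h3 => by
      have hφ : IsTestFun a b φ := ⟨h1, h2, h3⟩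
      set I := ∫ x, φ x with hI
      -- Subtracting I times the normalised ρ kills the mean of φ, so the difference is the
      -- derivative of a test function; the price I ∫ hρ is exactly c ∫ φ.
      obtain ⟨Φ, hΦ, hΦ'⟩ := (hφ.sub (hρ.const_mul I)).exists_primitive hab (by
        rw [integral_sub hφ.isBump.integrable (hρ.const_mul I).isBump.integrable,
          integral_const_mul, hρ1, mul_one, sub_self])
      have h4 := H Φ hΦ
      rw [hΦ.deriv.setIntegral_mul, hΦ'] at h4
      have h5 : ∀ x, h x * (φ x - I * ρ x) = h x * φ x - I * (h x * ρ x) := fun x => by ring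
      simp_rw [h5] at h4
      rw [integral_sub (hi φ hφ) ((hi ρ hρ).const_mul I), integral_const_mul, ← hc] at h4
      have h6 : ∀ x, φ x • (h x - c) = h x * φ x - c * φ x := fun x => by
        rw [smul_eq_mul]; ring
      simp_rw [h6]
      rw [integral_sub (hi φ hφ) (hφ.isBump.integrable.const_mul c), integral_const_mul, ← hI]
      linarith)
  filter_upwards [key] with x hx hxI
  exact sub_eq_zero.1 (hx hxI)

lemma eqOn_const_of_integral_deriv_eq_zero {T : ℝ} (hT : 0 < T) {k : ℝ → ℝ} (hk : Continuous k)
    (H : ∀ φ, IsTestFun 0 T φ → ∫ x in 0..T, k x * deriv φ x = 0) :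
    ∀ t ∈ Icc 0 T, k t = k 0 := by
  obtain ⟨c, hc⟩ := exists_ae_eq_const_of_integral_deriv_eq_zero hT
    (hk.locallyIntegrable.locallyIntegrableOn _)
    (fun φ hφ => (setIntegral_Ioo_eq hT.le _).trans (H φ hφ))
  rw [Measure.restrict_congr_set Ioo_ae_eq_Icc] at hc
  have h1 := Measure.eqOn_Icc_of_ae_eq volume hT.ne hc hk.continuousOn continuousOn_const
  intro t ht
  rw [h1 ht, h1 ⟨le_rfl, hT.le⟩]

lemma isBump₂_mul {θ ψ : ℝ → ℝ} (hθ : IsBump θ) (hψ : IsBump ψ) :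
    IsBump₂ fun t x => θ t * ψ x := by
  refine ⟨(hθ.smooth.comp contDiff_fst).mul (hψ.smooth.comp contDiff_snd), ?_⟩
  refine HasCompactSupport.intro (hθ.compact.isCompact.prod hψ.compact.isCompact)
    fun q hq => ?_
  rw [mem_prod, not_and_or] at hq
  rcases hq with hq | hq
  · rw [image_eq_zero_of_notMem_tsupport hq, zero_mul]
  · rw [image_eq_zero_of_notMem_tsupport hq, mul_zero]

lemma helm_const_mul {ψ : ℝ → ℝ} (c : ℝ) :
    helm (fun x => c * ψ x) = fun x => c * helm ψ x := by
  have h1 : deriv (fun x => c * ψ x) = fun x => c * deriv ψ x :=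
    funext fun x => deriv_const_mul_field c
  have h2 : deriv (fun x => c * deriv ψ x) = fun x => c * deriv (deriv ψ) x :=
    funext fun x => deriv_const_mul_field c
  ext x
  rw [helm, helm, h1, h2]
  ring

lemma continuous_fluxOp_comp {η ζ : ℝ → L2} (hη : Continuous η) (hζ : Continuous ζ) :
    Continuous fun t => fluxOp (η t) (ζ t) := by
  have h := continuous_fluxOp.comp (hη.prodMk hζ)
  exact h

/-- The inhomogeneity of the integrated equation. -/
def dataCurve (η₀ : L2) (X X' : ℝ → ℝ) (Z : L2) (t : ℝ) : L2 :=
  η₀ + (forcing X X' Z t - forcing X X' Z 0)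

lemma dataCurve_zero (η₀ : L2) (X X' : ℝ → ℝ) (Z : L2) : dataCurve η₀ X X' Z 0 = η₀ := by
  simp [dataCurve]

namespace ControlRep

variable {T : ℝ} {p : (ℝ → ℝ) × (ℝ → ℝ)} {X X' : ℝ → ℝ} {Z : L2}

lemma continuous_bottomCurve (h : ControlRep T p X X' Z) : Continuous (bottomCurve X Z) :=
  _root_.continuous_bottomCurve h.continuous_path Z

lemma continuous_forcing (h : ControlRep T p X X' Z) : Continuous (forcing X X' Z) :=
  _root_.continuous_forcing h.continuous_path h.continuous Z

lemma continuous_dataCurve (h : ControlRep T p X X' Z) (η₀ : L2) :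
    Continuous (dataCurve η₀ X X' Z) :=
  continuous_const.add (h.continuous_forcing.sub continuous_const)

/-- Testing with θ(t)ψ(x) shows that t ↦ ⟨η - F + G, ψ - ψ''/6⟩ has zero weak derivative, where G is
the time integral of the flux term. It is therefore constant on [0, T], and density in L² removes ψ.
-/
lemma isMild_of_weak (h : ControlRep T p X X' Z) (hT : 0 < T) {η₀ : L2} {η : ℝ → L2}
    (hη : Continuous η) (h0 : η 0 = η₀)
    (H : ∀ φ : ℝ → ℝ → ℝ, IsBump₂ φ →
        tsupport (fun q : ℝ × ℝ => φ q.1 q.2) ⊆ Ioo 0 T ×ˢ univ →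
        ∫ t in 0..T, (-inner ℝ (η t) (toL2 (helm (dt φ t)))
          + inner ℝ (fluxOp (η t) (bottomCurve X Z t)) (toL2 (helm (φ t))))
          = -∫ t in 0..T, inner ℝ (forcing X X' Z t) (toL2 (helm (dt φ t)))) :
    IsMild T (dataCurve η₀ X X' Z) (bottomCurve X Z) η := by
  refine ⟨hη.continuousOn, fun t ht => ?_⟩
  set F := forcing X X' Z with hF
  set N : ℝ → L2 := fun t => fluxOp (η t) (bottomCurve X Z t) with hN
  have hNc : Continuous N := continuous_fluxOp_comp hη h.continuous_bottomCurve
  have hFc : Continuous F := h.continuous_forcing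
  set G : ℝ → L2 := fun t => ∫ τ in 0..t, N τ with hG
  have hGd : ∀ t, HasDerivAt G (N t) t := hasDerivAt_integral_fluxOp h.continuous_bottomCurve hη
  have hGc : Continuous G := continuous_iff_continuousAt.2 fun t => (hGd t).continuousAt
  have hG0 : G 0 = 0 := by simp [hG]
  have hm : η t = dataCurve η₀ X X' Z t - G t ↔ η t = η₀ + (F t - F 0) - G t := Iff.rfl
  rw [show (∫ τ in 0..t, fluxOp (η τ) (bottomCurve X Z τ)) = G t from rfl, hm]
  clear_value F N G
  have key : ∀ ψ, IsBump ψ → inner ℝ (η t - F t + G t) (toL2 (helm ψ))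
      = inner ℝ (η 0 - F 0 + G 0) (toL2 (helm ψ)) := by
    intro ψ hψ
    set χ := toL2 (helm ψ) with hχ
    refine eqOn_const_of_integral_deriv_eq_zero hT
      (k := fun t => inner ℝ (η t - F t + G t) χ) (by fun_prop) (fun θ hθ => ?_) t ht
    have hb := isBump₂_mul hθ.isBump hψ
    have hdθ := hθ.isBump.deriv.continuous
    have hθc := hθ.isBump.continuous
    have hw := H _ hb (by
      refine closure_minimal (fun q hq => ?_) ((isClosed_tsupport θ).prod isClosed_univ) |>.trans
        (prod_mono hθ.2.2 subset_rfl)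
      exact ⟨subset_tsupport _ (left_ne_zero_of_mul hq), mem_univ _⟩)
    have e1 : ∀ t, toL2 (helm (dt (fun t x => θ t * ψ x) t)) = deriv θ t • χ := fun t => by
      have : dt (fun t x => θ t * ψ x) t = fun x => deriv θ t * ψ x :=
        funext fun x => deriv_mul_const_field (ψ x)
      rw [this, helm_const_mul, toL2_const_mul _ (hψ.helm.memLp 2)]
    have e2 : ∀ t, toL2 (helm fun x => θ t * ψ x) = θ t • χ := fun t => by
      rw [helm_const_mul, toL2_const_mul _ (hψ.helm.memLp 2)]
    simp only [e1, e2, inner_smul_right] at hw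
    have hd : ∀ t, HasDerivAt (fun t => θ t * inner ℝ (G t) χ)
        (deriv θ t * inner ℝ (G t) χ + θ t * inner ℝ (N t) χ) t := fun t => by
      have h2 := (hGd t).inner ℝ (hasDerivAt_const t χ)
      rw [inner_zero_right, zero_add] at h2
      exact (hθ.isBump.differentiable t).hasDerivAt.mul h2
    -- Integration by parts in time: θ vanishes at 0 and T, so the integral of (θ⟨G, χ⟩)' is zero
    -- and the flux term can be traded for θ'⟨G, χ⟩.
    have hz := intervalIntegral.integral_eq_sub_of_hasDerivAt (a := 0) (b := T)
      (fun t _ => hd t) (Continuous.intervalIntegrable (by fun_prop) _ _)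
    rw [hθ.eq_zero (by simp), hθ.eq_zero (by simp), zero_mul, zero_mul, sub_zero] at hz
    have hc1 : Continuous fun t => deriv θ t * inner ℝ (G t) χ + θ t * inner ℝ (N t) χ := by
      fun_prop
    have hc2 : Continuous fun t => -(deriv θ t * inner ℝ (η t) χ) + θ t * inner ℝ (N t) χ := by
      fun_prop
    have hc3 : Continuous fun t => deriv θ t * inner ℝ (F t) χ := by fun_prop
    have hsum : ∀ t, inner ℝ (η t - F t + G t) χ * deriv θ t
        = (deriv θ t * inner ℝ (G t) χ + θ t * inner ℝ (N t) χ)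
          - (-(deriv θ t * inner ℝ (η t) χ) + θ t * inner ℝ (N t) χ)
          - deriv θ t * inner ℝ (F t) χ := fun t => by
      rw [inner_add_left, inner_sub_left]; ring
    simp_rw [hsum]
    have hc12 : Continuous fun t => (deriv θ t * inner ℝ (G t) χ + θ t * inner ℝ (N t) χ)
        - (-(deriv θ t * inner ℝ (η t) χ) + θ t * inner ℝ (N t) χ) := hc1.sub hc2
    have hw' : ∫ t in 0..T, (-(deriv θ t * inner ℝ (η t) χ) + θ t * inner ℝ (N t) χ)
        = -∫ t in 0..T, deriv θ t * inner ℝ (F t) χ := by rw [hN]; exact hw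
    rw [intervalIntegral.integral_sub (hc12.intervalIntegrable _ _)
        (hc3.intervalIntegrable _ _),
      intervalIntegral.integral_sub (hc1.intervalIntegrable _ _) (hc2.intervalIntegrable _ _),
      hz, hw']
    ring
  have hall : η t - F t + G t = η 0 - F 0 + G 0 :=
    ext_inner_right ℝ (ext_helm (F := fun f => inner ℝ (η t - F t + G t) f)
      (G := fun f => inner ℝ (η 0 - F 0 + G 0) f) (by fun_prop) (by fun_prop) key)
  rw [hG0, add_zero, h0] at hall
  have : η t = (η t - F t + G t) + F t - G t := by abel
  rw [this, hall]
  abel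

/-- Here η = F - (G - (η₀ - F(0))). The bracket is differentiable with derivative N, and its pairing
with φ - φ_xx/6 vanishes at both ends, so integrating the product rule gives the weak form for
arbitrary φ. -/
lemma weak_of_isMild (h : ControlRep T p X X' Z) (hT : 0 < T) {η₀ : L2} {η : ℝ → L2}
    (hη : Continuous η) (hm : IsMild T (dataCurve η₀ X X' Z) (bottomCurve X Z) η)
    {φ : ℝ → ℝ → ℝ} (hφ : IsBump₂ φ)
    (hs : tsupport (fun q : ℝ × ℝ => φ q.1 q.2) ⊆ Ioo 0 T ×ˢ univ) :
    ∫ t in 0..T, (-inner ℝ (η t) (toL2 (helm (dt φ t)))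
          + inner ℝ (fluxOp (η t) (bottomCurve X Z t)) (toL2 (helm (φ t))))
          = -∫ t in 0..T, inner ℝ (forcing X X' Z t) (toL2 (helm (dt φ t))) := by
  set F := forcing X X' Z with hF
  set N : ℝ → L2 := fun t => fluxOp (η t) (bottomCurve X Z t) with hN
  have hNc : Continuous N := continuous_fluxOp_comp hη h.continuous_bottomCurve
  have hFc : Continuous F := h.continuous_forcing
  set G : ℝ → L2 := fun t => ∫ τ in 0..t, N τ with hG
  have hGd : ∀ t, HasDerivAt G (N t) t := hasDerivAt_integral_fluxOp h.continuous_bottomCurve hη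
  have hc1 : Continuous fun t => toL2 (helm (φ t)) := hφ.continuous_toL2_helm
  have hc2 : Continuous fun t => toL2 (helm (dt φ t)) := hφ.dt.continuous_toL2_helm
  have hm' : ∀ t ∈ Icc 0 T, η t = η₀ + (F t - F 0) - G t := hm.2
  have hN' : ∀ t, fluxOp (η t) (bottomCurve X Z t) = N t := fun _ => rfl
  simp only [hN']
  clear_value F N G
  have hd : ∀ t, HasDerivAt (fun t => inner ℝ (G t - (η₀ - F 0)) (toL2 (helm (φ t))))
      (inner ℝ (G t - (η₀ - F 0)) (toL2 (helm (dt φ t))) + inner ℝ (N t) (toL2 (helm (φ t)))) t :=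
    fun t => ((hGd t).sub_const (η₀ - F 0)).inner ℝ (hφ.hasDerivAt_toL2_helm t)
  have hGc : Continuous G := continuous_iff_continuousAt.2 fun t => (hGd t).continuousAt
  have hz := intervalIntegral.integral_eq_sub_of_hasDerivAt (a := 0) (b := T)
    (fun t _ => hd t) (Continuous.intervalIntegrable (by fun_prop) _ _)
  have hv : ∀ t, t ∉ Ioo 0 T → toL2 (helm (φ t)) = 0 := fun t ht => by
    rw [IsBump₂.apply_eq_zero hs ht]
    have : helm (fun _ => (0 : ℝ)) = fun _ => 0 := by ext x; simp [helm]
    rw [this, toL2_zero]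
  rw [hv T (by simp), hv 0 (by simp), inner_zero_right, inner_zero_right, sub_zero] at hz
  rw [eq_neg_iff_add_eq_zero, ← intervalIntegral.integral_add
    (Continuous.intervalIntegrable (by fun_prop) _ _)
    (Continuous.intervalIntegrable (by fun_prop) _ _)]
  refine Eq.trans ?_ hz
  apply intervalIntegral.integral_congr
  intro t ht
  rw [uIcc_of_le hT.le] at ht
  have e : η t = F t - (G t - (η₀ - F 0)) := by
    rw [hm' t ht]; abel
  simp only
  rw [e, inner_sub_left]
  ring

/-- The solutions of the weak formulation are those of the integrated equation. -/
theorem isSolution_iff_isMild (h : ControlRep T p X X' Z) (hT : 0 < T) (η₀ : L2) (η : ℝ → L2) :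
    IsSolution T η₀ (bottom p) η ↔ IsMild T (dataCurve η₀ X X' Z) (bottomCurve X Z) η := by
  rw [h.isSolution_iff hT.le]
  have hcongr : ∀ u v : ℝ → L2, EqOn u v (Icc 0 T) → ∀ φ : ℝ → ℝ → ℝ,
      ∫ t in 0..T, (-inner ℝ (u t) (toL2 (helm (dt φ t)))
        + inner ℝ (fluxOp (u t) (bottomCurve X Z t)) (toL2 (helm (φ t))))
      = ∫ t in 0..T, (-inner ℝ (v t) (toL2 (helm (dt φ t)))
        + inner ℝ (fluxOp (v t) (bottomCurve X Z t)) (toL2 (helm (φ t)))) := by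
    intro u v huv φ
    refine intervalIntegral.integral_congr fun t ht => ?_
    rw [uIcc_of_le hT.le] at ht
    rw [huv ht]
  have mem0 : (0 : ℝ) ∈ Icc 0 T := ⟨le_rfl, hT.le⟩
  constructor
  · rintro ⟨hc, h0, H⟩
    obtain ⟨u, huc, hu⟩ := exists_continuous_eqOn hT.le hc
    exact (h.isMild_of_weak hT huc ((hu mem0).symm.trans h0) fun φ hφ hs =>
      (hcongr u η hu.symm φ).trans (H φ hφ hs)).congr hu.symm
  · intro hm
    obtain ⟨u, huc, hu⟩ := exists_continuous_eqOn hT.le hm.1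
    refine ⟨hm.1, ?_, fun φ hφ hs => (hcongr η u hu φ).trans
      (h.weak_of_isMild hT huc (hm.congr hu) hφ hs)⟩
    rw [hm.2 0 mem0, dataCurve_zero]
    simp

end ControlRep

end

/-! ### Continuous representatives on an interval as inner products -/

noncomputable section

section Interval

variable {a b : ℝ}

/-- The space `L²(a, b)`. -/
abbrev L2I (a b : ℝ) : Type := Lp ℝ 2 (volume.restrict (Ioo a b))

lemma L2I.integrableOn (g : L2I a b) : IntegrableOn g (Ioo a b) :=
  (Lp.memLp g).integrable one_le_two

lemma L2I.intervalIntegrable (hab : a ≤ b) (g : L2I a b) : IntervalIntegrable g volume a b := by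
  rw [intervalIntegrable_iff_integrableOn_Ioo_of_le hab]
  exact g.integrableOn

lemma integral_primitive_mul_deriv {g : ℝ → ℝ} (hg : IntervalIntegrable g volume a b)
    {φ : ℝ → ℝ} (hφ : ContDiff ℝ 1 φ) (h0 : φ b = 0) :
    ∫ x in a..b, (∫ y in a..x, g y) * deriv φ x = -∫ x in a..b, g x * φ x := by
  have h1 := hg.absolutelyContinuousOnInterval_intervalIntegral (c := a) (by simp)
  have h2 : AbsolutelyContinuousOnInterval φ a b :=
    hφ.contDiffOn.absolutelyContinuousOnInterval
  rw [h1.integral_mul_deriv_eq_deriv_mul h2, h0, intervalIntegral.integral_same, mul_zero,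
    zero_mul, sub_zero, zero_sub]
  congr 1
  apply intervalIntegral.integral_congr_ae
  filter_upwards [hg.ae_hasDerivAt_integral] with x hx hx'
  rw [(hx (uIoc_subset_uIcc hx') a (by simp)).deriv]

lemma memLp_of_continuous {f : ℝ → ℝ} (hf : Continuous f) :
    MemLp f 2 (volume.restrict (Ioo a b)) := by
  obtain ⟨C, hC⟩ := isCompact_Icc.exists_bound_of_continuousOn (s := Icc a b) hf.continuousOn
  refine MemLp.of_bound hf.aestronglyMeasurable C ?_
  filter_upwards [ae_restrict_mem measurableSet_Ioo] with x hx
  exact hC x (Ioo_subset_Icc_self hx)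

/-- The class in `L²(a, b)` of a continuous function. -/
def contToLp (a b : ℝ) (f : C(ℝ, ℝ)) : L2I a b := (memLp_of_continuous f.continuous).toLp f

lemma inner_contToLp (f : C(ℝ, ℝ)) (g : L2I a b) :
    inner ℝ (contToLp a b f) g = ∫ x in Ioo a b, g x * f x := by
  rw [L2.inner_def]
  refine integral_congr_ae ?_
  filter_upwards [(memLp_of_continuous f.continuous).coeFn_toLp] with x hx
  simp only [contToLp, hx, RCLike.inner_apply, conj_trivial]

/-- The indicator function of `(a, x)` in `L²(a, b)`. -/
def stepVec (a b x : ℝ) : L2I a b :=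
  indicatorConstLp 2 (measurableSet_Iio (a := x)) (measure_ne_top _ _) 1

lemma inner_stepVec {x : ℝ} (hx : x ∈ Icc a b) (g : L2I a b) :
    inner ℝ (stepVec a b x) g = ∫ y in a..x, g y := by
  rw [stepVec, L2.inner_indicatorConstLp_one, Measure.restrict_restrict measurableSet_Iio,
    ← setIntegral_Ioo_eq hx.1]
  congr 2
  ext y
  simp only [mem_inter_iff, mem_Iio, mem_Ioo]
  constructor
  · rintro ⟨h1, h2, h3⟩; exact ⟨h2, h1⟩
  · rintro ⟨h1, h2⟩; exact ⟨h2, h1, h2.trans_le hx.2⟩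

/-- The symmetric difference of two half-lines has measure at most |y - x|. This continuity is the
source of all compactness: it makes point evaluations a continuous family of functionals. -/
lemma continuous_stepVec : Continuous (stepVec a b) := by
  refine continuous_indicatorConstLp_set (by simp) fun x => ?_
  have h1 : ∀ y, (volume.restrict (Ioo a b)) (symmDiff (Iio y) (Iio x))
      ≤ ENNReal.ofReal (|y - x|) := fun y => by
    refine (Measure.restrict_apply_le _ _).trans ?_
    rcases le_total x y with h | h
    · refine (measure_mono (t := Icc x y) ?_).trans ?_
      · intro z hz
        rcases hz with hz | hz
        · exact ⟨not_lt.1 hz.2, hz.1.le⟩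
        · exact absurd (hz.1.trans_le h) hz.2
      · rw [Real.volume_Icc, abs_of_nonneg (sub_nonneg.2 h)]
    · refine (measure_mono (t := Icc y x) ?_).trans ?_
      · intro z hz
        rcases hz with hz | hz
        · exact absurd (hz.1.trans_le h) hz.2
        · exact ⟨not_lt.1 hz.2, hz.1.le⟩
      · rw [Real.volume_Icc, abs_sub_comm, abs_of_nonneg (sub_nonneg.2 h)]
  refine tendsto_of_tendsto_of_tendsto_of_le_of_le tendsto_const_nhds ?_
    (fun _ => bot_le) h1
  have h2 : Continuous fun y => ENNReal.ofReal |y - x| :=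
    ENNReal.continuous_ofReal.comp (by fun_prop)
  have h3 := h2.tendsto x
  simpa using h3

/-- The value at `x` of the continuous representative of a function with derivative `g₁`. -/
def repVal (x : ℝ) (g₀ g₁ : L2I a b) : ℝ :=
  inner ℝ (contToLp a b (ContinuousMap.const ℝ (b - a)⁻¹)) g₀ +
    inner ℝ (stepVec a b x - contToLp a b ⟨fun s => (b - s) * (b - a)⁻¹, by fun_prop⟩) g₁

lemma repVal_eq_add_integral {x y : ℝ} (hx : x ∈ Icc a b) (hy : y ∈ Icc a b) (g₀ g₁ : L2I a b) :
    repVal y g₀ g₁ = repVal x g₀ g₁ + ∫ s in x..y, g₁ s := by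
  have hi : ∀ z ∈ Icc a b, IntervalIntegrable g₁ volume a z := fun z hz =>
    (g₁.intervalIntegrable (hz.1.trans hz.2)).mono_set (by
      rw [uIcc_of_le hz.1, uIcc_of_le (hz.1.trans hz.2)]; exact Icc_subset_Icc_right hz.2)
  rw [← intervalIntegral.integral_interval_sub_left (hi y hy) (hi x hx)]
  simp only [repVal, inner_sub_left, inner_stepVec hx, inner_stepVec hy]
  ring

/-- A function with weak derivative in `L²(a, b)` coincides with its continuous representative. -/
lemma ae_eq_repVal (hab : a < b) (g₀ g₁ : L2I a b)
    (H : ∀ φ, IsTestFun a b φ →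
      ∫ x in Ioo a b, g₀ x * deriv φ x = -∫ x in Ioo a b, g₁ x * φ x) :
    ∀ᵐ x ∂(volume.restrict (Ioo a b)), g₀ x = repVal x g₀ g₁ := by
  set G : ℝ → ℝ := fun x => ∫ y in a..x, g₁ y with hG
  have hGc : ContinuousOn G (Icc a b) := by
    have h := intervalIntegral.continuousOn_primitive_interval (μ := volume) (f := g₁)
      (a := a) (b := b) ((intervalIntegrable_iff' (by simp)).1 (g₁.intervalIntegrable hab.le))
    rwa [uIcc_of_le hab.le] at h
  have hGi : IntegrableOn G (Ioo a b) := (hGc.integrableOn_Icc).mono_set Ioo_subset_Icc_self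
  have hmul : ∀ f : ℝ → ℝ, IntegrableOn f (Ioo a b) → ∀ φ, IsTestFun a b φ →
      IntegrableOn (fun x => f x * φ x) (Ioo a b) := fun f hf φ hφ => by
    obtain ⟨C, hC⟩ := hφ.2.1.exists_bound_of_continuous hφ.isBump.continuous
    exact Integrable.mul_bdd (c := C) hf hφ.isBump.continuous.aestronglyMeasurable
      (Filter.Eventually.of_forall hC)
  obtain ⟨c, hc⟩ := exists_ae_eq_const_of_integral_deriv_eq_zero hab (h := fun x => g₀ x - G x)
    (g₀.integrableOn.sub hGi).locallyIntegrableOn fun φ hφ => by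
      simp only [sub_mul]
      rw [integral_sub (hmul _ g₀.integrableOn _ hφ.deriv) (hmul _ hGi _ hφ.deriv), H φ hφ,
        setIntegral_Ioo_eq hab.le, setIntegral_Ioo_eq hab.le,
        integral_primitive_mul_deriv (g₁.intervalIntegrable hab.le)
          (hφ.1.of_le (by exact_mod_cast le_top)) (hφ.eq_zero (by simp)), sub_self]
  -- The function is G + c, and comparing means fixes c. The mean of G is an integral of g₁ against
  -- (b - s)/(b - a), the weight in `repVal`.
  have h1 : ∫ x in a..b, G x = ∫ x in a..b, g₁ x * (b - x) := by
    have h := integral_primitive_mul_deriv (g₁.intervalIntegrable hab.le) (φ := fun x => x - b)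
      (by fun_prop) (by simp)
    simp only [deriv_sub_const, deriv_id'', mul_one] at h
    rw [hG, h, ← intervalIntegral.integral_neg]
    congr 1 with x
    ring
  have h2 : ∫ x in Ioo a b, (g₀ x - G x) = c * (b - a) := by
    rw [integral_congr_ae hc]
    simp [hab.le, mul_comm]
  rw [integral_sub g₀.integrableOn hGi, setIntegral_Ioo_eq hab.le G, h1] at h2
  filter_upwards [hc, ae_restrict_mem measurableSet_Ioo] with x hx hx'
  have h3 : ∫ y in Ioo a b, g₁ y * ((b - y) * (b - a)⁻¹)
      = (∫ y in a..b, g₁ y * (b - y)) * (b - a)⁻¹ := by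
    rw [← setIntegral_Ioo_eq hab.le, ← integral_mul_const]
    congr 1 with y
    ring
  rw [repVal, inner_sub_left, inner_stepVec (Ioo_subset_Icc_self hx'), inner_contToLp,
    inner_contToLp]
  simp only [ContinuousMap.const_apply, ContinuousMap.coe_mk]
  rw [h3, integral_mul_const]
  have h4 : b - a ≠ 0 := sub_ne_zero.2 hab.ne'
  have h5 : g₀ x = G x + c := by linarith
  have h6 : c = ((∫ y in Ioo a b, g₀ y) - ∫ y in a..b, g₁ y * (b - y)) * (b - a)⁻¹ := by
    rw [h2]; field_simp
  rw [h5, h6]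
  ring

end Interval

end

/-! ### Weak convergence along ultrafilters -/

noncomputable section

section WeakConvergence

open Filter Topology

variable {ι E E' : Type*} [NormedAddCommGroup E] [InnerProductSpace ℝ E]
  [NormedAddCommGroup E'] [InnerProductSpace ℝ E']

/-- Weak convergence in a Hilbert space. -/
def TendstoWeakly (u : ι → E) (F : Filter ι) (u₀ : E) : Prop :=
  ∀ v, Tendsto (fun i => inner ℝ v (u i)) F (𝓝 (inner ℝ v u₀))

/-- Banach–Alaoglu, transported to the space itself by the Riesz isomorphism. Ultrafilters replace
the extraction of subsequences. -/
lemma exists_tendstoWeakly [CompleteSpace E] (F : Ultrafilter ι) {u : ι → E} {M : ℝ}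
    (hu : ∀ᶠ i in (F : Filter ι), ‖u i‖ ≤ M) : ∃ u₀, TendstoWeakly u F u₀ := by
  let f : ι → WeakDual ℝ E := fun i => StrongDual.toWeakDual (InnerProductSpace.toDual ℝ E (u i))
  have hK := WeakDual.isCompact_closedBall (𝕜 := ℝ) (0 : StrongDual ℝ E) M
  obtain ⟨x, -, hx⟩ := hK.ultrafilter_le_nhds (F.map f) (by
    rw [le_principal_iff]
    refine hu.mono fun i hi => ?_
    simp only [f, mem_preimage, mem_closedBall_zero_iff]
    rw [StrongDual.toStrongDual_toWeakDual, LinearIsometryEquiv.norm_map]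
    exact hi)
  refine ⟨(InnerProductSpace.toDual ℝ E).symm (WeakDual.toStrongDual x), fun v => ?_⟩
  have h1 : Tendsto (fun i => f i v) F (𝓝 (x v)) :=
    ((WeakDual.eval_continuous v).tendsto x).comp hx
  rw [real_inner_comm, InnerProductSpace.toDual_symm_apply]
  refine h1.congr fun i => ?_
  rw [real_inner_comm]
  exact InnerProductSpace.toDual_apply_apply

/-- A closed subspace is its double orthogonal complement, a condition expressed by functionals and
so preserved by weak limits. -/
lemma TendstoWeakly.mem [CompleteSpace E] {F : Filter ι} [F.NeBot] {u : ι → E} {u₀ : E}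
    (h : TendstoWeakly u F u₀) {S : Submodule ℝ E} (hS : IsClosed (S : Set E))
    (hu : ∀ᶠ i in F, u i ∈ S) : u₀ ∈ S := by
  have : CompleteSpace S := hS.completeSpace_coe
  rw [← Submodule.orthogonal_orthogonal S]
  intro w hw
  refine tendsto_nhds_unique (h w) (tendsto_const_nhds.congr' (hu.mono fun i hi => ?_))
  exact (Submodule.inner_left_of_mem_orthogonal hi hw).symm

lemma TendstoWeakly.norm_sq_add_le {F : Filter ι} [F.NeBot] {u : ι → E} {u₀ : E} {v : ι → E'}
    {v₀ : E'} (h : TendstoWeakly u F u₀) (h' : TendstoWeakly v F v₀) {C : ℝ}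
    (hC : ∀ᶠ i in F, ‖u i‖ ^ 2 + ‖v i‖ ^ 2 ≤ C) : ‖u₀‖ ^ 2 + ‖v₀‖ ^ 2 ≤ C := by
  -- ⟨u₀, uᵢ⟩ + ⟨v₀, vᵢ⟩ is at most half the sum of all squared norms, hence at most this bound; in
  -- the limit the left side is ‖u₀‖² + ‖v₀‖².
  have h1 := le_of_tendsto ((h u₀).add (h' v₀)) (b := (‖u₀‖ ^ 2 + ‖v₀‖ ^ 2 + C) / 2)
    (hC.mono fun i hi => by
      have e1 := real_inner_le_norm u₀ (u i)
      have e2 := real_inner_le_norm v₀ (v i)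
      nlinarith [sq_nonneg (‖u₀‖ - ‖u i‖), sq_nonneg (‖v₀‖ - ‖v i‖)])
  rw [real_inner_self_eq_norm_sq, real_inner_self_eq_norm_sq] at h1
  linarith

/-- Weak convergence of a bounded family is uniform on compact families of functionals. -/
lemma TendstoWeakly.tendstoUniformlyOn {F : Filter ι} {u : ι → E} {u₀ : E}
    (h : TendstoWeakly u F u₀) {M : ℝ} (hM : ∀ᶠ i in F, ‖u i‖ ≤ M) {K : Set ℝ} (hK : IsCompact K)
    {κ : ℝ → E} (hκ : Continuous κ) :
    TendstoUniformlyOn (fun i x => inner ℝ (κ x) (u i)) (fun x => inner ℝ (κ x) u₀) F K := by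
  rw [← tendstoLocallyUniformlyOn_iff_tendstoUniformlyOn_of_compact hK,
    Metric.tendstoLocallyUniformlyOn_iff]
  intro ε hε x _
  set R := |M| + ‖u₀‖ + 1 with hR
  have hR0 : 0 < R := by positivity
  -- On this neighbourhood replacing κ(y) by κ(x) costs less than ε/2 uniformly in i, as R exceeds
  -- ‖u₀ - uᵢ‖; weak convergence at the single vector κ(x) gives the other half.
  refine ⟨{y | ‖κ y - κ x‖ < ε / (2 * R)}, mem_nhdsWithin_of_mem_nhds ?_, ?_⟩
  · exact (isOpen_lt (by fun_prop) continuous_const).mem_nhds (by simpa using by positivity)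
  · have hx := (Metric.tendsto_nhds.1 (h (κ x))) (ε / 2) (half_pos hε)
    filter_upwards [hx, hM] with i h1 h2 y hy
    rw [Real.dist_eq] at h1 ⊢
    have h3 : inner ℝ (κ y) u₀ - inner ℝ (κ y) (u i)
        = -(inner ℝ (κ x) (u i) - inner ℝ (κ x) u₀) + inner ℝ (κ y - κ x) (u₀ - u i) := by
      simp only [inner_sub_left, inner_sub_right]; ring
    have h4 : |inner ℝ (κ y - κ x) (u₀ - u i)| ≤ ε / (2 * R) * R := by
      refine (abs_real_inner_le_norm _ _).trans (mul_le_mul (le_of_lt hy) ?_ (norm_nonneg _)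
        (by positivity))
      refine (norm_sub_le _ _).trans ?_
      linarith [le_abs_self M]
    have h5 : ε / (2 * R) * R = ε / 2 := by field_simp
    rw [h3]
    refine (abs_add_le _ _).trans_lt ?_
    rw [abs_neg]
    linarith

end WeakConvergence

/-! ### Weak derivatives on an interval -/

section WeakDeriv

variable {a b : ℝ} {k : ℕ} {f f' g g' : ℝ → ℝ}

lemma IsTestFun.iteratedDeriv {φ : ℝ → ℝ} (h : IsTestFun a b φ) (k : ℕ) :
    IsTestFun a b (iteratedDeriv k φ) := by
  induction k with
  | zero => rwa [iteratedDeriv_zero]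
  | succ k ih => rw [iteratedDeriv_succ]; exact ih.deriv

lemma IsTestFun.integrable_mul {φ : ℝ → ℝ} (h : IsTestFun a b φ)
    (hf : LocallyIntegrableOn f (Ioo a b)) : IntegrableOn (fun x => f x * φ x) (Ioo a b) := by
  have h1 : IntegrableOn f (tsupport φ) := hf.integrableOn_compact_subset h.2.2 h.2.1
  obtain ⟨C, hC⟩ := h.2.1.exists_bound_of_continuous h.isBump.continuous
  have h2 : IntegrableOn (fun x => f x * φ x) (tsupport φ) :=
    Integrable.mul_bdd (c := C) h1 h.isBump.continuous.aestronglyMeasurable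
      (Filter.Eventually.of_forall hC)
  refine Integrable.integrableOn ((integrableOn_iff_integrable_of_support_subset
    fun x hx => ?_).1 h2)
  exact subset_tsupport _ (right_ne_zero_of_mul hx)

lemma LocallyIntegrableOn.congr_ae {s : Set ℝ} (hf : LocallyIntegrableOn f s)
    (h : f =ᵐ[volume.restrict s] g) : LocallyIntegrableOn g s := by
  intro x hx
  obtain ⟨t, ht, h1⟩ := hf x hx
  refine ⟨t ∩ s, Filter.inter_mem ht self_mem_nhdsWithin, ?_⟩
  exact (h1.mono_set inter_subset_left).congr_fun_ae
    (ae_restrict_of_ae_restrict_of_subset inter_subset_right h)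

namespace IsWeakDeriv

lemma congr (h : IsWeakDeriv a b k f g) (hf : f =ᵐ[volume.restrict (Ioo a b)] f')
    (hg : g =ᵐ[volume.restrict (Ioo a b)] g') : IsWeakDeriv a b k f' g' := by
  refine ⟨LocallyIntegrableOn.congr_ae h.1 hf,
    LocallyIntegrableOn.congr_ae h.2.1 hg, fun φ hφ => ?_⟩
  exact (integral_congr_ae (hf.mul (ae_eq_refl (iteratedDeriv k φ)))).symm.trans
    ((h.2.2 φ hφ).trans (congrArg _ (integral_congr_ae (hg.mul (ae_eq_refl φ)))))

lemma add (h : IsWeakDeriv a b k f g) (h' : IsWeakDeriv a b k f' g') :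
    IsWeakDeriv a b k (f + f') (g + g') := by
  refine ⟨h.1.add h'.1, h.2.1.add h'.2.1, fun φ hφ => ?_⟩
  simp only [Pi.add_apply, add_mul]
  rw [integral_add ((hφ.iteratedDeriv k).integrable_mul h.1)
    ((hφ.iteratedDeriv k).integrable_mul h'.1), integral_add (hφ.integrable_mul h.2.1)
    (hφ.integrable_mul h'.2.1), h.2.2 φ hφ, h'.2.2 φ hφ, mul_add]

lemma const_smul (h : IsWeakDeriv a b k f g) (c : ℝ) : IsWeakDeriv a b k (c • f) (c • g) := by
  refine ⟨h.1.smul c, h.2.1.smul c, fun φ hφ => ?_⟩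
  simp only [Pi.smul_apply, smul_eq_mul, mul_assoc]
  rw [integral_const_mul, integral_const_mul, h.2.2 φ hφ]
  ring

lemma ae_unique (h : IsWeakDeriv a b k f g) (h' : IsWeakDeriv a b k f g') :
    g =ᵐ[volume.restrict (Ioo a b)] g' := by
  have key := IsOpen.ae_eq_zero_of_integral_contDiff_smul_eq_zero (μ := (volume : Measure ℝ))
    (f := fun x => g x - g' x) (U := Ioo a b) isOpen_Ioo (h.2.1.sub h'.2.1) (fun φ h1 h2 h3 => by
      have hφ : IsTestFun a b φ := ⟨h1, h2, h3⟩
      have e : ∀ x, φ x • (g x - g' x) = g x * φ x - g' x * φ x := fun x => by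
        rw [smul_eq_mul]; ring
      simp_rw [e, ← sub_mul]
      rw [← hφ.setIntegral_mul (fun x => g x - g' x)]
      simp_rw [sub_mul]
      rw [integral_sub (hφ.integrable_mul h.2.1) (hφ.integrable_mul h'.2.1), sub_eq_zero]
      have h4 := (h.2.2 φ hφ).symm.trans (h'.2.2 φ hφ)
      exact mul_left_cancel₀ (pow_ne_zero k (by norm_num)) h4)
  rw [Filter.EventuallyEq, ae_restrict_iff' measurableSet_Ioo]
  filter_upwards [key] with x hx hx'
  exact sub_eq_zero.1 (hx hx')

lemma ae_eq_of_zero (h : IsWeakDeriv a b 0 f g) : f =ᵐ[volume.restrict (Ioo a b)] g :=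
  ae_unique (k := 0) (f := f) ⟨h.1, h.1, fun φ _ => by simp⟩ h

/-- Testing the relation of order k with φ' and that of order k + 1 with φ gives the same left side,
so consecutive weak derivatives are linked by a first-order relation. -/
lemma of_succ (h : IsWeakDeriv a b k f g) (h' : IsWeakDeriv a b (k + 1) f g') :
    ∀ φ, IsTestFun a b φ →
      ∫ x in Ioo a b, g x * deriv φ x = -∫ x in Ioo a b, g' x * φ x := by
  intro φ hφ
  have h1 := h.2.2 _ hφ.deriv
  have h2 := h'.2.2 _ hφ
  rw [← iteratedDeriv_succ', h2, pow_succ] at h1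
  have h3 : ((-1 : ℝ)) ^ k ≠ 0 := pow_ne_zero k (by norm_num)
  have h4 := mul_left_cancel₀ h3 (h1.symm.trans (mul_assoc _ _ _))
  rw [h4]; ring

end IsWeakDeriv

end WeakDeriv

end

/-! ### H^s as a closed subspace of a product of L² spaces -/

noncomputable section

section LintegralSq

variable {α : Type*} [MeasurableSpace α] {μ : Measure α}

lemma ofReal_sq_eq_enorm_sq (r : ℝ) : ENNReal.ofReal (r ^ 2) = ‖r‖ₑ ^ 2 := by
  rw [← sq_abs, ENNReal.ofReal_pow (abs_nonneg r), Real.enorm_eq_ofReal_abs]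

lemma lintegral_ofReal_sq (v : Lp ℝ 2 μ) :
    ∫⁻ x, ENNReal.ofReal (v x ^ 2) ∂μ = ENNReal.ofReal (‖v‖ ^ 2) := by
  rw [lintegral_congr fun x => ofReal_sq_eq_enorm_sq (v x), ← eLpNorm_two_sq, ENNReal.ofReal_pow (norm_nonneg _), Lp.norm_def,
    ENNReal.ofReal_toReal (Lp.eLpNorm_ne_top v)]

lemma memLp_two_of_lintegral_sq {f : α → ℝ} (hf : AEStronglyMeasurable f μ)
    (h : ∫⁻ x, ENNReal.ofReal (f x ^ 2) ∂μ < ⊤) : MemLp f 2 μ := by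
  refine ⟨hf, ?_⟩
  simp_rw [ofReal_sq_eq_enorm_sq] at h
  rw [← eLpNorm_two_sq] at h
  by_contra hn
  rw [not_lt, top_le_iff] at hn
  rw [hn] at h
  simp at h

end LintegralSq

/-- The Hilbert space in which a function of `H^s(a, b)`, `m = ⌊s⌋`, is represented by its
derivatives up to the order `m` and the difference quotient of the last one. -/
abbrev SobE (m : ℕ) (a b : ℝ) : Type :=
  WithLp 2 ((PiLp 2 fun _ : Fin (m + 1) => L2I a b) ×
    Lp ℝ 2 ((volume.restrict (Ioo a b)).prod (volume.restrict (Ioo a b))))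

/-- The weight in the difference quotient of a function of `H^s`. -/
def quotWeight (s : ℝ) (q : ℝ × ℝ) : ℝ :=
  if s = ⌊s⌋₊ then 0 else (√(|q.1 - q.2| ^ (1 + 2 * (s - ⌊s⌋₊))))⁻¹

lemma measurable_quotWeight (s : ℝ) : Measurable (quotWeight s) := by
  unfold quotWeight
  split_ifs <;> fun_prop

/-- The weighted difference quotient of `g`. -/
def diffQuot (s : ℝ) (g : ℝ → ℝ) (q : ℝ × ℝ) : ℝ := (g q.1 - g q.2) * quotWeight s q

section

variable {s a b : ℝ} {f f' : ℝ → ℝ}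

/-- The component of order `k`. -/
def sobComp (m : ℕ) (a b : ℝ) (k : Fin (m + 1)) : SobE m a b →L[ℝ] L2I a b :=
  (PiLp.proj 2 (fun _ : Fin (m + 1) => L2I a b) k).comp (WithLp.fstL 2 ℝ _ _)

/-- The difference quotient component. -/
def sobQuot (m : ℕ) (a b : ℝ) : SobE m a b →L[ℝ]
    Lp ℝ 2 ((volume.restrict (Ioo a b)).prod (volume.restrict (Ioo a b))) :=
  WithLp.sndL 2 ℝ _ _

lemma norm_sq_sobE (m : ℕ) (u : SobE m a b) :
    ‖u‖ ^ 2 = ∑ k, ‖sobComp m a b k u‖ ^ 2 + ‖sobQuot m a b u‖ ^ 2 := by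
  rw [WithLp.prod_norm_sq_eq_of_L2, PiLp.norm_sq_eq_of_L2]
  rfl

lemma exists_sobE {m : ℕ} (g : Fin (m + 1) → L2I a b)
    (q : Lp ℝ 2 ((volume.restrict (Ioo a b)).prod (volume.restrict (Ioo a b)))) :
    ∃ u : SobE m a b, (∀ k, sobComp m a b k u = g k) ∧ sobQuot m a b u = q :=
  ⟨WithLp.toLp 2 (WithLp.toLp 2 g, q), fun _ => rfl, rfl⟩

/-- The element `u` of the Hilbert space `SobE` represents the function `f`. -/
structure Represents (s a b : ℝ) (f : ℝ → ℝ) (u : SobE ⌊s⌋₊ a b) : Prop where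
  weak : ∀ k : Fin (⌊s⌋₊ + 1), IsWeakDeriv a b k f (sobComp ⌊s⌋₊ a b k u)
  quot : sobQuot ⌊s⌋₊ a b u =ᵐ[(volume.restrict (Ioo a b)).prod (volume.restrict (Ioo a b))]
    diffQuot s (sobComp ⌊s⌋₊ a b (Fin.last _) u)

lemma diffQuot_congr {g g' : ℝ → ℝ} (h : g =ᵐ[volume.restrict (Ioo a b)] g') :
    diffQuot s g =ᵐ[(volume.restrict (Ioo a b)).prod (volume.restrict (Ioo a b))]
      diffQuot s g' := by
  filter_upwards [Measure.quasiMeasurePreserving_fst.ae_eq_comp h,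
    Measure.quasiMeasurePreserving_snd.ae_eq_comp h] with q h1 h2
  simp only [Function.comp_apply] at h1 h2
  rw [diffQuot, diffQuot, h1, h2]

lemma aestronglyMeasurable_diffQuot {g : ℝ → ℝ}
    (hg : AEStronglyMeasurable g (volume.restrict (Ioo a b))) :
    AEStronglyMeasurable (diffQuot s g)
      ((volume.restrict (Ioo a b)).prod (volume.restrict (Ioo a b))) :=
  (hg.comp_fst.sub hg.comp_snd).mul (measurable_quotWeight s).aestronglyMeasurable

lemma gagliardoSq_eq {g : ℝ → ℝ} (hg : AEStronglyMeasurable g (volume.restrict (Ioo a b))) :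
    (if s = ⌊s⌋₊ then 0 else gagliardoSq (s - ⌊s⌋₊) a b g)
      = ∫⁻ q, ENNReal.ofReal (diffQuot s g q ^ 2)
        ∂((volume.restrict (Ioo a b)).prod (volume.restrict (Ioo a b))) := by
  rw [lintegral_prod _ ((aestronglyMeasurable_diffQuot hg).aemeasurable.pow_const 2).ennreal_ofReal]
  split_ifs with h
  · simp [diffQuot, quotWeight, if_pos h]
  · unfold gagliardoSq
    congr 1 with x
    congr 1 with y
    congr 1
    rw [diffQuot, quotWeight, if_neg h, mul_pow, inv_pow, Real.sq_sqrt (by positivity),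
      div_eq_mul_inv]

/-- The square of the Sobolev norm computed from the derivatives `g`. -/
lemma sobolev_sum_eq {g : ℕ → ℝ → ℝ} {u : SobE ⌊s⌋₊ a b}
    (h : ∀ k : Fin (⌊s⌋₊ + 1), g k =ᵐ[volume.restrict (Ioo a b)] sobComp ⌊s⌋₊ a b k u)
    (hq : sobQuot ⌊s⌋₊ a b u =ᵐ[(volume.restrict (Ioo a b)).prod (volume.restrict (Ioo a b))]
      diffQuot s (g ⌊s⌋₊)) :
    ((∑ k ∈ Finset.range (⌊s⌋₊ + 1), ∫⁻ x in Ioo a b, ENNReal.ofReal (g k x ^ 2)) +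
      if s = ⌊s⌋₊ then 0 else gagliardoSq (s - ⌊s⌋₊) a b (g ⌊s⌋₊)) = ENNReal.ofReal (‖u‖ ^ 2) := by
  have hm : AEStronglyMeasurable (g ⌊s⌋₊) (volume.restrict (Ioo a b)) :=
    (Lp.aestronglyMeasurable _).congr (h (Fin.last _)).symm
  rw [gagliardoSq_eq hm, norm_sq_sobE, ENNReal.ofReal_add (by positivity) (by positivity),
    ENNReal.ofReal_sum_of_nonneg (fun _ _ => by positivity), Finset.sum_range]
  congr 1
  · refine Finset.sum_congr rfl fun k _ => ?_
    rw [← lintegral_ofReal_sq]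
    refine lintegral_congr_ae ?_
    filter_upwards [h k] with x hx
    rw [hx]
  · rw [← lintegral_ofReal_sq]
    refine lintegral_congr_ae ?_
    filter_upwards [hq] with x hx
    rw [hx]

/-- Weak derivatives are unique almost everywhere, so every competitor in the infimum has the value
‖u‖²; thus the representation is isometric. -/
lemma Represents.sobolevSq_eq {u : SobE ⌊s⌋₊ a b} (h : Represents s a b f u) :
    sobolevSq s a b f = ENNReal.ofReal (‖u‖ ^ 2) := by
  apply le_antisymm
  · let g : ℕ → ℝ → ℝ := fun k =>
      if hk : k < ⌊s⌋₊ + 1 then sobComp ⌊s⌋₊ a b ⟨k, hk⟩ u else 0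
    have hg : ∀ k : Fin (⌊s⌋₊ + 1), g k = sobComp ⌊s⌋₊ a b k u := fun k => dif_pos k.2
    refine (iInf₂_le g fun k hk => ?_).trans (sobolev_sum_eq (fun k => by rw [hg k]) ?_).le
    · have := h.weak ⟨k, Nat.lt_succ_of_le hk⟩
      rwa [← hg] at this
    · have := h.quot
      rwa [← hg] at this
  · refine le_iInf₂ fun g hg => (sobolev_sum_eq (u := u) (fun k => ?_) ?_).ge
    · exact (hg k (Nat.lt_succ_iff.1 k.2)).ae_unique (h.weak k)
    · exact h.quot.trans (diffQuot_congr ((h.weak (Fin.last _)).ae_unique (hg _ le_rfl)))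

lemma Represents.mem {u : SobE ⌊s⌋₊ a b} (h : Represents s a b f u) : f ∈ sobolevH s a b := by
  change sobolevSq s a b f < ⊤
  rw [h.sobolevSq_eq]
  exact ENNReal.ofReal_lt_top

lemma exists_represents (hf : f ∈ sobolevH s a b) : ∃ u, Represents s a b f u := by
  have hf' : sobolevSq s a b f < ⊤ := hf
  unfold sobolevSq at hf'
  simp only [iInf_lt_iff] at hf'
  obtain ⟨g, hg, hlt⟩ := hf'
  have hm : ∀ k ≤ ⌊s⌋₊, AEStronglyMeasurable (g k) (volume.restrict (Ioo a b)) := fun k hk =>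
    (hg k hk).2.1.aestronglyMeasurable
  rw [ENNReal.add_lt_top, ENNReal.sum_lt_top, gagliardoSq_eq (hm _ le_rfl)] at hlt
  have h1 : ∀ k : Fin (⌊s⌋₊ + 1), MemLp (g k) 2 (volume.restrict (Ioo a b)) := fun k =>
    memLp_two_of_lintegral_sq (hm _ (Nat.lt_succ_iff.1 k.2)) (hlt.1 _ (Finset.mem_range.2 k.2))
  have h2 := memLp_two_of_lintegral_sq (aestronglyMeasurable_diffQuot (hm _ le_rfl)) hlt.2
  obtain ⟨u, hu, hq⟩ := exists_sobE (fun k => (h1 k).toLp _) (h2.toLp _)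
  refine ⟨u, fun k => ?_, ?_⟩
  · rw [hu]
    exact (hg k (Nat.lt_succ_iff.1 k.2)).congr (ae_eq_refl _) (h1 k).coeFn_toLp.symm
  · rw [hu, hq]
    exact h2.coeFn_toLp.trans (diffQuot_congr (h1 (Fin.last _)).coeFn_toLp.symm)

namespace Represents

lemma add {u v : SobE ⌊s⌋₊ a b} (h : Represents s a b f u) (h' : Represents s a b f' v) :
    Represents s a b (f + f') (u + v) := by
  refine ⟨fun k => ?_, ?_⟩
  · rw [map_add]
    exact ((h.weak k).add (h'.weak k)).congr (ae_eq_refl _) (Lp.coeFn_add _ _).symm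
  · rw [map_add, map_add]
    refine (Lp.coeFn_add _ _).trans (.trans ?_ (diffQuot_congr (Lp.coeFn_add _ _).symm))
    filter_upwards [h.quot, h'.quot] with q h1 h2
    rw [Pi.add_apply, h1, h2]
    simp only [diffQuot, Pi.add_apply]
    ring

lemma smul {u : SobE ⌊s⌋₊ a b} (h : Represents s a b f u) (c : ℝ) :
    Represents s a b (c • f) (c • u) := by
  refine ⟨fun k => ?_, ?_⟩
  · rw [map_smul]
    exact ((h.weak k).const_smul c).congr (ae_eq_refl _) (Lp.coeFn_smul _ _).symm
  · rw [map_smul, map_smul]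
    refine (Lp.coeFn_smul _ _).trans (.trans ?_ (diffQuot_congr (Lp.coeFn_smul _ _).symm))
    filter_upwards [h.quot] with q h1
    rw [Pi.smul_apply, h1]
    simp only [diffQuot, Pi.smul_apply, smul_eq_mul]
    ring

lemma sub {u v : SobE ⌊s⌋₊ a b} (h : Represents s a b f u) (h' : Represents s a b f' v) :
    Represents s a b (f - f') (u - v) := by
  have := h.add (h'.smul (-1))
  rwa [neg_one_smul, neg_one_smul, ← sub_eq_add_neg, ← sub_eq_add_neg] at this

lemma zero : Represents s a b 0 (0 : SobE ⌊s⌋₊ a b) := by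
  refine ⟨fun k => ?_, ?_⟩
  · rw [map_zero]
    refine IsWeakDeriv.congr (f := 0) (g := 0) ⟨?_, ?_, fun φ _ => by simp⟩ (ae_eq_refl _)
      (Lp.coeFn_zero _ _ _).symm
    · exact (locallyIntegrable_zero).locallyIntegrableOn _
    · exact (locallyIntegrable_zero).locallyIntegrableOn _
  · rw [map_zero, map_zero]
    refine (Lp.coeFn_zero _ _ _).trans (.trans ?_ (diffQuot_congr (Lp.coeFn_zero _ _ _).symm))
    refine Filter.Eventually.of_forall fun q => ?_
    simp [diffQuot]

lemma ae_eq {u : SobE ⌊s⌋₊ a b} (h : Represents s a b f u) :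
    f =ᵐ[volume.restrict (Ioo a b)] sobComp ⌊s⌋₊ a b 0 u :=
  (h.weak 0).ae_eq_of_zero

end Represents

/-- The image of `H^s(a, b)` in `SobE`. -/
def sobV (s a b : ℝ) : Submodule ℝ (SobE ⌊s⌋₊ a b) where
  carrier := {u | ∃ f, Represents s a b f u}
  add_mem' := fun ⟨f, hf⟩ ⟨g, hg⟩ => ⟨f + g, hf.add hg⟩
  zero_mem' := ⟨0, Represents.zero⟩
  smul_mem' := fun c _ ⟨f, hf⟩ => ⟨c • f, hf.smul c⟩

/-- The image of the test functions in `SobE`. -/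
def sobTest (s a b : ℝ) : Submodule ℝ (SobE ⌊s⌋₊ a b) where
  carrier := {u | ∃ f, IsTestFun a b f ∧ Represents s a b f u}
  add_mem' := fun ⟨f, h, hf⟩ ⟨g, h', hg⟩ => ⟨f + g, by
    have := h.sub (h'.const_mul (-1))
    simp only [neg_one_mul, sub_neg_eq_add] at this
    exact this, hf.add hg⟩
  zero_mem' := ⟨0, by
    obtain ⟨h1, h2⟩ : ContDiff ℝ ∞ (0 : ℝ → ℝ) ∧ HasCompactSupport (0 : ℝ → ℝ) :=
      ⟨contDiff_const, HasCompactSupport.zero⟩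
    exact ⟨h1, h2, by simp [tsupport_zero]⟩, Represents.zero⟩
  smul_mem' := fun c _ ⟨f, h, hf⟩ => ⟨c • f, h.const_mul c, hf.smul c⟩

/-- Weak derivative relations are pairings with test functions and pass to L² limits. The quotient
relation is pointwise and passes to the limit along an almost everywhere convergent subsequence. -/
lemma isClosed_sobV : IsClosed (sobV s a b : Set (SobE ⌊s⌋₊ a b)) := by
  refine IsSeqClosed.isClosed fun u u₀ hu hlim => ?_
  have hcomp : ∀ k, Filter.Tendsto (fun n => sobComp ⌊s⌋₊ a b k (u n)) Filter.atTop
      (nhds (sobComp ⌊s⌋₊ a b k u₀)) := fun k =>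
    ((sobComp ⌊s⌋₊ a b k).continuous.tendsto _).comp hlim
  have hquot : Filter.Tendsto (fun n => sobQuot ⌊s⌋₊ a b (u n)) Filter.atTop
      (nhds (sobQuot ⌊s⌋₊ a b u₀)) := ((sobQuot ⌊s⌋₊ a b).continuous.tendsto _).comp hlim
  choose f hf using hu
  refine ⟨sobComp ⌊s⌋₊ a b 0 u₀, fun k => ⟨(L2I.integrableOn _).locallyIntegrableOn,
    (L2I.integrableOn _).locallyIntegrableOn, fun φ hφ => ?_⟩, ?_⟩
  · have h1 := fun n => (((hf n).weak k).congr (hf n).ae_eq (ae_eq_refl _)).2.2 φ hφ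
    have hc : ∀ ψ : ℝ → ℝ, IsTestFun a b ψ → ∀ j, Filter.Tendsto
        (fun n => ∫ x in Ioo a b, sobComp ⌊s⌋₊ a b j (u n) x * ψ x) Filter.atTop
        (nhds (∫ x in Ioo a b, sobComp ⌊s⌋₊ a b j u₀ x * ψ x)) := fun ψ hψ j => by
      have h2 := (((innerSL ℝ (contToLp a b ⟨ψ, hψ.isBump.continuous⟩)).continuous.tendsto _).comp
        (hcomp j))
      simpa only [Function.comp_def, innerSL_apply_apply, inner_contToLp, ContinuousMap.coe_mk]
        using h2
    refine tendsto_nhds_unique (hc _ (hφ.iteratedDeriv k) 0) ?_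
    simp only [h1]
    exact (hc _ hφ k).const_mul _
  -- Two successive extractions: first for the top derivative, then, within that subsequence, for
  -- the quotient component on the square.
  · obtain ⟨n₁, hn₁, h1⟩ :=
      (tendstoInMeasure_of_tendsto_Lp (hcomp (Fin.last _))).exists_seq_tendsto_ae
    obtain ⟨n₂, hn₂, h2⟩ := (tendstoInMeasure_of_tendsto_Lp
      (hquot.comp hn₁.tendsto_atTop)).exists_seq_tendsto_ae
    have h3 := Measure.quasiMeasurePreserving_fst (μ := volume.restrict (Ioo a b))
      (ν := volume.restrict (Ioo a b)) |>.ae h1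
    have h4 := Measure.quasiMeasurePreserving_snd (μ := volume.restrict (Ioo a b))
      (ν := volume.restrict (Ioo a b)) |>.ae h1
    have h5 := ae_all_iff.2 fun n => (hf n).quot
    filter_upwards [h2, h3, h4, h5] with q h2 h3 h4 h5
    refine tendsto_nhds_unique h2 ?_
    simp only [Function.comp_apply, h5, diffQuot]
    exact ((h3.comp hn₂.tendsto_atTop).sub (h4.comp hn₂.tendsto_atTop)).mul_const _

lemma closure_sobTest_le : (sobTest s a b).topologicalClosure ≤ sobV s a b :=
  Submodule.topologicalClosure_minimal _ (fun _ ⟨f, _, h⟩ => ⟨f, h⟩) isClosed_sobV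

lemma mem_sobolevH0_iff {u : SobE ⌊s⌋₊ a b} (h : Represents s a b f u) :
    f ∈ sobolevH0 s a b ↔ u ∈ (sobTest s a b).topologicalClosure := by
  rw [← SetLike.mem_coe, Submodule.topologicalClosure_coe, Metric.mem_closure_iff]
  constructor
  · rintro ⟨-, hf⟩ ε hε
    obtain ⟨φ, hφ, hlt⟩ := hf (ENNReal.ofReal (ε ^ 2)) (by simpa using by positivity)
    -- The difference f - φ has finite norm and is represented by some w, so φ = f - (f - φ) is
    -- represented by u - w; finiteness of the norm of a test function need not be computed.
    obtain ⟨w, hw⟩ := exists_represents (s := s) (a := a) (b := b) (f := f - φ)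
      (hlt.trans_le le_top)
    have hv := h.sub hw
    rw [sub_sub_cancel] at hv
    refine ⟨u - w, ⟨φ, hφ, hv⟩, ?_⟩
    rw [hw.sobolevSq_eq, ENNReal.ofReal_lt_ofReal_iff (by positivity)] at hlt
    rw [dist_eq_norm, sub_sub_cancel]
    exact lt_of_pow_lt_pow_left₀ 2 hε.le hlt
  · intro H
    refine ⟨h.mem, fun δ hδ => ?_⟩
    obtain ⟨r, hr, hrδ⟩ := ENNReal.lt_iff_exists_nnreal_btwn.1 hδ
    obtain ⟨v, ⟨φ, hφ, hv⟩, hlt⟩ := H (√r) (Real.sqrt_pos.2 (by exact_mod_cast hr))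
    refine ⟨φ, hφ, ?_⟩
    rw [(h.sub hv).sobolevSq_eq]
    refine lt_of_le_of_lt ?_ hrδ
    rw [dist_eq_norm] at hlt
    refine ENNReal.ofReal_le_of_le_toReal ?_
    rw [ENNReal.coe_toReal]
    exact (pow_le_pow_left₀ (norm_nonneg _) hlt.le 2).trans_eq (Real.sq_sqrt r.2)

end

end

/-! ### From Sobolev controls to C¹ paths and L² shapes -/

noncomputable section

section Representative

variable {m : ℕ} {s a b : ℝ} {f : ℝ → ℝ}

/-- The vector representing the value at `x` of the continuous representative of the derivative
of order `j`. -/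
def repVec (a b : ℝ) (j : ℕ) (hj : j + 1 ≤ m) (x : ℝ) : SobE m a b :=
  ContinuousLinearMap.adjoint (sobComp m a b ⟨j, by omega⟩)
      (contToLp a b (ContinuousMap.const ℝ (b - a)⁻¹)) +
    ContinuousLinearMap.adjoint (sobComp m a b ⟨j + 1, by omega⟩)
      (stepVec a b x - contToLp a b ⟨fun s => (b - s) * (b - a)⁻¹, by fun_prop⟩)

lemma continuous_repVec (j : ℕ) (hj : j + 1 ≤ m) :
    Continuous (repVec (m := m) a b j hj) :=
  continuous_const.add ((ContinuousLinearMap.continuous _).comp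
    (continuous_stepVec.sub continuous_const))

lemma inner_repVec (j : ℕ) (hj : j + 1 ≤ m) (x : ℝ) (u : SobE m a b) :
    inner ℝ (repVec a b j hj x) u
      = repVal x (sobComp m a b ⟨j, by omega⟩ u) (sobComp m a b ⟨j + 1, by omega⟩ u) := by
  rw [repVec, inner_add_left, ContinuousLinearMap.adjoint_inner_left,
    ContinuousLinearMap.adjoint_inner_left, repVal]

lemma Represents.ae_eq_inner_repVec (hab : a < b) {u : SobE ⌊s⌋₊ a b} (h : Represents s a b f u)
    (j : ℕ) (hj : j + 1 ≤ ⌊s⌋₊) : ∀ᵐ x ∂(volume.restrict (Ioo a b)),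
      sobComp ⌊s⌋₊ a b ⟨j, by omega⟩ u x = inner ℝ (repVec a b j hj x) u := by
  simp_rw [inner_repVec]
  exact ae_eq_repVal hab _ _ ((h.weak ⟨j, by omega⟩).of_succ (h.weak ⟨j + 1, by omega⟩))

/-- The velocity of the path represented by `u`, extended by constants outside `[0, T]`. -/
def pathDeriv {T : ℝ} (hm : 2 ≤ m) (u : SobE m 0 T) (t : ℝ) : ℝ :=
  inner ℝ (repVec 0 T 1 hm (max 0 (min T t))) u

/-- The path represented by `u`. -/
def path {T : ℝ} (hm : 2 ≤ m) (u : SobE m 0 T) (t : ℝ) : ℝ :=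
  inner ℝ (repVec 0 T 0 (by omega) 0) u + ∫ τ in 0..t, pathDeriv hm u τ

/-- The shape of the bottom represented by `v`. -/
def shapeOf (hm : 2 ≤ m) (v : SobE m 0 1) : L2 :=
  toL2 ((Icc (0 : ℝ) 1).indicator fun x => inner ℝ (repVec 0 1 0 (by omega) x) v)

lemma continuous_pathDeriv {T : ℝ} (hm : 2 ≤ m) (u : SobE m 0 T) :
    Continuous (pathDeriv hm u) :=
  ((continuous_repVec 1 hm).comp (by fun_prop)).inner continuous_const

lemma hasDerivAt_path {T : ℝ} (hm : 2 ≤ m) (u : SobE m 0 T) (t : ℝ) :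
    HasDerivAt (path hm u) (pathDeriv hm u t) t :=
  (((continuous_pathDeriv hm u).integral_hasStrictDerivAt 0 t).hasDerivAt).const_add _

lemma memLp_indicator_Icc {g : ℝ → ℝ} (hg : Continuous g) :
    MemLp ((Icc (0 : ℝ) 1).indicator g) 2 := by
  rw [memLp_indicator_iff_restrict measurableSet_Icc,
    ← Measure.restrict_congr_set Ioo_ae_eq_Icc]
  exact memLp_of_continuous hg

lemma continuous_inner_repVec (j : ℕ) (hj : j + 1 ≤ m) (v : SobE m a b) :
    Continuous fun x => inner ℝ (repVec a b j hj x) v :=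
  (continuous_repVec j hj).inner continuous_const

lemma coeFn_shapeOf (hm : 2 ≤ m) (v : SobE m 0 1) : shapeOf hm v =ᵐ[volume]
    (Icc (0 : ℝ) 1).indicator fun x => inner ℝ (repVec 0 1 0 (by omega) x) v :=
  coeFn_toL2 (memLp_indicator_Icc (continuous_inner_repVec 0 _ v))

lemma indicator_Icc_ae_eq {g h : ℝ → ℝ} (H : g =ᵐ[volume.restrict (Ioo 0 1)] h) :
    (Icc (0 : ℝ) 1).indicator g =ᵐ[volume] (Icc (0 : ℝ) 1).indicator h := by
  rw [Measure.restrict_congr_set Ioo_ae_eq_Icc, Filter.EventuallyEq,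
    ae_restrict_iff' measurableSet_Icc] at H
  filter_upwards [H] with x hx
  by_cases hx' : x ∈ Icc (0 : ℝ) 1
  · rw [indicator_of_mem hx', indicator_of_mem hx', hx hx']
  · rw [indicator_of_notMem hx', indicator_of_notMem hx']

/-- The controls have a continuously differentiable path and a square integrable shape. -/
lemma controlRep_of_represents {T : ℝ} (hT : 0 < T) {p : (ℝ → ℝ) × (ℝ → ℝ)} (hm : 2 ≤ ⌊s⌋₊)
    {u : SobE ⌊s⌋₊ 0 T} (hu : Represents s 0 T p.1 u) {v : SobE ⌊s⌋₊ 0 1}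
    (hv : Represents s 0 1 p.2 v) :
    ControlRep T p (path hm u) (pathDeriv hm u) (shapeOf hm v) where
  hasDerivAt := hasDerivAt_path hm u
  continuous := continuous_pathDeriv hm u
  path := by
    -- The order-one component agrees almost everywhere with its continuous version; integrating
    -- that version from 0 gives a C¹ path agreeing almost everywhere with x₀. This uses weak
    -- derivatives up to order 2.
    have h1 := (ae_restrict_iff' measurableSet_Ioo).1 (hu.ae_eq_inner_repVec hT 1 hm)
    filter_upwards [hu.ae_eq, hu.ae_eq_inner_repVec hT 0 (by omega),
      ae_restrict_mem measurableSet_Ioo] with t h2 h3 ht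
    rw [h2]
    refine h3.trans ?_
    rw [inner_repVec, repVal_eq_add_integral ⟨le_rfl, hT.le⟩ (Ioo_subset_Icc_self ht),
      ← inner_repVec 0 (by omega), path]
    congr 1
    refine intervalIntegral.integral_congr_ae ?_
    filter_upwards [h1] with τ h4 hτ
    rw [uIoc_of_le ht.1.le] at hτ
    have h5 : τ ∈ Ioo 0 T := ⟨hτ.1, hτ.2.trans_lt ht.2⟩
    rw [pathDeriv, min_eq_right h5.2.le, max_eq_right h5.1.le]
    exact h4 h5
  shape := by
    refine (coeFn_shapeOf hm v).trans ?_
    have h1 : (fun x => inner ℝ (repVec 0 1 0 (by omega) x) v)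
        =ᵐ[volume.restrict (Ioo 0 1)] p.2 := by
      filter_upwards [hv.ae_eq_inner_repVec one_pos 0 (by omega), hv.ae_eq] with x h1 h2
      rw [h2]
      exact h1.symm
    exact indicator_Icc_ae_eq h1

end Representative

/-! ### Uniform convergence of paths, bottoms and data -/

section UniformLimits

open Filter Topology

variable {ι : Type*} {F : Filter ι} {m : ℕ} {T : ℝ}

/-- Uniform convergence on compact sets is preserved by continuous maps. -/
lemma TendstoUniformlyOn.continuous_comp {P Q : Type*} [UniformSpace P] [UniformSpace Q]
    {u : ι → ℝ → P} {u₀ : ℝ → P} {K : Set ℝ} (hK : IsCompact K)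
    (h : TendstoUniformlyOn u u₀ F K) (hu : ∀ i, Continuous (u i)) (hu₀ : Continuous u₀)
    {Φ : P → Q} (hΦ : Continuous Φ) :
    TendstoUniformlyOn (fun i t => Φ (u i t)) (fun t => Φ (u₀ t)) F K := by
  have : CompactSpace K := isCompact_iff_compactSpace.1 hK
  rw [tendstoUniformlyOn_iff_tendstoUniformly_comp_coe] at h ⊢
  let U : ι → C(K, P) := fun i => ⟨fun t => u i t, (hu i).comp continuous_subtype_val⟩
  let U₀ : C(K, P) := ⟨fun t => u₀ t, hu₀.comp continuous_subtype_val⟩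
  have h1 : Tendsto U F (𝓝 U₀) := ContinuousMap.tendsto_iff_tendstoUniformly.2 h
  have h2 := ((ContinuousMap.continuous_postcomp (X := K) ⟨Φ, hΦ⟩).tendsto U₀).comp h1
  exact ContinuousMap.tendsto_iff_tendstoUniformly.1 h2

lemma TendstoUniformlyOn.pair {P Q : Type*} [UniformSpace P] [UniformSpace Q] {K : Set ℝ}
    {u : ι → ℝ → P} {u₀ : ℝ → P} {v : ι → ℝ → Q} {v₀ : ℝ → Q} (h : TendstoUniformlyOn u u₀ F K)
    (h' : TendstoUniformlyOn v v₀ F K) :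
    TendstoUniformlyOn (fun i t => (u i t, v i t)) (fun t => (u₀ t, v₀ t)) F K :=
  fun V hV => tendsto_diag.eventually (h.prodMk h' V hV)

lemma tendstoUniformlyOn_pathDeriv (hm : 2 ≤ m) {u : ι → SobE m 0 T}
    {u₀ : SobE m 0 T}
    (h : TendstoWeakly u F u₀) {M : ℝ} (hM : ∀ᶠ i in F, ‖u i‖ ≤ M) :
    TendstoUniformlyOn (fun i => pathDeriv hm (u i)) (pathDeriv hm u₀) F (Icc 0 T) := by
  refine (h.tendstoUniformlyOn hM isCompact_Icc (continuous_repVec 1 hm)).congr ?_ |>.congr_right ?_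
  · refine Eventually.of_forall fun i t ht => ?_
    simp only [pathDeriv, min_eq_right ht.2, max_eq_right ht.1]
  · intro t ht
    simp only [pathDeriv, min_eq_right ht.2, max_eq_right ht.1]

lemma tendstoUniformlyOn_path (hT : 0 ≤ T) (hm : 2 ≤ m) {u : ι → SobE m 0 T} {u₀ : SobE m 0 T}
    (h : TendstoWeakly u F u₀) {M : ℝ} (hM : ∀ᶠ i in F, ‖u i‖ ≤ M) :
    TendstoUniformlyOn (fun i => path hm (u i)) (path hm u₀) F (Icc 0 T) := by
  rw [Metric.tendstoUniformlyOn_iff]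
  intro ε hε
  have h1 := Metric.tendstoUniformlyOn_iff.1 (tendstoUniformlyOn_pathDeriv hm h hM)
    (ε / (2 * (T + 1))) (by positivity)
  have h2 := Metric.tendsto_nhds.1 (h (repVec 0 T 0 (by omega) 0)) (ε / 2) (half_pos hε)
  filter_upwards [h1, h2] with i h1 h2 t ht
  rw [Real.dist_eq] at h2 ⊢
  have hi : ∀ w : SobE m 0 T, IntervalIntegrable (pathDeriv hm w) volume 0 t := fun w =>
    (continuous_pathDeriv hm w).intervalIntegrable _ _
  have h3 : |∫ τ in 0..t, (pathDeriv hm u₀ τ - pathDeriv hm (u i) τ)|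
      ≤ ε / (2 * (T + 1)) * |t - 0| := by
    rw [← Real.norm_eq_abs]
    refine intervalIntegral.norm_integral_le_of_norm_le_const fun τ hτ => ?_
    rw [uIoc_of_le ht.1] at hτ
    have := h1 τ ⟨hτ.1.le, hτ.2.trans ht.2⟩
    rw [Real.dist_eq] at this
    exact this.le
  rw [intervalIntegral.integral_sub (hi _) (hi _), sub_zero, abs_of_nonneg ht.1] at h3
  have h4 : ε / (2 * (T + 1)) * t ≤ ε / 2 := by
    rw [div_mul_eq_mul_div, div_le_div_iff₀ (by positivity) two_pos]
    nlinarith [ht.2, ht.1]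
  rw [abs_sub_comm] at h2
  have h5 : path hm u₀ t - path hm (u i) t
      = (inner ℝ (repVec 0 T 0 (by omega) 0) u₀ - inner ℝ (repVec 0 T 0 (by omega) 0) (u i))
        + ((∫ τ in 0..t, pathDeriv hm u₀ τ) - ∫ τ in 0..t, pathDeriv hm (u i) τ) := by
    simp only [path]; ring
  rw [h5]
  refine (abs_add_le _ _).trans_lt ?_
  linarith

/-- Point evaluations converge uniformly on [0, 1], an interval of length one, so a uniform bound
ε/2 is also an L² bound. -/
lemma tendsto_shapeOf (hm : 2 ≤ m) {v : ι → SobE m 0 1} {v₀ : SobE m 0 1}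
    (h : TendstoWeakly v F v₀) {M : ℝ} (hM : ∀ᶠ i in F, ‖v i‖ ≤ M) :
    Tendsto (fun i => shapeOf hm (v i)) F (𝓝 (shapeOf hm v₀)) := by
  rw [Metric.tendsto_nhds]
  intro ε hε
  have h1 := Metric.tendstoUniformlyOn_iff.1 (h.tendstoUniformlyOn hM
    (isCompact_Icc (a := (0 : ℝ)) (b := 1)) (continuous_repVec 0 (by omega))) (ε / 2) (by positivity)
  filter_upwards [h1] with i h1
  refine lt_of_le_of_lt ?_ (half_lt_self hε)
  rw [dist_eq_norm]
  have h2 : ‖shapeOf hm (v i) - shapeOf hm v₀‖ ≤ ‖toL2 ((Icc (0 : ℝ) 1).indicator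
      fun _ => ε / 2)‖ := by
    refine Lp.norm_le_norm_of_ae_le ?_
    filter_upwards [Lp.coeFn_sub (shapeOf hm (v i)) (shapeOf hm v₀), coeFn_shapeOf hm (v i),
      coeFn_shapeOf hm v₀, coeFn_toL2 (memLp_indicator_Icc (continuous_const (y := ε / 2)))]
      with x e1 e2 e3 e4
    rw [e1, e4, Pi.sub_apply, e2, e3]
    by_cases hx : x ∈ Icc (0 : ℝ) 1
    · simp only [indicator_of_mem hx]
      have := h1 x hx
      rw [dist_comm, dist_eq_norm] at this
      rw [Real.norm_of_nonneg (half_pos hε).le]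
      exact this.le
    · simp [indicator_of_notMem hx]
  refine h2.trans_eq ?_
  rw [← sq_eq_sq₀ (norm_nonneg _) (by positivity), ← real_inner_self_eq_norm_sq,
    inner_L2_eq (coeFn_toL2 (memLp_indicator_Icc (continuous_const (y := ε / 2))))
      (coeFn_toL2 (memLp_indicator_Icc (continuous_const (y := ε / 2))))]
  have : ∀ x, (Icc (0 : ℝ) 1).indicator (fun _ => ε / 2) x * (Icc (0 : ℝ) 1).indicator
      (fun _ => ε / 2) x = (Icc (0 : ℝ) 1).indicator (fun _ => (ε / 2) ^ 2) x := fun x => by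
    by_cases hx : x ∈ Icc (0 : ℝ) 1
    · simp only [indicator_of_mem hx]; ring
    · simp [indicator_of_notMem hx]
  simp_rw [this]
  rw [integral_indicator measurableSet_Icc]
  simp

/-- Translations are isometries, so strong continuity in r for each fixed f upgrades to joint
continuity. -/
lemma continuous_transl_uncurry : Continuous fun q : ℝ × L2 => transl q.1 q.2 := by
  rw [continuous_iff_continuousAt]
  rintro ⟨r, f⟩
  rw [ContinuousAt, tendsto_iff_dist_tendsto_zero]
  have h1 : Tendsto (fun q : ℝ × L2 => dist q.2 f + dist (transl q.1 f) (transl r f)) (𝓝 (r, f))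
      (𝓝 (dist f f + dist (transl r f) (transl r f))) :=
    ((continuous_snd.dist continuous_const).tendsto (r, f)).add
      ((((continuous_transl f).comp continuous_fst).dist continuous_const).tendsto (r, f))
  rw [dist_self, dist_self, add_zero] at h1
  refine squeeze_zero (fun _ => dist_nonneg) (fun q => ?_) h1
  refine (dist_triangle _ (transl q.1 f) _).trans ?_
  rw [(transl q.1).isometry.dist_eq]

/-- The convergence of the controls implies that of the bottoms. -/
lemma tendstoUniformlyOn_bottomCurve {X : ι → ℝ → ℝ} {X₀ : ℝ → ℝ} {Z : ι → L2} {Z₀ : L2}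
    (hX : TendstoUniformlyOn X X₀ F (Icc 0 T)) (hXc : ∀ i, Continuous (X i)) (hX₀ : Continuous X₀)
    (hZ : Tendsto Z F (𝓝 Z₀)) :
    TendstoUniformlyOn (fun i => bottomCurve (X i) (Z i)) (bottomCurve X₀ Z₀) F (Icc 0 T) := by
  have hZ' : TendstoUniformlyOn (fun i (_ : ℝ) => Z i) (fun _ => Z₀) F (Icc 0 T) :=
    hZ.tendstoUniformlyOn_const _
  have h := (hX.pair hZ').continuous_comp isCompact_Icc (fun i => (hXc i).prodMk continuous_const)
    (hX₀.prodMk continuous_const) continuous_transl_uncurry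
  exact h

/-- The convergence of the controls implies that of the data. -/
lemma tendstoUniformlyOn_dataCurve (hT : 0 ≤ T) (η₀ : L2) {X X' : ι → ℝ → ℝ} {X₀ X₀' : ℝ → ℝ}
    {Z : ι → L2} {Z₀ : L2}
    (hX : TendstoUniformlyOn X X₀ F (Icc 0 T)) (hXc : ∀ i, Continuous (X i)) (hX₀ : Continuous X₀)
    (hX' : TendstoUniformlyOn X' X₀' F (Icc 0 T)) (hXc' : ∀ i, Continuous (X' i))
    (hX₀' : Continuous X₀') (hZ : Tendsto Z F (𝓝 Z₀)) :
    TendstoUniformlyOn (fun i => dataCurve η₀ (X i) (X' i) (Z i)) (dataCurve η₀ X₀ X₀' Z₀) F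
      (Icc 0 T) := by
  have hB := tendstoUniformlyOn_bottomCurve hX hXc hX₀ hZ
  have hΦ : Continuous fun q : ℝ × L2 => (3 / 2 * q.1) • (opA q.2 - q.2)
      + (1 / 2 : ℝ) • opA q.2 := by fun_prop
  have h1 : TendstoUniformlyOn (fun i => forcing (X i) (X' i) (Z i)) (forcing X₀ X₀' Z₀) F
      (Icc 0 T) := (hX'.pair hB).continuous_comp isCompact_Icc
    (fun i => (hXc' i).prodMk (continuous_bottomCurve (hXc i) _))
    (hX₀'.prodMk (continuous_bottomCurve hX₀ _)) hΦ
  have h2 : TendstoUniformlyOn (fun i (_ : ℝ) => forcing (X i) (X' i) (Z i) 0)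
      (fun _ => forcing X₀ X₀' Z₀ 0) F (Icc 0 T) :=
    (h1.tendsto_at ⟨le_rfl, hT⟩).tendstoUniformlyOn_const _
  have h3 : TendstoUniformlyOn (fun (_ : ι) (_ : ℝ) => η₀) (fun _ => η₀) F (Icc 0 T) :=
    tendsto_const_nhds.tendstoUniformlyOn_const _
  exact h3.add (h1.sub h2)

end UniformLimits

end

/-! ### Unique solvability and the control ball in the Hilbert space -/

noncomputable section

section Existence

variable {T : ℝ} {p : (ℝ → ℝ) × (ℝ → ℝ)} {X X' : ℝ → ℝ} {Z : L2}

lemma exists_forall_norm_le_of_continuous {Y : Type*} [NormedAddCommGroup Y] (T : ℝ) {f : ℝ → Y}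
    (hf : Continuous f) : ∃ R, 0 ≤ R ∧ ∀ t ∈ Icc 0 T, ‖f t‖ ≤ R := by
  obtain ⟨C, hC⟩ := isCompact_Icc.exists_bound_of_continuousOn (s := Icc 0 T) hf.continuousOn
  exact ⟨max C 0, le_max_right _ _, fun t ht => (hC t ht).trans (le_max_left _ _)⟩

/-- The forced BBM problem is uniquely solvable for a regular control. -/
theorem ControlRep.existsUnique_solution (h : ControlRep T p X X' Z) (hT : 0 < T) (η₀ : L2) :
    ∃ η, IsSolution T η₀ (bottom p) η ∧
      ∀ η', IsSolution T η₀ (bottom p) η' → EqOn η' η (Icc 0 T) := by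
  obtain ⟨R, hR, h1⟩ := exists_forall_norm_le_of_continuous T (h.continuous_dataCurve η₀)
  obtain ⟨R', -, h2⟩ := exists_forall_norm_le_of_continuous T h.continuous_bottomCurve
  obtain ⟨C, hC⟩ := exists_mild (R := max R R') (hR.trans (le_max_left _ _)) hT.le
  obtain ⟨η, hη, -⟩ := hC _ _ (h.continuous_dataCurve η₀) h.continuous_bottomCurve fun t ht =>
    ⟨(h1 t ht).trans (le_max_left _ _), (h2 t ht).trans (le_max_right _ _)⟩
  refine ⟨η, (isSolution_iff_isMild h hT η₀ η).2 hη, fun η' hη' => ?_⟩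
  exact IsMild.eqOn hT.le h.continuous_bottomCurve ((isSolution_iff_isMild h hT η₀ η').1 hη') hη

/-- Lets the chosen solution be studied through the integrated equation built from any regular
representative of the control. -/
lemma ControlRep.isMild_solution (h : ControlRep T p X X' Z) (hT : 0 < T) (η₀ : L2) :
    IsMild T (dataCurve η₀ X X' Z) (bottomCurve X Z) (solution T η₀ (bottom p)) := by
  rw [← isSolution_iff_isMild h hT]
  obtain ⟨η, hη, -⟩ := h.existsUnique_solution hT η₀
  have hex : ∃ η, IsSolution T η₀ (bottom p) η := ⟨η, hη⟩
  rw [solution, dif_pos hex]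
  exact hex.choose_spec

end Existence

section Ball

variable {s T M : ℝ} {p : (ℝ → ℝ) × (ℝ → ℝ)}

lemma mem_controlBall_iff {u : SobE ⌊s⌋₊ 0 T} (hu : Represents s 0 T p.1 u) {v : SobE ⌊s⌋₊ 0 1}
    (hv : Represents s 0 1 p.2 v) : p ∈ controlBall s T M ↔
      v ∈ (sobTest s 0 1).topologicalClosure ∧ ‖u‖ ^ 2 + ‖v‖ ^ 2 ≤ M ^ 2 := by
  have h1 : sobolevSq s 0 T p.1 + sobolevSq s 0 1 p.2 ≤ ENNReal.ofReal (M ^ 2)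
      ↔ ‖u‖ ^ 2 + ‖v‖ ^ 2 ≤ M ^ 2 := by
    rw [hu.sobolevSq_eq, hv.sobolevSq_eq, ← ENNReal.ofReal_add (by positivity) (by positivity),
      ENNReal.ofReal_le_ofReal_iff (by positivity)]
  rw [← mem_sobolevH0_iff hv, ← h1]
  exact ⟨fun h => ⟨h.2.1, h.2.2⟩, fun h => ⟨hu.mem, h.1, h.2⟩⟩

lemma exists_represents_of_mem_controlBall (h : p ∈ controlBall s T M) :
    ∃ w : SobE ⌊s⌋₊ 0 T × SobE ⌊s⌋₊ 0 1,
      Represents s 0 T p.1 w.1 ∧ Represents s 0 1 p.2 w.2 := by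
  obtain ⟨u, hu⟩ := exists_represents h.1
  obtain ⟨v, hv⟩ := exists_represents h.2.1.1
  exact ⟨(u, v), hu, hv⟩

lemma zero_mem_controlBall : (0, 0) ∈ controlBall s T M := by
  rw [mem_controlBall_iff (p := (0, 0)) Represents.zero Represents.zero]
  exact ⟨zero_mem _, by simpa using sq_nonneg M⟩

end Ball

/-! ### Continuity of the cost and compactness of its range -/

section Cost

open Filter Topology

/-- The integral is the squared norm of the restriction to S, a bounded linear map. -/
lemma continuous_setIntegral_sq (S : Set ℝ) : Continuous fun u : L2 => ∫ x in S, u x ^ 2 := by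
  have h : ∀ u : L2, ∫ x in S, u x ^ 2 = ‖LpToLpRestrictCLM ℝ ℝ ℝ volume 2 S u‖ ^ 2 := fun u => by
    rw [← real_inner_self_eq_norm_sq, L2.inner_def]
    refine integral_congr_ae ?_
    filter_upwards [LpToLpRestrictCLM_coeFn ℝ S u] with x hx
    rw [hx]
    simp [sq]
  simp_rw [h]
  fun_prop

/-- The final state depends continuously on the data and on the bottom. -/
lemma tendsto_isMild {ι : Type*} {F : Filter ι} {T : ℝ} (hT : 0 ≤ T) {a ζ η : ι → ℝ → L2}
    {a₀ ζ₀ η₀ : ℝ → L2} (ha : TendstoUniformlyOn a a₀ F (Icc 0 T))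
    (hζ : TendstoUniformlyOn ζ ζ₀ F (Icc 0 T)) (hac : ∀ i, Continuous (a i))
    (hζc : ∀ i, Continuous (ζ i)) (ha₀ : Continuous a₀) (hζ₀ : Continuous ζ₀)
    (hη : ∀ᶠ i in F, IsMild T (a i) (ζ i) (η i)) (hη₀ : IsMild T a₀ ζ₀ η₀) :
    Tendsto (fun i => η i T) F (𝓝 (η₀ T)) := by
  obtain ⟨R₁, h0, h1⟩ := exists_forall_norm_le_of_continuous T ha₀
  obtain ⟨R₂, -, h2⟩ := exists_forall_norm_le_of_continuous T hζ₀
  -- Data within distance 1 of the limit share the bound R, so `exists_mild` and uniqueness bound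
  -- all nearby solutions by one constant, as the Lipschitz estimate requires.
  set R := max R₁ R₂ + 1 with hR
  obtain ⟨C, hC⟩ := exists_mild (R := R) (T := T)
    (add_nonneg (h0.trans (le_max_left _ _)) zero_le_one) hT
  have hbd : ∀ a' ζ' η' : ℝ → L2, Continuous a' → Continuous ζ' → IsMild T a' ζ' η' →
      (∀ t ∈ Icc 0 T, dist (a₀ t) (a' t) < 1) → (∀ t ∈ Icc 0 T, dist (ζ₀ t) (ζ' t) < 1) →
      ∀ t ∈ Icc 0 T, ‖η' t‖ ≤ C := by
    intro a' ζ' η' ha' hζ' hη' h3 h4 t ht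
    have aux : ∀ x y : L2, ‖x‖ ≤ max R₁ R₂ → dist x y < 1 → ‖y‖ ≤ R := fun x y hx hxy => by
      rw [dist_eq_norm'] at hxy
      have := norm_le_norm_add_norm_sub' y x
      linarith
    obtain ⟨w, hw, hwC⟩ := hC a' ζ' ha' hζ' fun t ht =>
      ⟨aux _ _ ((h1 t ht).trans (le_max_left _ _)) (h3 t ht),
        aux _ _ ((h2 t ht).trans (le_max_right _ _)) (h4 t ht)⟩
    rw [IsMild.eqOn hT hζ' hη' hw ht]
    exact hwC t ht
  obtain ⟨K, hK, hlip⟩ := mild_lipschitz (R := max C R) hT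
  have mT : T ∈ Icc 0 T := ⟨hT, le_rfl⟩
  rw [Metric.tendstoUniformlyOn_iff] at ha hζ
  rw [Metric.tendsto_nhds]
  intro ε hε
  set δ := ε / (2 * (K + 1)) with hδ
  have hδ0 : 0 < δ := by positivity
  filter_upwards [ha 1 one_pos, hζ 1 one_pos, ha δ hδ0, hζ δ hδ0, hη] with i e1 e2 e3 e4 e5
  have h5 := hlip _ _ _ _ _ _ hζ₀ (hζc i) hη₀ e5 (fun t ht =>
    ⟨(hbd _ _ _ ha₀ hζ₀ hη₀ (fun t _ => by simp) (fun t _ => by simp) t ht).trans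
        (le_max_left _ _),
      (hbd _ _ _ (hac i) (hζc i) e5 e1 e2 t ht).trans (le_max_left _ _),
      ((h2 t ht).trans ((le_max_right _ _).trans (by linarith))).trans (le_max_right C R)⟩) δ
    (fun t ht => by
      rw [← dist_eq_norm, ← dist_eq_norm]
      exact ⟨(e3 t ht).le, (e4 t ht).le⟩) T mT
  rw [dist_comm, dist_eq_norm]
  refine h5.trans_lt ?_
  rw [hδ, mul_div_assoc', div_lt_iff₀ (by positivity)]
  nlinarith

/-- The cost converges along ultrafilters on the set of admissible controls. -/
theorem exists_tendsto_cost {s T M : ℝ} (hs : 2 ≤ s) (hT : 0 < T) (a b : ℝ) (η₀ : L2)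
    (F : Ultrafilter ((ℝ → ℝ) × (ℝ → ℝ)))
    (hF : controlBall s T M ∈ F) :
    ∃ p₀ ∈ controlBall s T M, Tendsto (cost T a b η₀) F (𝓝 (cost T a b η₀ p₀)) := by
  have hm : 2 ≤ ⌊s⌋₊ := Nat.le_floor hs
  have hrep : ∀ p : (ℝ → ℝ) × (ℝ → ℝ), ∃ w : SobE ⌊s⌋₊ 0 T × SobE ⌊s⌋₊ 0 1,
      p ∈ controlBall s T M → Represents s 0 T p.1 w.1 ∧ Represents s 0 1 p.2 w.2 := fun p => by
    by_cases hp : p ∈ controlBall s T M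
    · obtain ⟨w, hw⟩ := exists_represents_of_mem_controlBall hp
      exact ⟨w, fun _ => hw⟩
    · exact ⟨0, fun h => absurd h hp⟩
  choose w hw using hrep
  have hF' : ∀ᶠ p in (F : Filter ((ℝ → ℝ) × (ℝ → ℝ))), p ∈ controlBall s T M := hF
  have hsq : ∀ᶠ p in (F : Filter ((ℝ → ℝ) × (ℝ → ℝ))),
      ‖(w p).1‖ ^ 2 + ‖(w p).2‖ ^ 2 ≤ M ^ 2 :=
    hF'.mono fun p hp => ((mem_controlBall_iff (hw p hp).1 (hw p hp).2).1 hp).2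
  have hu : ∀ᶠ p in (F : Filter ((ℝ → ℝ) × (ℝ → ℝ))), ‖(w p).1‖ ≤ |M| :=
    hsq.mono fun p hp => (le_abs_self _).trans (sq_le_sq.1 (by nlinarith [sq_nonneg ‖(w p).2‖]))
  have hv : ∀ᶠ p in (F : Filter ((ℝ → ℝ) × (ℝ → ℝ))), ‖(w p).2‖ ≤ |M| :=
    hsq.mono fun p hp => (le_abs_self _).trans (sq_le_sq.1 (by nlinarith [sq_nonneg ‖(w p).1‖]))
  obtain ⟨u₀, hu₀⟩ := exists_tendstoWeakly F hu
  obtain ⟨v₀, hv₀⟩ := exists_tendstoWeakly F hv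
  -- Weak limits stay in the closed subspaces and norms are weakly lower semicontinuous, so the
  -- limit is again an admissible control.
  obtain ⟨f, hf⟩ : u₀ ∈ sobV s 0 T :=
    hu₀.mem isClosed_sobV (hF'.mono fun p hp => ⟨p.1, (hw p hp).1⟩)
  have hv₀' : v₀ ∈ (sobTest s 0 1).topologicalClosure :=
    hv₀.mem (Submodule.isClosed_topologicalClosure _)
      (hF'.mono fun p hp => ((mem_controlBall_iff (hw p hp).1 (hw p hp).2).1 hp).1)
  obtain ⟨g, hg⟩ := closure_sobTest_le hv₀'
  refine ⟨(f, g), (mem_controlBall_iff (p := (f, g)) hf hg).2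
    ⟨hv₀', hu₀.norm_sq_add_le hv₀ hsq⟩, ?_⟩
  have hc₀ : ControlRep T (f, g) _ _ _ := controlRep_of_represents hT hm hf hg
  have hX := tendstoUniformlyOn_path hT.le hm hu₀ hu
  have hX' := tendstoUniformlyOn_pathDeriv hm hu₀ hu
  have hZ := tendsto_shapeOf hm hv₀ hv
  have cX : ∀ u : SobE ⌊s⌋₊ 0 T, Continuous (path hm u) := fun u =>
    continuous_iff_continuousAt.2 fun t => (hasDerivAt_path hm u t).continuousAt
  have cX' : ∀ u : SobE ⌊s⌋₊ 0 T, Continuous (pathDeriv hm u) := continuous_pathDeriv hm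
  have cF : ∀ (u : SobE ⌊s⌋₊ 0 T) (Z : L2),
      Continuous (dataCurve η₀ (path hm u) (pathDeriv hm u) Z) := fun u Z =>
    continuous_const.add ((continuous_forcing (cX u) (cX' u) Z).sub continuous_const)
  have key := tendsto_isMild hT.le
    (tendstoUniformlyOn_dataCurve hT.le η₀ hX (fun p => cX _) (cX _) hX' (fun p => cX' _) (cX' _) hZ)
    (tendstoUniformlyOn_bottomCurve hX (fun p => cX _) (cX _) hZ)
    (fun p => cF _ _) (fun p => continuous_bottomCurve (cX _) _) (cF _ _)
    (continuous_bottomCurve (cX _) _)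
    (hF'.mono fun p hp =>
      (controlRep_of_represents hT hm (hw p hp).1 (hw p hp).2).isMild_solution hT η₀)
    (hc₀.isMild_solution hT η₀)
  exact (((continuous_setIntegral_sq (Icc a b)).tendsto _).comp key).neg

/-- An ultrafilter on the range lifts to one on the ball, along which the cost converges to an
attained value. No topology on the set of controls is needed. -/
lemma isCompact_image_cost {s T M : ℝ} (hs : 2 ≤ s) (hT : 0 < T) (a b : ℝ) (η₀ : L2) :
    IsCompact (cost T a b η₀ '' controlBall s T M) := by
  rw [isCompact_iff_ultrafilter_le_nhds]
  intro G hG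
  rw [le_principal_iff] at hG
  obtain ⟨F, hF, rfl⟩ : ∃ F : Ultrafilter ((ℝ → ℝ) × (ℝ → ℝ)), controlBall s T M ∈ F ∧
      F.map (cost T a b η₀) = G :=
    ⟨Ultrafilter.ofComapInfPrincipal hG, Ultrafilter.ofComapInfPrincipal_mem hG,
      Ultrafilter.ofComapInfPrincipal_eq_of_map hG⟩
  obtain ⟨p₀, hp₀, hlim⟩ := exists_tendsto_cost hs hT a b η₀ F hF
  exact ⟨_, ⟨p₀, hp₀, rfl⟩, hlim⟩

end Cost

end

/-! ### Well-posedness and existence of an optimal control -/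

theorem theorem2 (T a b : ℝ) (hT : 0 < T) (hab : a ≤ b)
    (η₀ : Lp ℝ 2 (volume : Measure ℝ)) (ε M : ℝ) (hε : 0 < ε) (hM : 0 < M) :
    (∀ p ∈ controlBall (2 + ε) T M,
      ∃ η, IsSolution T η₀ (bottom p) η ∧
        ∀ η', IsSolution T η₀ (bottom p) η' → EqOn η' η (Icc 0 T)) ∧
    ∃ p ∈ controlBall (2 + ε) T M,
      IsGLB (cost T a b η₀ '' controlBall (2 + ε) T M) (cost T a b η₀ p) := by
  have hs : 2 ≤ 2 + ε := by linarith
  constructor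
  · intro p hp
    obtain ⟨w, hu, hv⟩ := exists_represents_of_mem_controlBall hp
    exact (controlRep_of_represents hT (Nat.le_floor hs) hu hv).existsUnique_solution hT η₀
  · obtain ⟨y, hy⟩ := (isCompact_image_cost (M := M) hs hT a b η₀).exists_isLeast
      ⟨_, (0, 0), zero_mem_controlBall, rfl⟩
    obtain ⟨p, hp, rfl⟩ := hy.1
    exact ⟨p, hp, hy.isGLB⟩
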